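/- **Setting.** Let $\Omega$ be a compact connected metric graph with finitely many edges (of positive lengths) and no vertices of valence $2$; $\Gamma$ denotes the set of vertices of valence $1$. Let $\varnothing\subseteq\Sigma\subseteq\Gamma$, $T>0$, and $\mathcal H=L_2(\Omega)$ (real). *Impulses and waves.* For $\gamma\in\Gamma$ a unit impulse leaves $\gamma$ at time $0$ and moves with speed $1$; on reaching a vertex of valence $\mu\ge 3$, an impulse of amplitude $a$ is replaced by a reflected impulse of amplitude $\frac{2-\mu}{\mu}a$ and impulses of amplitude $\frac2\mu a$ along the other edges; at a vertex of valence $1$ it is reflected with amplitude $-a$; amplitudes superpose. Let $a_\gamma(x,t)$ be the total amplitude at $x$ at time $t$, and $H_\gamma\subset\Omega\times[0,\infty)$ the closed support of the impulses. For $\varphi\in L_2[0,T]$ the wave is $u^\varphi_\gamma(x,s)=\sum_{t\le s}a_\gamma(x,t)\varphi(s-t)$; $\mathcal U_\gamma^s=\{u_\gamma^\varphi(\cdot,s)\}\subset\mathcal H$, $P_\gamma^s$ is the orthogonal projector onto $\mathcal U^s_\gamma$, the (shifted) eikonal is $E_\gamma=\int_0^T(s+1)\,dP_\gamma^s$, and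 $\mathfrak E$ is the $C^*$-algebra $\vee\{E_\gamma\mid\gamma\in\Sigma\}$ (here $\vee S$ is the smallest norm-closed, real, not necessarily unital $*$-subalgebra containing $S$). *Families.* Let $H=\bigcup_{\gamma\in\Sigma}H_\gamma\cap(\Omega\times[0,T])$, with projections $\pi(x,t)=x$, $\rho(x,t)=t$. A lattice $\mathcal L[h]$ is a class of the equivalence relation on $H$ generated by "same point or same time"; $\Lambda[x]=\pi(\mathcal L[\pi^{-1}(x)])$, $\Xi[x]=\rho(\mathcal L[\pi^{-1}(x)])$. Corner points of $H$ are those lying over vertices, those with $t=T$, and those where impulses running in opposite directions meet. The dividing points are the points of $\pi(\mathcal L[\text{corner points}])$, together with those interior points of edges arbitrarily near which there are two distinct points of that edge with the same $\Lambda$. A cell is a maximal open interval of non-dividing points of $\pi(H)$. Assume that there are finitely many cells. They are grouped into families $\Phi^1,\dots,\Phi^J$, two cells being in the same family iff the sets $\Lambda[x]$, $x$ in the one, cover the other. All cells $\omega^j_1,\dots,\omega^j_{m_j}$ of $\Phi^j$ have the same length $\epsilon_j$. Let $x^j(r)$, $0<r<\epsilon_j$, be the point at distance $r$ from a chosen end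 of a chosen cell of $\Phi^j$, and $x^j_k(r)$ the point of $\Lambda[x^j(r)]$ in $\omega^j_k$; put $(Uy)_j(r)=(y(x^j_k(r)))_{k=1}^{m_j}$ for $y\in\mathcal H$. *Matrix algebras.* For $r\in(0,\epsilon_j)$ let $t_1<\dots<t_{n_j}$ be the points of $\Xi[x^j(r)]$. The vectors $\alpha^i_{\gamma j}=(a_\gamma(x^j_k(r),t_i))_{k=1}^{m_j}\in\mathbb R^{m_j}$ do not depend on $r$. Let $\beta^1_{\gamma j},\dots,\beta^{n_j}_{\gamma j}$ result from them by Gram–Schmidt orthonormalization (with $\beta^i=0$ if $\alpha^i$ lies in the span of the preceding vectors), $P^i_{\gamma j}=\langle\cdot,\beta^i_{\gamma j}\rangle\beta^i_{\gamma j}$, and $\mathfrak P_j=\vee\{P^i_{\gamma j}\mid\gamma\in\Sigma,\ 1\le i\le n_j\}\subseteq\mathbb M^{m_j}$, where $\mathbb M^{m}$ is the algebra of real $m\times m$ matrices. **Statement.** (0) For each $A\in\mathfrak E$ there is exactly one $e=(e_j)_j\in\bigoplus_jC([0,\epsilon_j];\mathbb M^{m_j})$ such that $UAy=e\cdot Uy$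 for all $y\in\mathcal H$. Denote by $U\mathfrak EU^{-1}$ the set of all these $e$, and for $\mathbf r=(r_1,\dots,r_J)$, $r_j\in[0,\epsilon_j]$, put $e(\mathbf r)=\bigoplus_je_j(r_j)$ and $(U\mathfrak EU^{-1})(\mathbf r)=\vee\{(UE_\gamma U^{-1})(\mathbf r)\mid\gamma\in\Sigma\}$. (1) Let $\gamma\in\Sigma$, $1\le j\le J$, $1\le i\le n_j$, and let $\mathbf r,\mathbf r'$ be points with $r_j\in(0,\epsilon_j)$ and $r_j\ne r_j'$. Then there is $e\in U\mathfrak EU^{-1}$ such that $e(\mathbf r)$ has $j$-th block $P^i_{\gamma j}$ and zero other blocks, and $e(\mathbf r')=0$. (2) If $r_j\notin\{0,\epsilon_j\}$ for all $j$, then $(U\mathfrak EU^{-1})(\mathbf r)=\bigoplus_{j=1}^J\mathfrak P_j$. (3) If $0<a_j\le b_j<\epsilon_j$ for a fixed $j$, then the restrictions to $[a_j,b_j]$ of the $j$-th blocks of the elements of $U\mathfrak EU^{-1}$ form the whole algebra $C([a_j,b_j];\mathfrak P_j)$. (4) There are no links between the blocks away from the endpoints: if $0<a_j\le b_j<\epsilon_j$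 for all $j$, then the restrictions of the elements of $U\mathfrak EU^{-1}$ to $r_j\in[a_j,b_j]$, $j=1,\dots,J$, form the whole algebra $\bigoplus_{j=1}^JC([a_j,b_j];\mathfrak P_j)$. -/

import Mathlib

open Filter Topology MeasureTheory

/-- `⋁ S`: the smallest norm-closed (real, not necessarily unital) star subalgebra containing `S`. -/
noncomputable def cstarGen {A : Type*} [NonUnitalRing A] [StarRing A] [TopologicalSpace A]
    [IsTopologicalRing A] [ContinuousStar A] [Module ℝ A] [IsScalarTower ℝ A A]
    [SMulCommClass ℝ A A] [StarModule ℝ A] [ContinuousConstSMul ℝ A] (S : Set A) :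
    NonUnitalStarSubalgebra ℝ A :=
  (NonUnitalStarAlgebra.adjoin ℝ S).topologicalClosure

/-- A compact connected metric graph with vertex set `V` and edge set `E`.  The edge `e` is
parametrised by its length `s ∈ [0, len e]`, `s = 0` being the end `ends e false` and `s = len e`
the end `ends e true`.  Loops and multiple edges are allowed; a loop counts twice in the valence.
There are no vertices of valence `2`. -/
structure MetricGraph (V E : Type*) where
  ends : E → Bool → V
  len : E → ℝ
  len_pos : ∀ e, 0 < len e
  connected : ∀ v w : V,
    Relation.ReflTransGen (fun a b => ∃ e c, ends e c = a ∧ ends e (!c) = b) v w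
  valence_ne_two : ∀ v : V, Nat.card {d : E × Bool // ends d.1 d.2 = v} ≠ 2

namespace MetricGraph

variable {V E : Type*} (G : MetricGraph V E)

/-- The number of edge ends at the vertex `v`. -/
noncomputable def valence (v : V) : ℕ := Nat.card {d : E × Bool // G.ends d.1 d.2 = v}

/-- The set `Γ` of boundary vertices. -/
def boundary : Set V := {v | G.valence v = 1}

/-- An oriented edge `(e, b)` starts at the end `b` of `e` and runs to the other end. -/
def source (d : E × Bool) : V := G.ends d.1 d.2

/-- The vertex to which an oriented edge runs. -/
def target (d : E × Bool) : V := G.ends d.1 (!d.2)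

/-- Distance from the starting end of the oriented edge `d` to the point with coordinate `s`. -/
noncomputable def offset (d : E × Bool) (s : ℝ) : ℝ := if d.2 then G.len d.1 - s else s

/-! ### Impulse dynamics -/

open Classical in
/-- Amplitude with which a unit impulse that arrives along `d'` is sent out along `d`:
`(2 - μ) / μ` for the reflected and `2 / μ` for a transmitted impulse at an interior vertex of
valence `μ`, and `-1` at a boundary vertex. -/
noncomputable def scatter (d' d : E × Bool) : ℝ :=
  if G.valence (G.source d) = 1 then -1
  else 2 / (G.valence (G.source d) : ℝ) - if d = (d'.1, !d'.2) then 1 else 0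

open Classical in
/-- Amplitude sent into the oriented edge `d` at time `t` by impulses which have passed through
exactly `k` vertices since a unit impulse was sent out from `γ` at time `0`. -/
noncomputable def emit [Fintype E] (γ : V) : ℕ → E × Bool → ℝ → ℝ
  | 0, d, t => if G.source d = γ ∧ t = 0 then 1 else 0
  | k + 1, d, t => ∑ d' : E × Bool,
      if G.target d' = G.source d then G.scatter d' d * emit γ k d' (t - G.len d'.1) else 0

variable [Fintype E]

/-- Total amplitude sent into the oriented edge `d` at time `t` (superposition; for each `t` only
finitely many terms are nonzero). -/
noncomputable def pulse (γ : V) (d : E × Bool) (t : ℝ) : ℝ := ∑ᶠ k : ℕ, G.emit γ k d t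

/-- Amplitude of the impulse that runs along `d` and is at the coordinate `s` at time `t`. -/
noncomputable def run (γ : V) (d : E × Bool) (s t : ℝ) : ℝ := G.pulse γ d (t - G.offset d s)

/-- The amplitude `a_γ(x, t)` at the point `x = (e, s)` of an open edge. -/
noncomputable def amp (γ : V) (x : E × ℝ) (t : ℝ) : ℝ := ∑ b : Bool, G.run γ (x.1, b) x.2 t

/-- The hydra `H_γ`, i.e. the (closed) space-time support of the impulses.  Points of the graph are
the vertices `Sum.inl v` and the points `Sum.inr (e, s)`, `0 < s < len e`, of the open edges. -/
def hydra (γ : V) : Set ((V ⊕ E × ℝ) × ℝ) :=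
  {h | match h with
    | (Sum.inl v, t) => ∃ d, (G.source d = v ∧ G.pulse γ d t ≠ 0) ∨
        (G.target d = v ∧ G.pulse γ d (t - G.len d.1) ≠ 0)
    | (Sum.inr x, t) => 0 < x.2 ∧ x.2 < G.len x.1 ∧ ∃ b, G.run γ (x.1, b) x.2 t ≠ 0}

/-- The truncated hydra `H_Σ^T`. -/
def hydraT (Sig : Set V) (T : ℝ) : Set ((V ⊕ E × ℝ) × ℝ) :=
  {h | h.2 ≤ T ∧ ∃ γ ∈ Sig, h ∈ G.hydra γ}

/-! ### Lattices, determination sets, critical points, cells -/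

/-- The equivalence on the truncated hydra generated by "same point or same time". -/
def Linked (Sig : Set V) (T : ℝ) : (V ⊕ E × ℝ) × ℝ → (V ⊕ E × ℝ) × ℝ → Prop :=
  Relation.ReflTransGen fun h h' =>
    h ∈ G.hydraT Sig T ∧ h' ∈ G.hydraT Sig T ∧ (h.1 = h'.1 ∨ h.2 = h'.2)

/-- The lattice `𝓛_Σ[B]`. -/
def lattice (Sig : Set V) (T : ℝ) (B : Set ((V ⊕ E × ℝ) × ℝ)) : Set ((V ⊕ E × ℝ) × ℝ) :=
  {h | h ∈ G.hydraT Sig T ∧ ∃ h₀ ∈ B ∩ G.hydraT Sig T, G.Linked Sig T h₀ h}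

/-- `Λ_Σ[A] = π(𝓛_Σ[π⁻¹(A)])`; `Λ_Σ[{x}]` is the determination set of `x`. -/
def det (Sig : Set V) (T : ℝ) (A : Set (V ⊕ E × ℝ)) : Set (V ⊕ E × ℝ) :=
  Prod.fst '' G.lattice Sig T {h | h.1 ∈ A}

/-- `Ξ_Σ[A] = ρ(𝓛_Σ[π⁻¹(A)])`. -/
def times (Sig : Set V) (T : ℝ) (A : Set (V ⊕ E × ℝ)) : Set ℝ :=
  Prod.snd '' G.lattice Sig T {h | h.1 ∈ A}

/-- The corner points of `H_Σ^T`: points over vertices, points at the final time, and points where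
two impulses running in opposite directions meet (self-intersections of a hydra and transversal
intersections of two hydras). -/
def corner (Sig : Set V) (T : ℝ) : Set ((V ⊕ E × ℝ) × ℝ) :=
  {h | h ∈ G.hydraT Sig T ∧
    ((∃ v, h.1 = Sum.inl v) ∨ h.2 = T ∨
      ∃ e s, h.1 = Sum.inr (e, s) ∧ ∀ b : Bool, ∃ γ ∈ Sig, G.run γ (e, b) s h.2 ≠ 0)}

/-- The critical points `Θ_Σ = π(𝓛_Σ[Corn H_Σ^T])`. -/
def critical (Sig : Set V) (T : ℝ) : Set (V ⊕ E × ℝ) :=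
  Prod.fst '' G.lattice Sig T (G.corner Sig T)

/-- Points of an open edge near which the determination sets do not separate points.  Such a point
would be interior to an interval which a determination set meets twice. -/
def fold (Sig : Set V) (T : ℝ) : Set (V ⊕ E × ℝ) :=
  {x | ∃ e s, x = Sum.inr (e, s) ∧ ∀ δ > 0, ∃ s' s'' : ℝ, |s' - s| < δ ∧ |s'' - s| < δ ∧
    s' ≠ s'' ∧ Sum.inr (e, s'') ∈ G.det Sig T {Sum.inr (e, s')}}

/-- The points dividing the part of the graph captured by the waves. -/
def dividing (Sig : Set V) (T : ℝ) : Set (V ⊕ E × ℝ) := G.critical Sig T ∪ G.fold Sig T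

/-- The regular points: the remaining points of `π(H_Σ^T)`, which is the closure of the metric
neighbourhood of `Σ` of radius `T`. -/
def regular (Sig : Set V) (T : ℝ) : Set (V ⊕ E × ℝ) :=
  (Prod.fst '' G.hydraT Sig T) \ G.dividing Sig T

/-- The point of the closed edge `e` with coordinate `s`. -/
noncomputable def pointAt (e : E) (s : ℝ) : V ⊕ E × ℝ :=
  if s ≤ 0 then Sum.inl (G.ends e false)
  else if G.len e ≤ s then Sum.inl (G.ends e true) else Sum.inr (e, s)

/-- The open interval of the edge `c.1` between the coordinates `c.2.1` and `c.2.2`. -/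
def interval (c : E × ℝ × ℝ) : Set (V ⊕ E × ℝ) :=
  {x | ∃ s ∈ Set.Ioo c.2.1 c.2.2, x = Sum.inr (c.1, s)}

/-- A cell: a maximal interval of regular points. -/
def IsCell (Sig : Set V) (T : ℝ) (c : E × ℝ × ℝ) : Prop :=
  0 ≤ c.2.1 ∧ c.2.1 < c.2.2 ∧ c.2.2 ≤ G.len c.1 ∧
    (interval c : Set (V ⊕ E × ℝ)) ⊆ G.regular Sig T ∧
    G.pointAt c.1 c.2.1 ∈ G.dividing Sig T ∧ G.pointAt c.1 c.2.2 ∈ G.dividing Sig T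

/-- A numbering of the families `Φ¹, …, Φᴶ` and of the cells of each of them, with the choice, for
each family, of the cell end from which the parameter `r` is counted.  Two cells belong to the same
family iff the determination sets of the points of the one cover the other. -/
structure Parametrization (Sig : Set V) (T : ℝ) where
  /-- number of families -/
  J : ℕ
  /-- number of cells of a family -/
  m : Fin J → ℕ
  cell : (j : Fin J) → Fin (m j) → E × ℝ × ℝ
  isCell : ∀ j k, G.IsCell Sig T (cell j k)
  cell_injective : Function.Injective fun p : Σ j, Fin (m j) => cell p.1 p.2
  cell_surjective : ∀ c, G.IsCell Sig T c → ∃ j k, cell j k = c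
  family_iff : ∀ j k j' k',
    (interval (cell j' k') : Set (V ⊕ E × ℝ)) ⊆ G.det Sig T (interval (cell j k)) ↔ j = j'
  /-- the cell by which the family is parametrised -/
  base : (j : Fin J) → Fin (m j)
  /-- `r` is counted from the left end of the base cell if `false`, from the right one if `true` -/
  rev : Fin J → Bool

/-! ### Waves, reachable sets, eikonals -/

/-- The real Hilbert space `𝓗 = L₂(Ω) = ⨁_e L₂(e)`. -/
def L2 : Type _ := PiLp 2 fun e : E => Lp ℝ 2 (volume.restrict (Set.Ioo 0 (G.len e)))

noncomputable instance : NormedAddCommGroup G.L2 :=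
  inferInstanceAs
    (NormedAddCommGroup (PiLp 2 fun e : E => Lp ℝ 2 (volume.restrict (Set.Ioo 0 (G.len e)))))

noncomputable instance : InnerProductSpace ℝ G.L2 :=
  inferInstanceAs
    (InnerProductSpace ℝ (PiLp 2 fun e : E => Lp ℝ 2 (volume.restrict (Set.Ioo 0 (G.len e)))))

instance : CompleteSpace G.L2 :=
  inferInstanceAs
    (CompleteSpace (PiLp 2 fun e : E => Lp ℝ 2 (volume.restrict (Set.Ioo 0 (G.len e)))))

variable {G} in
/-- The value `y(x)` at the point `x = (e, s)` of an open edge (for almost every `s`). -/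
noncomputable def L2.val (y : G.L2) (x : E × ℝ) : ℝ :=
  (WithLp.ofLp (p := 2) (V := ∀ e : E, Lp ℝ 2 (volume.restrict (Set.Ioo 0 (G.len e)))) y x.1) x.2

/-- The wave `u^f(x, t)`, `f = δ_γ φ`: the convolution in time of the impulses with `φ`. -/
noncomputable def wave (γ : V) (φ : ℝ → ℝ) (t : ℝ) (x : E × ℝ) : ℝ :=
  ∑ᶠ s ∈ Set.Icc 0 t, G.amp γ x s * φ (t - s)

/-- The reachable set `𝓤_γ^s`, for controls `φ ∈ L₂[0, T]`. -/
def reachable (T : ℝ) (γ : V) (s : ℝ) : Set G.L2 :=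
  {y | ∃ φ : ℝ → ℝ, MemLp φ 2 (volume.restrict (Set.Icc 0 T)) ∧
    ∀ e, ∀ᵐ x ∂volume.restrict (Set.Ioo 0 (G.len e)), y.val (e, x) = G.wave γ φ s (e, x)}

/-- The orthogonal projector `P_γ^s` in `𝓗` onto the subspace `𝓤_γ^s`. -/
noncomputable def proj (T : ℝ) (γ : V) (s : ℝ) : G.L2 →L[ℝ] G.L2 :=
  (Submodule.span ℝ (G.reachable T γ s)).topologicalClosure.starProjection

/-- The eikonal `∫₀ᵀ s dP_γ^s`, as the limit in operator norm of Riemann-Stieltjes sums. -/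
noncomputable def eikonal (T : ℝ) (γ : V) : G.L2 →L[ℝ] G.L2 :=
  limUnder atTop fun N : ℕ => ∑ k ∈ Finset.range N,
    (((k : ℝ) + 1) * T / N) • (G.proj T γ (((k : ℝ) + 1) * T / N) - G.proj T γ ((k : ℝ) * T / N))

/-- The shifted eikonal `∫₀ᵀ (s + 1) dP_γ^s`. -/
noncomputable def shiftedEikonal (T : ℝ) (γ : V) : G.L2 →L[ℝ] G.L2 :=
  G.eikonal T γ + G.proj T γ T

/-- The eikonal algebra `𝔈_Σ^T`. -/
noncomputable def eikonalAlgebra (Sig : Set V) (T : ℝ) :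
    NonUnitalStarSubalgebra ℝ (G.L2 →L[ℝ] G.L2) :=
  cstarGen (G.shiftedEikonal T '' Sig)

namespace Parametrization

variable {G} {Sig : Set V} {T : ℝ} (D : G.Parametrization Sig T)

/-- The common length `ε_j` of the cells of the `j`-th family. -/
noncomputable def ε (j : Fin D.J) : ℝ :=
  (D.cell j (D.base j)).2.2 - (D.cell j (D.base j)).2.1

/-- The point `x(r)` of the base cell of the `j`-th family. -/
noncomputable def basePoint (j : Fin D.J) (r : ℝ) : E × ℝ :=
  ((D.cell j (D.base j)).1,
    if D.rev j then (D.cell j (D.base j)).2.2 - r else (D.cell j (D.base j)).2.1 + r)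

/-- The coordinate of `x_k(r)`. -/
noncomputable def coord (j : Fin D.J) (k : Fin (D.m j)) (r : ℝ) : ℝ :=
  Classical.epsilon fun s => s ∈ Set.Ioo (D.cell j k).2.1 (D.cell j k).2.2 ∧
    Sum.inr ((D.cell j k).1, s) ∈ G.det Sig T {Sum.inr (D.basePoint j r)}

/-- `x_k(r)`: the point of the determination set of `x(r)` in the `k`-th cell of the family. -/
noncomputable def pt (j : Fin D.J) (k : Fin (D.m j)) (r : ℝ) : E × ℝ :=
  ((D.cell j k).1, D.coord j k r)

/-! ### Amplitude vectors and the matrix algebras -/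

open Classical in
/-- The (finite) set of times `Ξ_Σ[x(r)]` at the midpoint `r = ε_j / 2`.  (The vectors below do not
depend on the choice of `r ∈ (0, ε_j)`.) -/
noncomputable def timeSet (j : Fin D.J) : Finset ℝ :=
  if h : (G.times Sig T {Sum.inr (D.basePoint j (D.ε j / 2))}).Finite then h.toFinset else ∅

/-- The number `n_j` of time cells of the `j`-th family. -/
noncomputable def n (j : Fin D.J) : ℕ := (D.timeSet j).card

/-- The times `t_1 < … < t_n` of `timeSet`. -/
noncomputable def time (j : Fin D.J) (i : Fin (D.n j)) : ℝ :=
  (D.timeSet j).orderEmbOfFin rfl i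

/-- The amplitude vector `α^i_{γ j} = (a_γ(x_k, t_i))_k`. -/
noncomputable def α (γ : V) (j : Fin D.J) (i : Fin (D.n j)) : EuclideanSpace ℝ (Fin (D.m j)) :=
  WithLp.toLp 2 fun k => G.amp γ (D.pt j k (D.ε j / 2)) (D.time j i)

/-- The vectors `β^i_{γ j}`, by the Gram-Schmidt procedure (`0` if `α^i` is in the span of the
preceding vectors). -/
noncomputable def β (γ : V) (j : Fin D.J) (i : Fin (D.n j)) : EuclideanSpace ℝ (Fin (D.m j)) :=
  InnerProductSpace.gramSchmidtNormed ℝ (D.α γ j) i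

/-- The projector `P^i_{γ j} = ⟨·, β^i⟩ β^i` as a matrix. -/
noncomputable def P (γ : V) (j : Fin D.J) (i : Fin (D.n j)) :
    Matrix (Fin (D.m j)) (Fin (D.m j)) ℝ :=
  Matrix.of fun k l => D.β γ j i k * D.β γ j i l

/-- The matrix algebra `𝔓_j` generated by the projectors `P^i_{γ j}`, `γ ∈ Σ`. -/
noncomputable def blockAlgebra (j : Fin D.J) :
    NonUnitalStarSubalgebra ℝ (Matrix (Fin (D.m j)) (Fin (D.m j)) ℝ) :=
  cstarGen {M | ∃ γ ∈ Sig, ∃ i, M = D.P γ j i}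

/-! ### The parametrised algebra -/

/-- The algebra `⨁_j C([0, ε_j]; 𝕄^{m_j})`. -/
abbrev Symbols : Type :=
  (j : Fin D.J) → C(Set.Icc (0 : ℝ) (D.ε j), Matrix (Fin (D.m j)) (Fin (D.m j)) ℝ)

/-- `U A U⁻¹` is the operator of multiplication by `F`, where `(U y)_j(r) = (y(x_k(r)))_k`:
that is, `U A y = F · U y` for all `y ∈ 𝓗`. -/
def IsSymbol (A : G.L2 →L[ℝ] G.L2) (F : D.Symbols) : Prop :=
  ∀ (y : G.L2) (j : Fin D.J), ∀ᵐ r : ℝ, ∀ (hr : r ∈ Set.Icc 0 (D.ε j)) (k : Fin (D.m j)),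
    (A y).val (D.pt j k r) = ∑ l, F j ⟨r, hr⟩ k l * y.val (D.pt j l r)

/-- `U 𝔈_Σ^T U⁻¹`, its elements being identified with continuous matrix functions. -/
def modelAlgebra : Set D.Symbols := {F | ∃ A ∈ G.eikonalAlgebra Sig T, D.IsSymbol A F}

/-- The fibre algebra `(U 𝔈_Σ^T U⁻¹)(r)`, generated by the matrices `(U E_γ^T U⁻¹)(r)`, `γ ∈ Σ`. -/
noncomputable def fibreAlgebra (r : ∀ j, Set.Icc (0 : ℝ) (D.ε j)) :
    NonUnitalStarSubalgebra ℝ (∀ j, Matrix (Fin (D.m j)) (Fin (D.m j)) ℝ) :=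
  cstarGen {M | ∃ γ ∈ Sig, ∃ F : D.Symbols, D.IsSymbol (G.shiftedEikonal T γ) F ∧
    M = fun j => F j (r j)}

/-- The inclusion of `[a, b]` into `[0, ε_j]`. -/
def incl {j : Fin D.J} {a b : ℝ} (ha : 0 < a) (hb : b < D.ε j) (s : Set.Icc a b) :
    Set.Icc (0 : ℝ) (D.ε j) :=
  ⟨s, ha.le.trans s.2.1, s.2.2.trans hb.le⟩

end Parametrization

end MetricGraph

/-! After the parametrisation everything is explicit. The projector onto the waves from `γ`
reachable at time `s` acts at `r`, in the `j`-th block, as the sum of those `P γ j i` whose time has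
come, `timeFun j i r ≤ s` (`hasSymbol_proj`). Integrating `s + 1` against this increasing family
shows that the shifted eikonal is multiplication by `∑ i, (timeFun j i r + 1) • P γ j i`
(`hasSymbol_shiftedEikonal`).

The times are affine in `r` with slope ±1, and the decisive fact is `timeFun_inj`: over the open
intervals `(0, ε_j)` the ranges of the time functions of all pairs `(j, i)` are pairwise disjoint.
Hence a continuous function that vanishes outside one shifted range, applied to the eikonal,
isolates one projector in one block, multiplied by any continuous `g` vanishing outside `(0, ε_j)`
(`exists_localized`). A tent function `g` gives (1). Sums and products of such elements give `f r •
M` on interior segments for every `M` in the algebra generated by the projectors, and since that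
algebra is finite-dimensional every continuous function with values in it is obtained
(`exists_extension`). The reverse inclusions in (2)-(4) come from evaluation at a point: entries of
a symbol are bounded by the operator norm (`IsSymbol.abs_le`), so evaluation passes from the
generators to their closure. The same bound gives uniqueness in (0).

The geometry behind `timeFun_inj`: an impulse can leave its edge or the time window only through a
corner, so along an interval free of critical points each point of a lattice moves with unit speed
(`Linked.extend`). As folds are excluded as well, a lattice has at most one point over a cell
(`IsCell.eq_of_rel`), and cells that share a lattice are isometric (`IsCell.exists_isometry`). Two
impulses at the same time lie on one lattice, so a time determines the family and the parameter.

For the projectors: because the time ranges are disjoint, a control can be concentrated on one of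
them, and it then produces the vector `α` times an arbitrary function cut off to the arrived part
(`sum_embed_mem_reachable`). The order of the times does not depend on `r` (`timeFun_strictMono`),
so a single Gram-Schmidt procedure serves all `r` and respects the cut-off. The scattering
coefficients never enter. -/

namespace MetricGraph

variable {V E : Type*} (G : MetricGraph V E)

/-! ### Impulses: finiteness and motion with unit speed. -/

/-- The rate of change of the time along an impulse running along an edge in direction `b`. -/
def dirSign (b : Bool) : ℝ := if b then -1 else 1

lemma dirSign_eq (b : Bool) : dirSign b = 1 ∨ dirSign b = -1 := by cases b <;> simp [dirSign]

lemma offset_add (d : E × Bool) (s u : ℝ) :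
    G.offset d (s + u) = G.offset d s + dirSign d.2 * u := by
  rcases d with ⟨e, b⟩
  cases b <;> simp [offset, dirSign]
  ring

lemma offset_pos {d : E × Bool} {s : ℝ} (h0 : 0 < s) (h1 : s < G.len d.1) :
    0 < G.offset d s := by
  rcases d with ⟨e, b⟩
  cases b <;> simp [offset] <;> assumption

variable [Fintype E]

lemma exists_len_lower_bound : ∃ δ > 0, ∀ e, δ ≤ G.len e := by
  rcases isEmpty_or_nonempty E with h | h
  · exact ⟨1, one_pos, fun e => h.elim e⟩
  · obtain ⟨e, he⟩ := Finite.exists_min G.len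
    exact ⟨G.len e, G.len_pos e, he⟩

/-- Each passage through a vertex costs at least the shortest edge length. Consequently only
finitely many generations of impulses matter up to time `T`, and none exist at negative times. -/
lemma emit_ne_zero_le {δ : ℝ} (hδ : ∀ e, δ ≤ G.len e) (γ : V) (k : ℕ) :
    ∀ (d : E × Bool) (t : ℝ), G.emit γ k d t ≠ 0 → k * δ ≤ t := by
  induction k with
  | zero =>
    intro d t h
    have : G.source d = γ ∧ t = 0 := by
      by_contra hc
      exact h (by simp only [emit, hc, if_false])
    simp [this.2]
  | succ k ih =>
    intro d t h
    obtain ⟨d', -, hd'⟩ := Finset.exists_ne_zero_of_sum_ne_zero h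
    have h1 : G.emit γ k d' (t - G.len d'.1) ≠ 0 := by
      intro h0
      simp [h0] at hd'
    have := ih d' _ h1
    have := hδ d'.1
    push_cast
    linarith

lemma emit_support_finite (γ : V) (k : ℕ) :
    ∀ d : E × Bool, {t | G.emit γ k d t ≠ 0}.Finite := by
  induction k with
  | zero =>
    intro d
    refine (Set.finite_singleton (0 : ℝ)).subset fun t h => ?_
    by_contra hc
    exact h (by simp only [emit]; rw [if_neg (fun h' => hc h'.2)])
  | succ k ih =>
    intro d
    refine (Set.finite_iUnion fun d' : E × Bool => (ih d').image (· + G.len d'.1)).subset ?_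
    intro t h
    obtain ⟨d', -, hd'⟩ := Finset.exists_ne_zero_of_sum_ne_zero h
    refine Set.mem_iUnion.2 ⟨d', t - G.len d'.1, ?_, by simp⟩
    intro h0
    simp [h0] at hd'

lemma exists_emit_ne_zero {γ : V} {d : E × Bool} {t : ℝ} (h : G.pulse γ d t ≠ 0) :
    ∃ k, G.emit γ k d t ≠ 0 := by
  by_contra! hc
  exact h (by simp [pulse, hc])

lemma pulse_of_neg {γ : V} {d : E × Bool} {t : ℝ} (ht : t < 0) : G.pulse γ d t = 0 := by
  by_contra h
  obtain ⟨k, hk⟩ := G.exists_emit_ne_zero h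
  obtain ⟨δ, hδ, hl⟩ := G.exists_len_lower_bound
  have := G.emit_ne_zero_le hl γ k d t hk
  have : 0 ≤ (k : ℝ) * δ := by positivity
  linarith

lemma pulse_times_finite (γ : V) (d : E × Bool) (T : ℝ) :
    {t | t ≤ T ∧ G.pulse γ d t ≠ 0}.Finite := by
  obtain ⟨δ, hδ, hl⟩ := G.exists_len_lower_bound
  refine ((Set.finite_Iic ⌊T / δ⌋₊).biUnion fun k _ => G.emit_support_finite γ k d).subset ?_
  rintro t ⟨ht, hp⟩
  obtain ⟨k, hk⟩ := G.exists_emit_ne_zero hp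
  have := G.emit_ne_zero_le hl γ k d t hk
  refine Set.mem_biUnion (x := k) ?_ hk
  exact Nat.le_floor ((le_div_iff₀ hδ).2 (by linarith))

/-- The offset and the time change by the same amount. Inside an edge this is all the dynamics that
is used. -/
lemma run_shift (γ : V) (e : E) (b : Bool) (s t u : ℝ) :
    G.run γ (e, b) (s + u) (t + dirSign b * u) = G.run γ (e, b) s t := by
  simp only [run, offset_add]
  congr 1
  ring

lemma time_pos_of_run_ne_zero {γ : V} {e : E} {b : Bool} {s t : ℝ} (h0 : 0 < s)
    (h1 : s < G.len e) (h : G.run γ (e, b) s t ≠ 0) : 0 < t := by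
  by_contra! hc
  have := G.offset_pos (d := (e, b)) h0 h1
  exact h (G.pulse_of_neg (by linarith))

/-- At time `t` an impulse from `Sig`, running in direction `b`, is at the coordinate `s` of the
edge `e`. -/
def Live (Sig : Set V) (T : ℝ) (e : E) (b : Bool) (s t : ℝ) : Prop :=
  t ≤ T ∧ ∃ γ ∈ Sig, G.run γ (e, b) s t ≠ 0

variable {G} {Sig : Set V} {T : ℝ}

/-- `run` is given by a formula in `s` that makes sense on the whole line, so only the final time
limits the shift; staying on the edge is a separate matter. -/
lemma Live.shift {e : E} {b : Bool} {s t u : ℝ} (h : G.Live Sig T e b s t)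
    (hu : t + dirSign b * u ≤ T) : G.Live Sig T e b (s + u) (t + dirSign b * u) := by
  obtain ⟨-, γ, hγ, h⟩ := h
  exact ⟨hu, γ, hγ, by rwa [run_shift]⟩

omit [Fintype E] in
lemma pointAt_of_mem {e : E} {s : ℝ} (h0 : 0 < s) (h1 : s < G.len e) :
    G.pointAt e s = Sum.inr (e, s) := by
  simp [pointAt, not_le.2 h0, not_le.2 h1]

lemma Live.mem_hydraT {e : E} {b : Bool} {s t : ℝ} (h : G.Live Sig T e b s t) (h0 : 0 ≤ s)
    (h1 : s ≤ G.len e) : (G.pointAt e s, t) ∈ G.hydraT Sig T := by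
  obtain ⟨hT, γ, hγ, h⟩ := h
  refine ⟨hT, γ, hγ, ?_⟩
  have hl := G.len_pos e
  rcases h0.eq_or_lt with rfl | h0
  · have hp : G.pointAt e 0 = Sum.inl (G.ends e false) := by simp [pointAt]
    rw [hp]
    cases b
    · exact ⟨(e, false), Or.inl ⟨rfl, by simpa [run, offset] using h⟩⟩
    · exact ⟨(e, true), Or.inr ⟨rfl, by simpa [run, offset] using h⟩⟩
  rcases h1.eq_or_lt with rfl | h1
  · have hp : G.pointAt e (G.len e) = Sum.inl (G.ends e true) := by
      simp [pointAt, not_le.2 hl]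
    rw [hp]
    cases b
    · exact ⟨(e, false), Or.inr ⟨rfl, by simpa [run, offset] using h⟩⟩
    · exact ⟨(e, true), Or.inl ⟨rfl, by simpa [run, offset] using h⟩⟩
  · rw [pointAt_of_mem h0 h1]
    exact ⟨h0, h1, b, h⟩

lemma mem_hydraT_inr {e : E} {s t : ℝ} :
    ((Sum.inr (e, s), t) : (V ⊕ E × ℝ) × ℝ) ∈ G.hydraT Sig T ↔
      0 < s ∧ s < G.len e ∧ ∃ b, G.Live Sig T e b s t := by
  constructor
  · rintro ⟨hT, γ, hγ, h0, h1, b, hb⟩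
    exact ⟨h0, h1, b, hT, γ, hγ, hb⟩
  · rintro ⟨h0, h1, b, h⟩
    simpa [pointAt_of_mem h0 h1] using h.mem_hydraT h0.le h1.le

/-- The times at which impulses from `Sig` are sent into the oriented edge `d`. -/
lemma pulseTimes_finite [Finite V] (Sig : Set V) (T : ℝ) (d : E × Bool) :
    {t | t ≤ T ∧ ∃ γ ∈ Sig, G.pulse γ d t ≠ 0}.Finite := by
  refine (Set.finite_iUnion fun γ : V => G.pulse_times_finite γ d T).subset ?_
  rintro t ⟨ht, γ, -, h⟩
  exact Set.mem_iUnion.2 ⟨γ, ht, h⟩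

/-- The emission times of the impulses found at time at most `T` on the edge `e`. -/
lemma Live.emission {e : E} {b : Bool} {s t : ℝ} (h : G.Live Sig T e b s t) (h0 : 0 ≤ s)
    (h1 : s ≤ G.len e) :
    t - G.offset (e, b) s ∈ {t | t ≤ T ∧ ∃ γ ∈ Sig, G.pulse γ (e, b) t ≠ 0} := by
  obtain ⟨hT, γ, hγ, h⟩ := h
  refine ⟨?_, γ, hγ, h⟩
  have : 0 ≤ G.offset (e, b) s := by cases b <;> simp [offset] <;> linarith
  linarith

end MetricGraph

/-! ### Lattices, corners, and the motion of a lattice. -/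

namespace MetricGraph

variable {V E : Type*} [Fintype E] {G : MetricGraph V E} {Sig : Set V} {T : ℝ}

lemma Linked.symm {h h' : (V ⊕ E × ℝ) × ℝ} (hl : G.Linked Sig T h h') : G.Linked Sig T h' h := by
  induction hl with
  | refl => exact Relation.ReflTransGen.refl
  | tail _ hs ih =>
    refine Relation.ReflTransGen.head ⟨hs.2.1, hs.1, ?_⟩ ih
    rcases hs.2.2 with h | h
    · exact Or.inl h.symm
    · exact Or.inr h.symm

lemma Linked.trans {h h' h'' : (V ⊕ E × ℝ) × ℝ} (hl : G.Linked Sig T h h')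
    (hl' : G.Linked Sig T h' h'') : G.Linked Sig T h h'' :=
  Relation.ReflTransGen.trans hl hl'

lemma Linked.mem {h h' : (V ⊕ E × ℝ) × ℝ} (hl : G.Linked Sig T h h') (hm : h ∈ G.hydraT Sig T) :
    h' ∈ G.hydraT Sig T := by
  induction hl with
  | refl => exact hm
  | tail _ hs _ => exact hs.2.1

lemma linked_of_same_point {x : V ⊕ E × ℝ} {t t' : ℝ} (h : (x, t) ∈ G.hydraT Sig T)
    (h' : (x, t') ∈ G.hydraT Sig T) : G.Linked Sig T (x, t) (x, t') :=
  Relation.ReflTransGen.single ⟨h, h', Or.inl rfl⟩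

lemma linked_of_same_time {x x' : V ⊕ E × ℝ} {t : ℝ} (h : (x, t) ∈ G.hydraT Sig T)
    (h' : (x', t) ∈ G.hydraT Sig T) : G.Linked Sig T (x, t) (x', t) :=
  Relation.ReflTransGen.single ⟨h, h', Or.inr rfl⟩

variable (G Sig T) in
/-- The points `x` and `y` lie under the same lattice. -/
def Rel (x y : V ⊕ E × ℝ) : Prop :=
  ∃ t t', (x, t) ∈ G.hydraT Sig T ∧ G.Linked Sig T (x, t) (y, t')

lemma Rel.symm {x y : V ⊕ E × ℝ} (h : G.Rel Sig T x y) : G.Rel Sig T y x := by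
  obtain ⟨t, t', hm, hl⟩ := h
  exact ⟨t', t, hl.mem hm, hl.symm⟩

lemma Rel.trans {x y z : V ⊕ E × ℝ} (h : G.Rel Sig T x y) (h' : G.Rel Sig T y z) :
    G.Rel Sig T x z := by
  obtain ⟨t, t', hm, hl⟩ := h
  obtain ⟨s, s', hm', hl'⟩ := h'
  exact ⟨t, s', hm, (hl.trans (linked_of_same_point (hl.mem hm) hm')).trans hl'⟩

lemma mem_det_iff {A : Set (V ⊕ E × ℝ)} {y : V ⊕ E × ℝ} :
    y ∈ G.det Sig T A ↔ ∃ x ∈ A, G.Rel Sig T x y := by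
  constructor
  · rintro ⟨⟨z, t'⟩, ⟨-, ⟨x, t⟩, ⟨hx, hm⟩, hl⟩, rfl⟩
    exact ⟨x, hx, t, t', hm, hl⟩
  · rintro ⟨x, hx, t, t', hm, hl⟩
    exact ⟨(y, t'), ⟨hl.mem hm, (x, t), ⟨hx, hm⟩, hl⟩, rfl⟩

lemma mem_det_singleton {x y : V ⊕ E × ℝ} : y ∈ G.det Sig T {x} ↔ G.Rel Sig T x y := by
  simp [mem_det_iff]

lemma mem_critical_iff {x : V ⊕ E × ℝ} :
    x ∈ G.critical Sig T ↔ ∃ y t, (y, t) ∈ G.corner Sig T ∧ G.Rel Sig T x y ∧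
      ∃ t', (x, t') ∈ G.hydraT Sig T ∧ G.Linked Sig T (x, t') (y, t) := by
  constructor
  · rintro ⟨⟨z, t'⟩, ⟨hm, ⟨y, t⟩, ⟨hc, -⟩, hl⟩, rfl⟩
    exact ⟨y, t, hc, ⟨t', t, hm, hl.symm⟩, t', hm, hl.symm⟩
  · rintro ⟨y, t, hc, -, t', hm, hl⟩
    exact ⟨(x, t'), ⟨hm, (y, t), ⟨hc, hl.mem hm⟩, hl.symm⟩, rfl⟩

/-- Used to keep tracks away from corners: a corner reached by links would make the starting point
critical. -/
lemma not_corner_of_linked {x : V ⊕ E × ℝ} {t : ℝ} {h : (V ⊕ E × ℝ) × ℝ}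
    (hn : x ∉ G.critical Sig T) (hm : (x, t) ∈ G.hydraT Sig T)
    (hl : G.Linked Sig T (x, t) h) : h ∉ G.corner Sig T := fun hc =>
  hn (mem_critical_iff.2 ⟨h.1, h.2, hc, ⟨t, h.2, hm, hl⟩, t, hm, hl⟩)

lemma Rel.mem_critical {x y : V ⊕ E × ℝ} (h : G.Rel Sig T x y) (hy : y ∈ G.critical Sig T) :
    x ∈ G.critical Sig T := by
  obtain ⟨z, t, hc, -, t', hm, hl⟩ := mem_critical_iff.1 hy
  obtain ⟨s, s', hm', hl'⟩ := h
  by_contra hn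
  exact not_corner_of_linked hn hm'
    ((hl'.trans (linked_of_same_point (hl'.mem hm') hm)).trans hl) hc

/-- A corner is determined by an edge together with one emission time (at a vertex or at the final
time) or two (at a meeting point), and there are finitely many emission times up to `T`. -/
lemma corner_finite [Finite V] : (G.corner Sig T).Finite := by
  have hP := fun d => G.pulseTimes_finite Sig T d
  set P : E × Bool → Set ℝ := fun d => {t | t ≤ T ∧ ∃ γ ∈ Sig, G.pulse γ d t ≠ 0} with hPdef
  have h1 : (⋃ d, (fun t => ((Sum.inl (G.source d), t) : (V ⊕ E × ℝ) × ℝ)) '' P d).Finite :=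
    Set.finite_iUnion fun d => (hP d).image _
  have h2 : (⋃ d, (fun t => ((Sum.inl (G.target d), t + G.len d.1) : (V ⊕ E × ℝ) × ℝ)) ''
      P d).Finite := Set.finite_iUnion fun d => (hP d).image _
  have h3 : (⋃ e, (fun t => ((Sum.inr (e, T - t), T) : (V ⊕ E × ℝ) × ℝ)) ''
      P (e, false)).Finite := Set.finite_iUnion fun d => (hP _).image _
  have h4 : (⋃ e, (fun t => ((Sum.inr (e, G.len e - T + t), T) : (V ⊕ E × ℝ) × ℝ)) ''
      P (e, true)).Finite := Set.finite_iUnion fun d => (hP _).image _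
  -- Impulses emitted at `t.1` from the end `s = 0` and at `t.2` from the other end meet where `t.1
  -- + s = t.2 + len - s`.
  have h5 : (⋃ e, (fun t : ℝ × ℝ => ((Sum.inr (e, (G.len e + t.2 - t.1) / 2),
      (G.len e + t.2 + t.1) / 2) : (V ⊕ E × ℝ) × ℝ)) '' (P (e, false) ×ˢ P (e, true))).Finite :=
    Set.finite_iUnion fun d => ((hP _).prod (hP _)).image _
  refine ((((h1.union h2).union h3).union h4).union h5).subset ?_
  rintro ⟨x | ⟨e, s⟩, t⟩ ⟨hm, hc⟩
  · obtain ⟨hT, γ, hγ, d, ⟨rfl, hd⟩ | ⟨rfl, hd⟩⟩ := hm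
    · exact Or.inl (Or.inl (Or.inl (Or.inl
        (Set.mem_iUnion.2 ⟨d, t, ⟨hT, γ, hγ, hd⟩, rfl⟩))))
    · refine Or.inl (Or.inl (Or.inl (Or.inr
        (Set.mem_iUnion.2 ⟨d, t - G.len d.1, ⟨?_, γ, hγ, hd⟩, by simp⟩))))
      have := G.len_pos d.1
      simp only at hT
      linarith
  · obtain ⟨hs0, hs1, b, hb⟩ := mem_hydraT_inr.1 hm
    have key : t = T → ((Sum.inr (e, s), t) : (V ⊕ E × ℝ) × ℝ) ∈
        (⋃ e, (fun t => ((Sum.inr (e, T - t), T) : (V ⊕ E × ℝ) × ℝ)) '' P (e, false)) ∪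
        (⋃ e, (fun t => ((Sum.inr (e, G.len e - T + t), T) : (V ⊕ E × ℝ) × ℝ)) ''
          P (e, true)) := by
      rintro rfl
      cases b
      · refine Or.inl (Set.mem_iUnion.2 ⟨e, _, hb.emission hs0.le hs1.le, ?_⟩)
        simp [offset]
      · refine Or.inr (Set.mem_iUnion.2 ⟨e, _, hb.emission hs0.le hs1.le, ?_⟩)
        simp [offset]
    rcases hc with ⟨v, hv⟩ | hT | ⟨e', s', he, hc⟩
    · simp at hv
    · rcases key hT with h | h
      · exact Or.inl (Or.inl (Or.inr h))
      · exact Or.inl (Or.inr h)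
    · simp only [Sum.inr.injEq, Prod.mk.injEq] at he
      obtain ⟨rfl, rfl⟩ := he
      have hl : ∀ b, G.Live Sig T e b s t := fun b => ⟨hm.1, hc b⟩
      refine Or.inr (Set.mem_iUnion.2 ⟨e, (_, _), ⟨(hl false).emission hs0.le hs1.le,
        (hl true).emission hs0.le hs1.le⟩, ?_⟩)
      simp only [offset, Prod.mk.injEq, Sum.inr.injEq, true_and, if_true]
      constructor
      · simp; ring
      · simp; ring

/-- A track of an impulse which meets no corner stays in the interior of an edge. -/
lemma Live.extend {I : Set ℝ} (hI : I.OrdConnected) (h0I : 0 ∈ I) {e : E} {b : Bool} {s t σ : ℝ}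
    (hl : G.Live Sig T e b s t) (h0 : 0 < s) (h1 : s < G.len e)
    (hc : ∀ u ∈ I, 0 ≤ s + σ * u → s + σ * u ≤ G.len e → t + dirSign b * (σ * u) ≤ T →
      (G.pointAt e (s + σ * u), t + dirSign b * (σ * u)) ∉ G.corner Sig T) :
    ∀ u ∈ I, 0 < s + σ * u ∧ s + σ * u < G.len e ∧ t + dirSign b * (σ * u) < T ∧
      G.Live Sig T e b (s + σ * u) (t + dirSign b * (σ * u)) := by
  -- `g` measures the room left before either end of the edge or the final time. It is nonnegative
  -- at `0`; if it failed to be positive on `I`, the intermediate value theorem would give a zero,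
  -- and a zero of `g` is a vertex or a point with `t = T`, hence a corner.
  set g : ℝ → ℝ := fun u => min (min (s + σ * u) (G.len e - (s + σ * u)))
    (T - (t + dirSign b * (σ * u))) with hg
  have hgc : Continuous g := by fun_prop
  have main : ∀ u ∈ I, 0 < g u := by
    intro u hu
    by_contra! hneg
    have hz : 0 ≤ g 0 := by
      have := hl.1
      simp only [hg, mul_zero, add_zero]
      exact le_min (le_min h0.le (by linarith)) (by linarith)
    obtain ⟨v, hv, hv0⟩ := intermediate_value_uIcc (f := g) (a := 0) (b := u) hgc.continuousOn
      (Set.mem_uIcc.2 (Or.inr ⟨hneg, hz⟩))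
    have hvI : v ∈ I := hI.uIcc_subset h0I hu hv
    have a1 : 0 ≤ s + σ * v := by
      rw [← hv0]; exact (min_le_left _ _).trans (min_le_left _ _)
    have a2 : 0 ≤ G.len e - (s + σ * v) := by
      rw [← hv0]; exact (min_le_left _ _).trans (min_le_right _ _)
    have a3 : 0 ≤ T - (t + dirSign b * (σ * v)) := by
      rw [← hv0]; exact (min_le_right _ _)
    have hlv := hl.shift (u := σ * v) (by linarith)
    have hm := hlv.mem_hydraT a1 (by linarith)
    refine hc v hvI a1 (by linarith) (by linarith) ⟨hm, ?_⟩
    by_contra! hcon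
    have b1 : 0 < s + σ * v := by
      refine lt_of_le_of_ne a1 fun h => hcon.1 (G.ends e false) ?_
      simp [pointAt, ← h]
    have b2 : 0 < G.len e - (s + σ * v) := by
      refine lt_of_le_of_ne a2 fun h => hcon.1 (G.ends e true) ?_
      have : s + σ * v = G.len e := by linarith
      simp [pointAt, this, not_le.2 (G.len_pos e)]
    have b3 : 0 < T - (t + dirSign b * (σ * v)) := by
      refine lt_of_le_of_ne a3 fun h => hcon.2.1 ?_
      simp only
      linarith
    have : 0 < g v := lt_min (lt_min b1 b2) b3
    linarith
  intro u hu
  obtain ⟨h12, h3⟩ := lt_min_iff.1 (main u hu)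
  obtain ⟨g1, g2⟩ := lt_min_iff.1 h12
  exact ⟨g1, by linarith, by linarith, hl.shift (by linarith)⟩

/-- Along an interval free of critical points, each point of the lattice moves with unit speed. -/
theorem Linked.extend {I : Set ℝ} (hI : I.OrdConnected) (h0I : 0 ∈ I) {e : E} {s t : ℝ} {b : Bool}
    (hr : ∀ u ∈ I, 0 < s + u ∧ s + u < G.len e ∧ Sum.inr (e, s + u) ∉ G.critical Sig T)
    (hb : G.Live Sig T e b s t) {h : (V ⊕ E × ℝ) × ℝ} (hh : G.Linked Sig T (Sum.inr (e, s), t) h) :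
    ∃ e' s' t' b' σ, h = (Sum.inr (e', s'), t') ∧ (σ = 1 ∨ σ = -1) ∧ G.Live Sig T e' b' s' t' ∧
      ∀ u ∈ I, 0 < s' + σ * u ∧ s' + σ * u < G.len e' ∧
        G.Live Sig T e' b' (s' + σ * u) (t' + dirSign b' * (σ * u)) ∧
        G.Linked Sig T (Sum.inr (e, s + u), t + dirSign b * u)
          (Sum.inr (e', s' + σ * u), t' + dirSign b' * (σ * u)) := by
  have hs0 : 0 < s := by simpa using (hr 0 h0I).1
  have hs1 : s < G.len e := by simpa using (hr 0 h0I).2.1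
  have base : ∀ u ∈ I, 0 < s + 1 * u ∧ s + 1 * u < G.len e ∧ t + dirSign b * (1 * u) < T ∧
      G.Live Sig T e b (s + 1 * u) (t + dirSign b * (1 * u)) := by
    refine hb.extend hI h0I hs0 hs1 fun u hu _ _ h3 => ?_
    obtain ⟨r0, r1, r2⟩ := hr u hu
    have hm := (hb.shift (u := u) (by simpa using h3)).mem_hydraT r0.le r1.le
    rw [pointAt_of_mem r0 r1] at hm
    rw [one_mul, pointAt_of_mem r0 r1]
    exact not_corner_of_linked r2 hm Relation.ReflTransGen.refl
  simp only [one_mul] at base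
  have baseM : ∀ u ∈ I, ((Sum.inr (e, s + u), t + dirSign b * u) : (V ⊕ E × ℝ) × ℝ) ∈
      G.hydraT Sig T := fun u hu =>
    mem_hydraT_inr.2 ⟨(base u hu).1, (base u hu).2.1, b, (base u hu).2.2.2⟩
  -- Induction on the chain of links: each new point is dragged along with its predecessor. While it
  -- stays in the closed edge and before `T` it is linked to the moved base point, so it cannot be a
  -- corner, and `Live.extend` then keeps it in the open edge.
  induction hh with
  | refl =>
    refine ⟨e, s, t, b, 1, rfl, Or.inl rfl, hb, fun u hu => ?_⟩
    rw [one_mul]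
    exact ⟨(base u hu).1, (base u hu).2.1, (base u hu).2.2.2, Relation.ReflTransGen.refl⟩
  | @tail h1 h2 hl hs ih =>
    obtain ⟨e1, s1, t1, b1, σ1, rfl, hσ1, hl1, ih⟩ := ih
    obtain ⟨hm1, hm2, hs⟩ := hs
    have mem1 : ∀ u ∈ I, ((Sum.inr (e1, s1 + σ1 * u), t1 + dirSign b1 * (σ1 * u)) :
        (V ⊕ E × ℝ) × ℝ) ∈ G.hydraT Sig T := fun u hu =>
      (ih u hu).2.2.2.mem (baseM u hu)
    obtain ⟨x2, t2⟩ := h2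
    rcases hs with hs | hs
    · simp only at hs
      subst hs
      obtain ⟨c0, c1, b2, hl2⟩ := mem_hydraT_inr.1 hm2
      have main := hl2.extend (σ := σ1) hI h0I c0 c1 (fun u hu _ _ h3 => by
        obtain ⟨d0, d1, d2, d3⟩ := ih u hu
        have hm := (hl2.shift (u := σ1 * u) h3).mem_hydraT d0.le d1.le
        rw [pointAt_of_mem d0 d1] at hm ⊢
        exact not_corner_of_linked (hr u hu).2.2 (baseM u hu)
          (d3.trans (linked_of_same_point (mem1 u hu) hm)))
      refine ⟨e1, s1, t2, b2, σ1, rfl, hσ1, hl2, fun u hu => ?_⟩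
      obtain ⟨m0, m1, -, m2⟩ := main u hu
      exact ⟨m0, m1, m2, (ih u hu).2.2.2.trans (linked_of_same_point (mem1 u hu)
        (mem_hydraT_inr.2 ⟨m0, m1, b2, m2⟩))⟩
    · simp only at hs
      subst hs
      have hl02 : G.Linked Sig T (Sum.inr (e, s), t) (x2, t1) :=
        hl.trans (linked_of_same_time hm1 hm2)
      have hnc := not_corner_of_linked (by simpa using (hr 0 h0I).2.2)
        (by simpa using baseM 0 h0I) hl02
      rcases x2 with v | ⟨e2, s2⟩
      · exact absurd ⟨hm2, Or.inl ⟨v, rfl⟩⟩ hnc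
      obtain ⟨c0, c1, b2, hl2⟩ := mem_hydraT_inr.1 hm2
      have hsq : dirSign b2 * dirSign b2 = 1 := by
        rcases dirSign_eq b2 with h | h <;> simp [h]
      -- The velocity of the new point is forced: with this sign its time and that of its
      -- predecessor stay equal as `u` varies.
      set σ2 := dirSign b2 * (dirSign b1 * σ1) with hσ2
      have htime : ∀ u, t1 + dirSign b2 * (σ2 * u) = t1 + dirSign b1 * (σ1 * u) := by
        intro u
        rw [hσ2]
        linear_combination (dirSign b1 * σ1 * u) * hsq
      have main := hl2.extend (σ := σ2) hI h0I c0 c1 (fun u hu h1 h2 h3 => by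
        have hm := (hl2.shift (u := σ2 * u) h3).mem_hydraT h1 h2
        obtain ⟨d0, d1, d2, d3⟩ := ih u hu
        have hm1' := mem1 u hu
        rw [htime] at hm ⊢
        exact not_corner_of_linked (hr u hu).2.2 (baseM u hu)
          (d3.trans (linked_of_same_time hm1' hm)))
      refine ⟨e2, s2, t1, b2, σ2, rfl, ?_, hl2, fun u hu => ?_⟩
      · rw [hσ2]
        rcases dirSign_eq b2 with h | h <;> rcases dirSign_eq b1 with h' | h' <;>
          rcases hσ1 with h'' | h'' <;> simp [h, h', h'']
      · obtain ⟨m0, m1, -, m2⟩ := main u hu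
        refine ⟨m0, m1, m2, (ih u hu).2.2.2.trans ?_⟩
        have hm := mem_hydraT_inr.2 ⟨m0, m1, b2, m2⟩
        rw [htime] at hm ⊢
        exact linked_of_same_time (mem1 u hu) hm

end MetricGraph

/-! ### Regular points, cells, and isometries between cells. -/

namespace MetricGraph

variable {V E : Type*} [Fintype E] {G : MetricGraph V E} {Sig : Set V} {T : ℝ}

lemma mem_pi_iff {x : V ⊕ E × ℝ} :
    x ∈ Prod.fst '' G.hydraT Sig T ↔ ∃ t, (x, t) ∈ G.hydraT Sig T := by
  simp

lemma not_critical_of_regular {x : V ⊕ E × ℝ} (h : x ∈ G.regular Sig T) :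
    x ∉ G.critical Sig T := fun hc => h.2 (Or.inl hc)

lemma inl_notMem_regular (v : V) : (Sum.inl v : V ⊕ E × ℝ) ∉ G.regular Sig T := by
  intro h
  obtain ⟨t, ht⟩ := mem_pi_iff.1 h.1
  exact not_corner_of_linked (not_critical_of_regular h) ht Relation.ReflTransGen.refl
    ⟨ht, Or.inl ⟨v, rfl⟩⟩

lemma regular_live {e : E} {s : ℝ} (h : Sum.inr (e, s) ∈ G.regular Sig T) :
    0 < s ∧ s < G.len e ∧ ∃ b t, G.Live Sig T e b s t := by
  obtain ⟨t, ht⟩ := mem_pi_iff.1 h.1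
  obtain ⟨h0, h1, b, hb⟩ := mem_hydraT_inr.1 ht
  exact ⟨h0, h1, b, t, hb⟩

lemma ordConnected_abs_lt (δ : ℝ) : {u : ℝ | |u| < δ}.OrdConnected := by
  have : {u : ℝ | |u| < δ} = Set.Ioo (-δ) δ := by
    ext u; simp [abs_lt]
  rw [this]
  exact Set.ordConnected_Ioo

/-- Regular points form an open set, and near a regular point different points lie under different
lattices. -/
theorem exists_regular_nhd [Finite V] {e : E} {s : ℝ} (h : Sum.inr (e, s) ∈ G.regular Sig T) :
    ∃ δ > 0, (∀ u, |u| < δ → Sum.inr (e, s + u) ∈ G.regular Sig T) ∧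
      ∀ u u', |u| < δ → |u'| < δ → G.Rel Sig T (Sum.inr (e, s + u)) (Sum.inr (e, s + u')) →
        u = u' := by
  obtain ⟨h0, h1, b, t, hb⟩ := regular_live h
  have hfold : Sum.inr (e, s) ∉ G.fold Sig T := fun hf => h.2 (Or.inr hf)
  obtain ⟨δ₀, hδ₀, huniq⟩ : ∃ δ > 0, ∀ s' s'', |s' - s| < δ → |s'' - s| < δ →
      G.Rel Sig T (Sum.inr (e, s')) (Sum.inr (e, s'')) → s' = s'' := by
    by_contra! hc
    refine hfold ⟨e, s, rfl, fun δ hδ => ?_⟩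
    obtain ⟨s', s'', h1, h2, h3, h4⟩ := hc δ hδ
    exact ⟨s', s'', h1, h2, h4, mem_det_singleton.2 h3⟩
  -- Each critical point `z` near `s` is linked to a corner. Two of them linked to the same corner
  -- are related to each other, hence equal by local uniqueness; so finiteness of the corners makes
  -- these `z` finite in number.
  have hfin : {z | |z - s| < δ₀ ∧ Sum.inr (e, z) ∈ G.critical Sig T}.Finite := by
    have hch : ∀ z, ∃ c, z ∈ {z | |z - s| < δ₀ ∧ Sum.inr (e, z) ∈ G.critical Sig T} →
        c ∈ G.corner Sig T ∧ ∃ t', (Sum.inr (e, z), t') ∈ G.hydraT Sig T ∧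
          G.Linked Sig T (Sum.inr (e, z), t') c := by
      intro z
      by_cases hz : z ∈ {z | |z - s| < δ₀ ∧ Sum.inr (e, z) ∈ G.critical Sig T}
      · obtain ⟨y, τ, hc, -, t', h1, h2⟩ := mem_critical_iff.1 hz.2
        exact ⟨(y, τ), fun _ => ⟨hc, t', h1, h2⟩⟩
      · exact ⟨(Sum.inr (e, 0), 0), fun h => absurd h hz⟩
    choose c hc using hch
    refine Set.Finite.of_injOn (f := c) (t := G.corner Sig T) (fun z hz => (hc z hz).1) ?_
      corner_finite
    intro z hz z' hz' hzz
    obtain ⟨-, t1, m1, l1⟩ := hc z hz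
    obtain ⟨-, t2, m2, l2⟩ := hc z' hz'
    refine huniq z z' hz.1 hz'.1 ⟨t1, t2, m1, l1.trans ?_⟩
    rw [hzz]
    exact l2.symm
  have hopen : IsOpen ({z | |z - s| < δ₀ ∧ Sum.inr (e, z) ∈ G.critical Sig T}ᶜ ∩
      Set.Ioo 0 (G.len e)) := hfin.isClosed.isOpen_compl.inter isOpen_Ioo
  obtain ⟨δ₁, hδ₁, hball⟩ := Metric.isOpen_iff.1 hopen s
    ⟨fun hh => not_critical_of_regular h hh.2, h0, h1⟩
  set δ := min δ₀ δ₁ with hδ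
  have hδpos : 0 < δ := lt_min hδ₀ hδ₁
  have hcr : ∀ u ∈ {u : ℝ | |u| < δ}, 0 < s + u ∧ s + u < G.len e ∧
      Sum.inr (e, s + u) ∉ G.critical Sig T := by
    intro u hu
    have hu0 : |u| < δ₀ := lt_of_lt_of_le hu (min_le_left _ _)
    have hu1 : |u| < δ₁ := lt_of_lt_of_le hu (min_le_right _ _)
    have := hball (show s + u ∈ Metric.ball s δ₁ by simpa [Real.dist_eq] using hu1)
    exact ⟨this.2.1, this.2.2, fun hcc => this.1 ⟨by simpa using hu0, hcc⟩⟩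
  have hext := Linked.extend (ordConnected_abs_lt δ) (by simpa using hδpos) hcr hb
    (Relation.ReflTransGen.refl)
  obtain ⟨e', s', t', b', σ, heq, hσ, -, hext⟩ := hext
  simp only [Prod.mk.injEq, Sum.inr.injEq] at heq
  obtain ⟨⟨rfl, rfl⟩, rfl⟩ := heq
  refine ⟨δ, hδpos, ?_, ?_⟩
  · intro u hu
    refine ⟨?_, ?_⟩
    · have hu' : |σ * u| < δ := by rcases hσ with rfl | rfl <;> simpa using hu
      have hσu : σ * (σ * u) = u := by rcases hσ with rfl | rfl <;> ring
      obtain ⟨e0, e1, e2, -⟩ := hext (σ * u) hu'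
      rw [hσu] at e0 e1 e2
      exact mem_pi_iff.2 ⟨_, mem_hydraT_inr.2 ⟨e0, e1, b', e2⟩⟩
    · rintro (hc | ⟨e'', z, hz, hf⟩)
      · exact (hcr u hu).2.2 hc
      · simp only [Sum.inr.injEq, Prod.mk.injEq] at hz
        obtain ⟨rfl, rfl⟩ := hz
        obtain ⟨z', z'', h1, h2, h3, h4⟩ := hf (δ - |u|) (by linarith)
        have key : ∀ w, |w - (s + u)| < δ - |u| → |w - s| < δ₀ := by
          intro w hw
          have : w - s = (w - (s + u)) + u := by ring
          rw [this]
          have := abs_add_le (w - (s + u)) u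
          have := min_le_left δ₀ δ₁
          linarith
        exact h3 (huniq z' z'' (key z' h1) (key z'' h2) (mem_det_singleton.1 h4))
  · intro u u' hu hu' hrel
    have := huniq (s + u) (s + u')
      (by simpa using lt_of_lt_of_le hu (min_le_left _ _))
      (by simpa using lt_of_lt_of_le hu' (min_le_left _ _)) hrel
    linarith

/-- Regularity belongs to the whole lattice. Critical points are carried along by links at once; a
fold at `y` is carried back by the unit-speed motion to distinct related points near `x`, against
local uniqueness there. -/
theorem Rel.regular [Finite V] {x y : V ⊕ E × ℝ} (hx : x ∈ G.regular Sig T)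
    (hrel : G.Rel Sig T x y) : y ∈ G.regular Sig T := by
  rcases x with v | ⟨e, s⟩
  · exact absurd hx (inl_notMem_regular v)
  obtain ⟨δ, hδ, hreg, huniq⟩ := exists_regular_nhd hx
  obtain ⟨t, t', hm, hl⟩ := hrel
  refine ⟨mem_pi_iff.2 ⟨t', hl.mem hm⟩, ?_⟩
  rintro (hc | ⟨e₁, s₁, rfl, hf⟩)
  · exact not_critical_of_regular hx (Rel.mem_critical ⟨t, t', hm, hl⟩ hc)
  obtain ⟨-, -, b, hb⟩ := mem_hydraT_inr.1 hm
  obtain ⟨e₂, s₂, t₂, b₂, σ, heq, hσ, -, hext⟩ := hl.extend (ordConnected_abs_lt δ)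
    (by simpa using hδ) (fun u hu => ⟨(regular_live (hreg u hu)).1, (regular_live (hreg u hu)).2.1,
      not_critical_of_regular (hreg u hu)⟩) hb
  simp only [Prod.mk.injEq, Sum.inr.injEq] at heq
  obtain ⟨⟨rfl, rfl⟩, rfl⟩ := heq
  obtain ⟨z, z', h1, h2, h3, h4⟩ := hf δ hδ
  have key : ∀ w, |w - s₁| < δ → |σ * (w - s₁)| < δ ∧
      G.Rel Sig T (Sum.inr (e, s + σ * (w - s₁))) (Sum.inr (e₁, w)) := by
    intro w hw
    have hu : |σ * (w - s₁)| < δ := by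
      rw [abs_mul]
      rcases hσ with rfl | rfl <;> simpa only [abs_neg, abs_one, one_mul] using hw
    refine ⟨hu, ?_⟩
    obtain ⟨e0, e1, e2, e3⟩ := hext _ hu
    have hw' : s₁ + σ * (σ * (w - s₁)) = w := by rcases hσ with rfl | rfl <;> ring
    have e4 := e3.symm.mem (mem_hydraT_inr.2 ⟨e0, e1, b₂, e2⟩)
    rw [hw'] at e3
    exact ⟨_, _, e4, e3⟩
  have := huniq _ _ (key z h1).1 (key z' h2).1
    (((key z h1).2.trans (mem_det_singleton.1 h4)).trans (key z' h2).2.symm)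
  apply h3
  rcases hσ with rfl | rfl <;> linarith

lemma exists_maximal_Ioo {R : Set ℝ} (hR : IsOpen R) {l s : ℝ} (hl : R ⊆ Set.Ioo 0 l)
    (hs : s ∈ R) : ∃ p q, 0 ≤ p ∧ q ≤ l ∧ p < s ∧ s < q ∧ Set.Ioo p q ⊆ R ∧ p ∉ R ∧ q ∉ R := by
  have hs' := hl hs
  set A := Set.Iic s ∩ Rᶜ
  set B := Set.Ici s ∩ Rᶜ
  have hA : IsClosed A := isClosed_Iic.inter hR.isClosed_compl
  have hB : IsClosed B := isClosed_Ici.inter hR.isClosed_compl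
  have h0A : (0 : ℝ) ∈ A := ⟨hs'.1.le, fun h => lt_irrefl _ (hl h).1⟩
  have hlB : l ∈ B := ⟨hs'.2.le, fun h => lt_irrefl _ (hl h).2⟩
  have bA : BddAbove A := ⟨s, fun x hx => hx.1⟩
  have bB : BddBelow B := ⟨s, fun x hx => hx.1⟩
  have pA := hA.csSup_mem ⟨_, h0A⟩ bA
  have qB := hB.csInf_mem ⟨_, hlB⟩ bB
  refine ⟨sSup A, sInf B, le_csSup bA h0A, csInf_le bB hlB, ?_, ?_, ?_, pA.2, qB.2⟩
  · exact lt_of_le_of_ne pA.1 fun h => pA.2 (h ▸ hs)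
  · exact lt_of_le_of_ne qB.1 fun h => qB.2 (h ▸ hs)
  · intro x hx
    by_contra hxR
    rcases le_total x s with h | h
    · exact absurd (le_csSup bA ⟨h, hxR⟩) (not_le.2 hx.1)
    · exact absurd (csInf_le bB ⟨h, hxR⟩) (not_le.2 hx.2)

lemma mem_dividing_of_pi {e : E} {s : ℝ} (h : G.pointAt e s ∈ Prod.fst '' G.hydraT Sig T)
    (hr : Sum.inr (e, s) ∉ G.regular Sig T) : G.pointAt e s ∈ G.dividing Sig T := by
  by_contra hd
  have hreg : G.pointAt e s ∈ G.regular Sig T := ⟨h, hd⟩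
  unfold pointAt at hreg
  split_ifs at hreg
  · exact inl_notMem_regular _ hreg
  · exact inl_notMem_regular _ hreg
  · exact hr hreg

/-- A track over an interval of regular points. -/
lemma Live.extend_regular {e : E} {b : Bool} {p q s t : ℝ} (hp : p < s) (hq : s < q)
    (hreg : ∀ z ∈ Set.Ioo p q, Sum.inr (e, z) ∈ G.regular Sig T) (hl : G.Live Sig T e b s t) :
    ∀ z ∈ Set.Icc p q, G.Live Sig T e b z (t + dirSign b * (z - s)) := by
  have h := regular_live (hreg s ⟨hp, hq⟩)
  have key : ∀ u ∈ Set.Ioo (p - s) (q - s), t + dirSign b * u ≤ T := by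
    intro u hu
    have h2 := (hl.extend (σ := 1) (I := Set.Ioo (p - s) (q - s)) Set.ordConnected_Ioo
      ⟨by linarith, by linarith⟩ h.1 h.2.1 ?_ u hu).2.2.1.le
    · simpa using h2
    intro u hu h0 h1 h3
    rw [one_mul] at h0 h1 h3 ⊢
    have hr := hreg (s + u) ⟨by linarith [hu.1], by linarith [hu.2]⟩
    obtain ⟨r0, r1, -⟩ := regular_live hr
    have hm := (hl.shift h3).mem_hydraT h0 h1
    rw [pointAt_of_mem r0 r1] at hm ⊢
    exact not_corner_of_linked (not_critical_of_regular hr) hm Relation.ReflTransGen.refl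
  -- The bound `t ≤ T` is a closed condition, so it survives at the ends of the interval. This is
  -- what puts the ends of a cell into `π(H)`.
  have hcl : closure (Set.Ioo (p - s) (q - s)) ⊆ {u | t + dirSign b * u ≤ T} :=
    closure_minimal key (isClosed_le (by fun_prop) continuous_const)
  rw [closure_Ioo (by linarith)] at hcl
  intro z hz
  have := hl.shift (hcl (⟨by linarith [hz.1], by linarith [hz.2]⟩ :
    z - s ∈ Set.Icc (p - s) (q - s)))
  simpa using this

/-- The cell is the connected component of the open set of regular points. Tracks over it extend to
its ends, which are therefore captured by the waves; not being regular, they are dividing points. -/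
theorem exists_cell [Finite V] {e : E} {s : ℝ} (h : Sum.inr (e, s) ∈ G.regular Sig T) :
    ∃ p q, G.IsCell Sig T (e, p, q) ∧ p < s ∧ s < q := by
  have hopen : IsOpen {z | Sum.inr (e, z) ∈ G.regular Sig T} := by
    rw [Metric.isOpen_iff]
    intro z hz
    obtain ⟨δ, hδ, hreg, -⟩ := exists_regular_nhd hz
    refine ⟨δ, hδ, fun w hw => ?_⟩
    have := hreg (w - z) (by simpa [Real.dist_eq] using hw)
    simpa using this
  obtain ⟨p, q, hp, hq, hps, hsq, hsub, hpR, hqR⟩ := exists_maximal_Ioo hopen (l := G.len e)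
    (fun z hz => ⟨(regular_live hz).1, (regular_live hz).2.1⟩) h
  obtain ⟨-, -, b, t, hb⟩ := regular_live h
  have hext := hb.extend_regular hps hsq hsub
  refine ⟨p, q, ⟨hp, hps.trans hsq, hq, ?_, ?_, ?_⟩, hps, hsq⟩
  · rintro _ ⟨z, hz, rfl⟩
    exact hsub hz
  · exact mem_dividing_of_pi (mem_pi_iff.2 ⟨_, (hext p ⟨le_rfl, (hps.trans hsq).le⟩).mem_hydraT hp
      ((hps.trans hsq).le.trans hq)⟩) hpR
  · exact mem_dividing_of_pi (mem_pi_iff.2 ⟨_, (hext q ⟨(hps.trans hsq).le, le_rfl⟩).mem_hydraT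
      (hp.trans (hps.trans hsq).le) hq⟩) hqR

namespace IsCell

variable {e : E} {p q : ℝ}

lemma regular_of_mem (hc : G.IsCell Sig T (e, p, q)) {s : ℝ} (hs : s ∈ Set.Ioo p q) :
    Sum.inr (e, s) ∈ G.regular Sig T := hc.2.2.2.1 ⟨s, hs, rfl⟩

lemma left_notMem (hc : G.IsCell Sig T (e, p, q)) : Sum.inr (e, p) ∉ G.regular Sig T := by
  intro h
  have := regular_live h
  have h5 := hc.2.2.2.2.1
  simp only at h5
  rw [pointAt_of_mem this.1 this.2.1] at h5
  exact h.2 h5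

lemma right_notMem (hc : G.IsCell Sig T (e, p, q)) : Sum.inr (e, q) ∉ G.regular Sig T := by
  intro h
  have := regular_live h
  have h5 := hc.2.2.2.2.2
  simp only at h5
  rw [pointAt_of_mem this.1 this.2.1] at h5
  exact h.2 h5

lemma subset_of_ordConnected (hc : G.IsCell Sig T (e, p, q)) {s : ℝ} (hs : s ∈ Set.Ioo p q)
    {S : Set ℝ} (hS : S.OrdConnected) (hsS : s ∈ S)
    (hreg : ∀ z ∈ S, Sum.inr (e, z) ∈ G.regular Sig T) : S ⊆ Set.Ioo p q := by
  intro z hz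
  constructor
  · by_contra! h
    exact hc.left_notMem (hreg p (hS.out hz hsS ⟨h, hs.1.le⟩))
  · by_contra! h
    exact hc.right_notMem (hreg q (hS.out hsS hz ⟨hs.2.le, h⟩))

lemma eq_of_mem {p' q' s : ℝ} (hc : G.IsCell Sig T (e, p, q)) (hc' : G.IsCell Sig T (e, p', q'))
    (hs : s ∈ Set.Ioo p q) (hs' : s ∈ Set.Ioo p' q') : p = p' ∧ q = q' := by
  have h1 := hc.subset_of_ordConnected hs Set.ordConnected_Ioo hs' fun z hz =>
    hc'.regular_of_mem hz
  have h2 := hc'.subset_of_ordConnected hs' Set.ordConnected_Ioo hs fun z hz =>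
    hc.regular_of_mem hz
  have hpq : p < q := hs.1.trans hs.2
  have hpq' : p' < q' := hs'.1.trans hs'.2
  have i1 := (Set.Ioo_subset_Ioo_iff hpq).1 h2
  have i2 := (Set.Ioo_subset_Ioo_iff hpq').1 h1
  exact ⟨le_antisymm i2.1 i1.1, le_antisymm i1.2 i2.2⟩

variable [Finite V]

/-- The motion along a cell of a lattice point. -/
lemma extend (hc : G.IsCell Sig T (e, p, q)) {s t : ℝ} (hs : s ∈ Set.Ioo p q) {b : Bool}
    (hb : G.Live Sig T e b s t) {e' : E} {s' t' : ℝ}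
    (hl : G.Linked Sig T (Sum.inr (e, s), t) (Sum.inr (e', s'), t')) :
    ∃ b' σ, (σ = 1 ∨ σ = -1) ∧ G.Live Sig T e' b' s' t' ∧ ∀ u ∈ Set.Ioo (p - s) (q - s),
      G.Live Sig T e' b' (s' + σ * u) (t' + dirSign b' * (σ * u)) ∧
      Sum.inr (e', s' + σ * u) ∈ G.regular Sig T ∧
      G.Linked Sig T (Sum.inr (e, s + u), t + dirSign b * u)
          (Sum.inr (e', s' + σ * u), t' + dirSign b' * (σ * u)) ∧
      G.Rel Sig T (Sum.inr (e, s + u)) (Sum.inr (e', s' + σ * u)) := by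
  have hreg : ∀ u ∈ Set.Ioo (p - s) (q - s), Sum.inr (e, s + u) ∈ G.regular Sig T := fun u hu =>
    hc.regular_of_mem ⟨by linarith [hu.1], by linarith [hu.2]⟩
  obtain ⟨e₂, s₂, t₂, b₂, σ, heq, hσ, hl2, hext⟩ := hl.extend (I := Set.Ioo (p - s) (q - s))
    Set.ordConnected_Ioo ⟨by linarith [hs.1], by linarith [hs.2]⟩ (fun u hu =>
      ⟨(regular_live (hreg u hu)).1, (regular_live (hreg u hu)).2.1,
        not_critical_of_regular (hreg u hu)⟩) hb
  simp only [Prod.mk.injEq, Sum.inr.injEq] at heq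
  obtain ⟨⟨rfl, rfl⟩, rfl⟩ := heq
  refine ⟨b₂, σ, hσ, hl2, fun u hu => ?_⟩
  obtain ⟨e0, e1, e2, e3⟩ := hext u hu
  have hm := e3.symm.mem (mem_hydraT_inr.2 ⟨e0, e1, b₂, e2⟩)
  have hrel : G.Rel Sig T (Sum.inr (e, s + u)) (Sum.inr (e', s' + σ * u)) := ⟨_, _, hm, e3⟩
  exact ⟨e2, (hrel.regular (hreg u hu)), e3, hrel⟩

/-- A lattice lies over at most one point of a cell. -/
theorem eq_of_rel (hc : G.IsCell Sig T (e, p, q)) {s s' : ℝ} (hs : s ∈ Set.Ioo p q)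
    (hs' : s' ∈ Set.Ioo p q) (h : G.Rel Sig T (Sum.inr (e, s)) (Sum.inr (e, s'))) : s = s' := by
  obtain ⟨t, t', hm, hl⟩ := h
  obtain ⟨-, -, b, hb⟩ := mem_hydraT_inr.1 hm
  obtain ⟨b', σ, rfl | rfl, -, hext⟩ := hc.extend hs hb hl
  -- Orientation kept: the translation by `s' - s` takes points of the cell to regular points, yet
  -- it takes some interior point to an end of the cell.
  · by_contra hne
    rcases lt_or_gt_of_ne hne with hlt | hlt
    · have := (hext (q - s') ⟨by linarith [hs.1, hs'.2], by linarith⟩).2.1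
      rw [one_mul, add_sub_cancel] at this
      exact hc.right_notMem this
    · have := (hext (p - s') ⟨by linarith [hs.1, hs'.2], by linarith [hs'.1, hs.2]⟩).2.1
      rw [one_mul, add_sub_cancel] at this
      exact hc.left_notMem this
  -- Orientation reversed: the motion is the reflection in the midpoint `m`, so `m + η` and `m - η`
  -- are related for small `η`, which contradicts local uniqueness at `m`.
  · exfalso
    set m := (s + s') / 2 with hm
    have hmc : m ∈ Set.Ioo p q := ⟨by linarith [hs.1, hs'.1], by linarith [hs.2, hs'.2]⟩
    obtain ⟨δ, hδ, -, huniq⟩ := exists_regular_nhd (hc.regular_of_mem hmc)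
    set η := min (δ / 2) ((q - m) / 2) with hη
    have hη0 : 0 < η := lt_min (by linarith) (by linarith [hmc.2])
    have hη1 : η ≤ δ / 2 := min_le_left _ _
    have hη2 : η ≤ (q - m) / 2 := min_le_right _ _
    have hrel := (hext (m + η - s) ⟨by linarith [hmc.1], by linarith [hmc.2]⟩).2.2.2
    have e1 : s + (m + η - s) = m + η := by ring
    have e2 : s' + -1 * (m + η - s) = m + -η := by rw [hm]; ring
    rw [e1, e2] at hrel
    have := huniq η (-η) (by rw [abs_of_pos hη0]; linarith)
      (by rw [abs_neg, abs_of_pos hη0]; linarith) hrel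
    linarith

lemma image_ordConnected {I : Set ℝ} (hI : I.OrdConnected) {s' σ : ℝ} (hσ : σ = 1 ∨ σ = -1) :
    ((fun u => s' + σ * u) '' I).OrdConnected := by
  refine ⟨?_⟩
  rintro _ ⟨u, hu, rfl⟩ _ ⟨v, hv, rfl⟩ z hz
  rcases hσ with rfl | rfl
  · exact ⟨z - s', hI.out hu hv ⟨by linarith [hz.1], by linarith [hz.2]⟩, by ring⟩
  · exact ⟨s' - z, hI.out hv hu ⟨by linarith [hz.2], by linarith [hz.1]⟩, by ring⟩

/-- If a lattice has points over two cells, then the lattices of the points of the first cell trace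
out the second one isometrically. -/
theorem exists_isometry {e' : E} {p' q' : ℝ} (hc : G.IsCell Sig T (e, p, q))
    (hc' : G.IsCell Sig T (e', p', q')) {s s' : ℝ} (hs : s ∈ Set.Ioo p q)
    (hs' : s' ∈ Set.Ioo p' q') (h : G.Rel Sig T (Sum.inr (e, s)) (Sum.inr (e', s'))) :
    ∃ σ : ℝ, (σ = 1 ∨ σ = -1) ∧ ∀ z ∈ Set.Ioo p q, s' + σ * (z - s) ∈ Set.Ioo p' q' ∧
      G.Rel Sig T (Sum.inr (e, z)) (Sum.inr (e', s' + σ * (z - s))) := by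
  obtain ⟨t, t', hm, hl⟩ := h
  obtain ⟨-, -, b, hb⟩ := mem_hydraT_inr.1 hm
  obtain ⟨b', σ, hσ, -, hext⟩ := hc.extend hs hb hl
  refine ⟨σ, hσ, fun z hz => ?_⟩
  have hu : z - s ∈ Set.Ioo (p - s) (q - s) := ⟨by linarith [hz.1], by linarith [hz.2]⟩
  constructor
  · refine hc'.subset_of_ordConnected hs'
      (image_ordConnected (s' := s') (Set.ordConnected_Ioo (a := p - s) (b := q - s)) hσ)
      ⟨0, ⟨by linarith [hs.1], by linarith [hs.2]⟩, by simp⟩ ?_ ⟨_, hu, rfl⟩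
    rintro _ ⟨u, hu, rfl⟩
    exact (hext u hu).2.1
  · have := (hext _ hu).2.2.2
    rwa [add_sub_cancel] at this

theorem exists_rel {e' : E} {p' q' : ℝ} (hc : G.IsCell Sig T (e, p, q))
    (hc' : G.IsCell Sig T (e', p', q')) {s s' : ℝ} (hs : s ∈ Set.Ioo p q)
    (hs' : s' ∈ Set.Ioo p' q') (h : G.Rel Sig T (Sum.inr (e, s)) (Sum.inr (e', s'))) {z' : ℝ}
    (hz' : z' ∈ Set.Ioo p' q') :
    ∃ z ∈ Set.Ioo p q, G.Rel Sig T (Sum.inr (e, z)) (Sum.inr (e', z')) := by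
  obtain ⟨σ, -, hext⟩ := hc'.exists_isometry hc hs' hs h.symm
  exact ⟨_, (hext z' hz').1, (hext z' hz').2.symm⟩

end IsCell

end MetricGraph

/-! ### Affine coordinates on the cells of a family, and its time functions. -/

namespace MetricGraph

variable {V E : Type*} [Fintype E] {G : MetricGraph V E} {Sig : Set V} {T : ℝ}

lemma exists_live_of_amp_ne_zero {γ : V} (hγ : γ ∈ Sig) {x : E × ℝ} {t : ℝ} (ht : t ≤ T)
    (h : G.amp γ x t ≠ 0) : ∃ b, G.Live Sig T x.1 b x.2 t := by
  obtain ⟨b, -, hb⟩ := Finset.exists_ne_zero_of_sum_ne_zero h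
  exact ⟨b, ht, γ, hγ, hb⟩

namespace Parametrization

variable (D : G.Parametrization Sig T)

lemma ε_pos (j : Fin D.J) : 0 < D.ε j := by
  have := (D.isCell j (D.base j)).2.1
  unfold ε
  linarith

lemma mid_mem (j : Fin D.J) : D.ε j / 2 ∈ Set.Ioo 0 (D.ε j) := by
  have := D.ε_pos j
  constructor <;> linarith

/-- The sign with which the base cell is parametrised. -/
noncomputable def baseSign (j : Fin D.J) : ℝ := if D.rev j then -1 else 1

lemma baseSign_eq (j : Fin D.J) : D.baseSign j = 1 ∨ D.baseSign j = -1 := by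
  unfold baseSign
  split_ifs <;> simp

lemma basePoint_eq (j : Fin D.J) (r : ℝ) :
    (D.basePoint j r).2 = (D.basePoint j 0).2 + D.baseSign j * r := by
  unfold basePoint baseSign
  split_ifs
  · simp; ring
  · simp

lemma basePoint_mem_iff (j : Fin D.J) (r : ℝ) :
    (D.basePoint j r).2 ∈ Set.Ioo (D.cell j (D.base j)).2.1 (D.cell j (D.base j)).2.2 ↔
      r ∈ Set.Ioo 0 (D.ε j) := by
  unfold basePoint ε
  simp only [Set.mem_Ioo]
  split_ifs <;> constructor <;> rintro ⟨h1, h2⟩ <;> constructor <;> linarith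

lemma exists_basePoint {j : Fin D.J} {z : ℝ}
    (hz : z ∈ Set.Ioo (D.cell j (D.base j)).2.1 (D.cell j (D.base j)).2.2) :
    ∃ r ∈ Set.Ioo 0 (D.ε j), D.basePoint j r = ((D.cell j (D.base j)).1, z) := by
  have key : ∃ r, (D.basePoint j r).2 = z := by
    unfold basePoint
    by_cases h : D.rev j
    · exact ⟨(D.cell j (D.base j)).2.2 - z, by simp [h]⟩
    · exact ⟨z - (D.cell j (D.base j)).2.1, by simp [h]⟩
  obtain ⟨r, rfl⟩ := key
  exact ⟨r, (D.basePoint_mem_iff j r).1 hz, rfl⟩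

variable [Finite V]

/-- Being in one family means that some lattice has points over both cells, and then the two are
isometric; composing with the affine coordinate of the base cell gives `c + σ * r`. The choice made
in `coord` agrees with it because a lattice has at most one point in a cell. -/
theorem exists_coord (j : Fin D.J) (k : Fin (D.m j)) :
    ∃ c σ : ℝ, (σ = 1 ∨ σ = -1) ∧ ∀ r,
      (c + σ * r ∈ Set.Ioo (D.cell j k).2.1 (D.cell j k).2.2 ↔ r ∈ Set.Ioo 0 (D.ε j)) ∧
      (r ∈ Set.Ioo 0 (D.ε j) → D.coord j k r = c + σ * r ∧
        G.Rel Sig T (Sum.inr (D.basePoint j r)) (Sum.inr ((D.cell j k).1, c + σ * r))) := by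
  have hc0 := D.isCell j (D.base j)
  have hck := D.isCell j k
  have hbase : ∀ r ∈ Set.Ioo 0 (D.ε j), (D.basePoint j r).2 ∈
    Set.Ioo (D.cell j (D.base j)).2.1 (D.cell j (D.base j)).2.2 := fun r hr =>
      (D.basePoint_mem_iff j r).2 hr
  set s' := ((D.cell j k).2.1 + (D.cell j k).2.2) / 2 with hs'
  have hlt := hck.2.1
  have hs'm : s' ∈ Set.Ioo (D.cell j k).2.1 (D.cell j k).2.2 := ⟨by linarith, by linarith⟩
  obtain ⟨_, ⟨s, hs, rfl⟩, hrel⟩ := mem_det_iff.1 ((D.family_iff j (D.base j) j k).2 rfl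
    (show (Sum.inr ((D.cell j k).1, s') : V ⊕ E × ℝ) ∈ interval (D.cell j k) from ⟨s', hs'm, rfl⟩))
  obtain ⟨σ, hσ, hiso⟩ := IsCell.exists_isometry hc0 hck hs hs'm hrel
  set c := s' + σ * ((D.basePoint j 0).2 - s) with hc
  have hθ : ∀ r, c + σ * D.baseSign j * r = s' + σ * ((D.basePoint j r).2 - s) := by
    intro r
    rw [D.basePoint_eq j r, hc]
    ring
  have hmaps : ∀ r ∈ Set.Ioo 0 (D.ε j),
      c + σ * D.baseSign j * r ∈ Set.Ioo (D.cell j k).2.1 (D.cell j k).2.2 ∧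
      G.Rel Sig T (Sum.inr (D.basePoint j r))
        (Sum.inr ((D.cell j k).1, c + σ * D.baseSign j * r)) := by
    intro r hr
    rw [hθ]
    exact hiso _ (hbase r hr)
  have huniq : ∀ r ∈ Set.Ioo 0 (D.ε j), ∀ z ∈ Set.Ioo (D.cell j k).2.1 (D.cell j k).2.2,
      G.Rel Sig T (Sum.inr (D.basePoint j r)) (Sum.inr ((D.cell j k).1, z)) →
      z = c + σ * D.baseSign j * r := fun r hr z hz hzr =>
    IsCell.eq_of_rel hck hz (hmaps r hr).1 (hzr.symm.trans (hmaps r hr).2)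
  have hτ : σ * D.baseSign j = 1 ∨ σ * D.baseSign j = -1 := by
    rcases hσ with rfl | rfl <;> rcases D.baseSign_eq j with h | h <;> simp [h]
  refine ⟨c, σ * D.baseSign j, hτ, fun r => ⟨⟨fun hr => ?_, fun hr => (hmaps r hr).1⟩,
    fun hr => ⟨?_, (hmaps r hr).2⟩⟩⟩
  · obtain ⟨z, hz, hzr⟩ := IsCell.exists_rel hc0 hck hs hs'm hrel hr
    obtain ⟨r', hr', hb⟩ := D.exists_basePoint hz
    have := huniq r' hr' _ hr (by rw [hb]; exact hzr)
    have h2 : r = r' := by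
      rcases hτ with h | h <;> rw [h] at this <;> linarith
    rwa [h2]
  · have hex : ∃ z, z ∈ Set.Ioo (D.cell j k).2.1 (D.cell j k).2.2 ∧
        Sum.inr ((D.cell j k).1, z) ∈ G.det Sig T {Sum.inr (D.basePoint j r)} :=
      ⟨_, (hmaps r hr).1, mem_det_singleton.2 (hmaps r hr).2⟩
    have hsp := Classical.epsilon_spec hex
    exact huniq r hr _ hsp.1 (mem_det_singleton.1 hsp.2)

/-- The constant term of the affine parametrisation of a cell. -/
noncomputable def shift (j : Fin D.J) (k : Fin (D.m j)) : ℝ := (D.exists_coord j k).choose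

/-- The sign of the affine parametrisation of a cell. -/
noncomputable def sign (j : Fin D.J) (k : Fin (D.m j)) : ℝ :=
  (D.exists_coord j k).choose_spec.choose

/-- The affine parametrisation of a cell. -/
noncomputable def aff (j : Fin D.J) (k : Fin (D.m j)) (r : ℝ) : ℝ := D.shift j k + D.sign j k * r

lemma sign_eq (j : Fin D.J) (k : Fin (D.m j)) : D.sign j k = 1 ∨ D.sign j k = -1 :=
  (D.exists_coord j k).choose_spec.choose_spec.1

lemma sign_mul_self (j : Fin D.J) (k : Fin (D.m j)) : D.sign j k * D.sign j k = 1 := by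
  rcases D.sign_eq j k with h | h <;> simp [h]

lemma aff_mem_iff (j : Fin D.J) (k : Fin (D.m j)) (r : ℝ) :
    D.aff j k r ∈ Set.Ioo (D.cell j k).2.1 (D.cell j k).2.2 ↔ r ∈ Set.Ioo 0 (D.ε j) :=
  ((D.exists_coord j k).choose_spec.choose_spec.2 r).1

lemma coord_eq (j : Fin D.J) (k : Fin (D.m j)) {r : ℝ} (hr : r ∈ Set.Ioo 0 (D.ε j)) :
    D.coord j k r = D.aff j k r :=
  (((D.exists_coord j k).choose_spec.choose_spec.2 r).2 hr).1

lemma rel_aff (j : Fin D.J) (k : Fin (D.m j)) {r : ℝ} (hr : r ∈ Set.Ioo 0 (D.ε j)) :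
    G.Rel Sig T (Sum.inr (D.basePoint j r)) (Sum.inr ((D.cell j k).1, D.aff j k r)) :=
  (((D.exists_coord j k).choose_spec.choose_spec.2 r).2 hr).2

lemma pt_eq (j : Fin D.J) (k : Fin (D.m j)) {r : ℝ} (hr : r ∈ Set.Ioo 0 (D.ε j)) :
    D.pt j k r = ((D.cell j k).1, D.aff j k r) := by
  rw [pt, D.coord_eq j k hr]

lemma aff_sub (j : Fin D.J) (k : Fin (D.m j)) (r r' : ℝ) :
    D.aff j k r' = D.aff j k r + D.sign j k * (r' - r) := by
  unfold aff
  ring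

lemma aff_injective (j : Fin D.J) (k : Fin (D.m j)) : Function.Injective (D.aff j k) := by
  intro r r' h
  unfold aff at h
  rcases D.sign_eq j k with hs | hs <;> rw [hs] at h <;> linarith

lemma aff_surjective (j : Fin D.J) (k : Fin (D.m j)) (z : ℝ) : ∃ r, D.aff j k r = z := by
  refine ⟨D.sign j k * (z - D.shift j k), ?_⟩
  unfold aff
  linear_combination (z - D.shift j k) * D.sign_mul_self j k

lemma regular_aff (j : Fin D.J) (k : Fin (D.m j)) {r : ℝ} (hr : r ∈ Set.Ioo 0 (D.ε j)) :
    Sum.inr ((D.cell j k).1, D.aff j k r) ∈ G.regular Sig T :=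
  IsCell.regular_of_mem (D.isCell j k) ((D.aff_mem_iff j k r).2 hr)

/-- Different cells are disjoint. -/
lemma aff_cell_injective {j j' : Fin D.J} {k : Fin (D.m j)} {k' : Fin (D.m j')} {r r' : ℝ}
    (hr : r ∈ Set.Ioo 0 (D.ε j)) (hr' : r' ∈ Set.Ioo 0 (D.ε j'))
    (h1 : (D.cell j k).1 = (D.cell j' k').1) (h2 : D.aff j k r = D.aff j' k' r') :
    (⟨j, k⟩ : Σ j, Fin (D.m j)) = ⟨j', k'⟩ ∧ r = r' := by
  have hc := D.isCell j k
  have hc' := D.isCell j' k'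
  have hm := (D.aff_mem_iff j k r).2 hr
  have hm' := (D.aff_mem_iff j' k' r').2 hr'
  have heq : D.cell j k = D.cell j' k' := by
    have h3 : D.cell j k = ((D.cell j' k').1, (D.cell j k).2.1, (D.cell j k).2.2) := by
      rw [← h1]
    rw [h3] at hc
    have := IsCell.eq_of_mem hc hc' (h2 ▸ hm) hm'
    rw [h3, this.1, this.2]
  have hk : (⟨j, k⟩ : Σ j, Fin (D.m j)) = ⟨j', k'⟩ := D.cell_injective heq
  refine ⟨hk, ?_⟩
  cases hk
  exact D.aff_injective j k h2

/-- One common lattice makes the determination sets of the first cell cover the second, so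
`family_iff` gives `j = j'`; uniqueness of lattice points in the base cell then gives `r = r'`. All
disjointness of times rests on this. -/
lemma eq_of_rel_basePoint {j j' : Fin D.J} {r r' : ℝ}
    (hr : r ∈ Set.Ioo 0 (D.ε j)) (hr' : r' ∈ Set.Ioo 0 (D.ε j'))
    (h : G.Rel Sig T (Sum.inr (D.basePoint j r)) (Sum.inr (D.basePoint j' r'))) :
    j = j' ∧ r = r' := by
  have hc := D.isCell j (D.base j)
  have hc' := D.isCell j' (D.base j')
  have hm := (D.basePoint_mem_iff j r).2 hr
  have hm' := (D.basePoint_mem_iff j' r').2 hr'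
  have hj : j = j' := by
    refine (D.family_iff j (D.base j) j' (D.base j')).1 ?_
    rintro _ ⟨z, hz, rfl⟩
    obtain ⟨w, hw, hrel⟩ := IsCell.exists_rel hc hc' hm hm' h hz
    exact mem_det_iff.2 ⟨_, ⟨w, hw, rfl⟩, hrel⟩
  refine ⟨hj, ?_⟩
  subst hj
  have := IsCell.eq_of_rel hc hm hm' h
  rw [D.basePoint_eq j r, D.basePoint_eq j r'] at this
  rcases D.baseSign_eq j with hs | hs <;> rw [hs] at this <;> linarith

lemma exists_aff_of_regular {e : E} {s : ℝ} (h : Sum.inr (e, s) ∈ G.regular Sig T) :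
    ∃ j k, ∃ r ∈ Set.Ioo 0 (D.ε j), (D.cell j k).1 = e ∧ D.aff j k r = s := by
  obtain ⟨p, q, hc, h1, h2⟩ := exists_cell h
  obtain ⟨j, k, hk⟩ := D.cell_surjective _ hc
  obtain ⟨r, rfl⟩ := D.aff_surjective j k s
  refine ⟨j, k, r, (D.aff_mem_iff j k r).1 ?_, by rw [hk], rfl⟩
  rw [hk]
  exact ⟨h1, h2⟩

/-- `t` is a time of the lattice of the base point of the `j`-th family with parameter `r`. -/
def IsTime (j : Fin D.J) (r t : ℝ) : Prop :=
  ∃ k b, G.Live Sig T (D.cell j k).1 b (D.aff j k r) t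

lemma aff_mem_edge (j : Fin D.J) (k : Fin (D.m j)) {r : ℝ} (hr : r ∈ Set.Ioo 0 (D.ε j)) :
    0 < D.aff j k r ∧ D.aff j k r < G.len (D.cell j k).1 := by
  have := regular_live (D.regular_aff j k hr)
  exact ⟨this.1, this.2.1⟩

/-- Simultaneous impulses lie on one lattice, hence over the same family and the same parameter. -/
lemma isTime_of_live {j : Fin D.J} {k : Fin (D.m j)} {r t : ℝ} (hr : r ∈ Set.Ioo 0 (D.ε j))
    {e : E} {s : ℝ} (h0 : 0 < s) (h1 : s < G.len e) {b b' : Bool}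
    (hl : G.Live Sig T (D.cell j k).1 b (D.aff j k r) t) (hl' : G.Live Sig T e b' s t) :
    ∃ k', (D.cell j k').1 = e ∧ D.aff j k' r = s := by
  have hm := mem_hydraT_inr.2 ⟨(D.aff_mem_edge j k hr).1, (D.aff_mem_edge j k hr).2, b, hl⟩
  have hm' := mem_hydraT_inr.2 ⟨h0, h1, b', hl'⟩
  have hrel : G.Rel Sig T (Sum.inr ((D.cell j k).1, D.aff j k r)) (Sum.inr (e, s)) :=
    ⟨t, t, hm, linked_of_same_time hm hm'⟩
  obtain ⟨j', k', r', hr', rfl, rfl⟩ :=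
    D.exists_aff_of_regular (hrel.regular (D.regular_aff j k hr))
  obtain ⟨rfl, rfl⟩ := D.eq_of_rel_basePoint hr hr'
    (((D.rel_aff j k hr).trans hrel).trans (D.rel_aff j' k' hr').symm)
  exact ⟨k', rfl, rfl⟩

lemma mem_times_iff {j : Fin D.J} {r t : ℝ} (hr : r ∈ Set.Ioo 0 (D.ε j)) :
    t ∈ G.times Sig T {Sum.inr (D.basePoint j r)} ↔ D.IsTime j r t := by
  constructor
  · rintro ⟨⟨y, t'⟩, ⟨hm', ⟨x, t₀⟩, ⟨hx, hm⟩, hl⟩, rfl⟩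
    obtain rfl : x = _ := hx
    have hrel : G.Rel Sig T (Sum.inr (D.basePoint j r)) y := ⟨t₀, t', hm, hl⟩
    have hreg := hrel.regular
      (IsCell.regular_of_mem (D.isCell j (D.base j)) ((D.basePoint_mem_iff j r).2 hr))
    rcases y with v | ⟨e, s⟩
    · exact absurd hreg (inl_notMem_regular v)
    obtain ⟨j', k', r', hr', rfl, rfl⟩ := D.exists_aff_of_regular hreg
    obtain ⟨rfl, rfl⟩ := D.eq_of_rel_basePoint hr hr' (hrel.trans (D.rel_aff j' k' hr').symm)
    obtain ⟨-, -, b, hb⟩ := mem_hydraT_inr.1 hm'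
    exact ⟨k', b, hb⟩
  · rintro ⟨k, b, hb⟩
    obtain ⟨t₁, t₂, hm, hl⟩ := D.rel_aff j k hr
    have hm' := mem_hydraT_inr.2 ⟨(D.aff_mem_edge j k hr).1, (D.aff_mem_edge j k hr).2, b, hb⟩
    exact ⟨(_, t), ⟨hm', (_, t₁), ⟨rfl, hm⟩, hl.trans (linked_of_same_point (hl.mem hm) hm')⟩,
      rfl⟩

lemma IsTime.unique {j j' : Fin D.J} {r r' t : ℝ} (hr : r ∈ Set.Ioo 0 (D.ε j))
    (hr' : r' ∈ Set.Ioo 0 (D.ε j')) (h : D.IsTime j r t) (h' : D.IsTime j' r' t) :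
    j = j' ∧ r = r' := by
  obtain ⟨k, b, hb⟩ := h
  obtain ⟨k', b', hb'⟩ := h'
  have hm := mem_hydraT_inr.2 ⟨(D.aff_mem_edge j k hr).1, (D.aff_mem_edge j k hr).2, b, hb⟩
  have hm' := mem_hydraT_inr.2
    ⟨(D.aff_mem_edge j' k' hr').1, (D.aff_mem_edge j' k' hr').2, b', hb'⟩
  exact D.eq_of_rel_basePoint hr hr' (((D.rel_aff j k hr).trans
    ⟨t, t, hm, linked_of_same_time hm hm'⟩).trans (D.rel_aff j' k' hr').symm)

lemma live_line {j : Fin D.J} {k : Fin (D.m j)} {b : Bool} {r r' t : ℝ}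
    (hr : r ∈ Set.Ioo 0 (D.ε j)) (hr' : r' ∈ Set.Ioo 0 (D.ε j))
    (h : G.Live Sig T (D.cell j k).1 b (D.aff j k r) t) :
    G.Live Sig T (D.cell j k).1 b (D.aff j k r') (t + dirSign b * D.sign j k * (r' - r)) := by
  have hm := (D.aff_mem_iff j k r).2 hr
  have := h.extend_regular hm.1 hm.2 (fun z hz => IsCell.regular_of_mem (D.isCell j k) hz) _
    (Set.Ioo_subset_Icc_self ((D.aff_mem_iff j k r').2 hr'))
  rw [D.aff_sub j k r r', add_sub_cancel_left, ← mul_assoc] at this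
  rwa [D.aff_sub j k r r']

lemma dirSign_mul_sign (b : Bool) (j : Fin D.J) (k : Fin (D.m j)) :
    dirSign b * D.sign j k = 1 ∨ dirSign b * D.sign j k = -1 := by
  rcases dirSign_eq b with h | h <;> rcases D.sign_eq j k with h' | h' <;> simp [h, h']

lemma IsTime.exists_sign {j : Fin D.J} {r t : ℝ} (hr : r ∈ Set.Ioo 0 (D.ε j))
    (h : D.IsTime j r t) : ∃ τ : ℝ, (τ = 1 ∨ τ = -1) ∧ ∀ r' ∈ Set.Ioo 0 (D.ε j),
      D.IsTime j r' (t + τ * (r' - r)) := by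
  obtain ⟨k, b, hb⟩ := h
  exact ⟨_, D.dirSign_mul_sign b j k, fun r' hr' => ⟨k, b, D.live_line hr hr' hb⟩⟩

/-- Two lines of opposite slope through `(r, t)` would give the same time to the distinct parameters
`r + η` and `r - η`, although a time determines its parameter. -/
lemma timeLine_sign_unique {j : Fin D.J} {r t τ τ' : ℝ} (hr : r ∈ Set.Ioo 0 (D.ε j))
    (hτ : τ = 1 ∨ τ = -1) (hτ' : τ' = 1 ∨ τ' = -1)
    (h : ∀ r' ∈ Set.Ioo 0 (D.ε j), D.IsTime j r' (t + τ * (r' - r)))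
    (h' : ∀ r' ∈ Set.Ioo 0 (D.ε j), D.IsTime j r' (t + τ' * (r' - r))) : τ = τ' := by
  by_contra hne
  have hopp : τ' = -τ := by
    rcases hτ with rfl | rfl <;> rcases hτ' with rfl | rfl <;> simp_all
  obtain ⟨η, hη, hη1, hη2⟩ : ∃ η > 0, η < r ∧ η < D.ε j - r := by
    refine ⟨min r (D.ε j - r) / 2, ?_, ?_, ?_⟩
    · have : 0 < min r (D.ε j - r) := lt_min hr.1 (by linarith [hr.2])
      linarith
    · have := min_le_left r (D.ε j - r)
      have := hr.1
      linarith
    · have := min_le_right r (D.ε j - r)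
      have := hr.2
      linarith
  have m1 : r + η ∈ Set.Ioo 0 (D.ε j) := ⟨by linarith [hr.1], by linarith⟩
  have m2 : r - η ∈ Set.Ioo 0 (D.ε j) := ⟨by linarith, by linarith [hr.2]⟩
  have a1 := h _ m1
  have a2 := h' _ m2
  have heq : t + τ' * (r - η - r) = t + τ * (r + η - r) := by rw [hopp]; ring
  rw [heq] at a2
  have := (IsTime.unique D m1 m2 a1 a2).2
  linarith

lemma times_mid_finite (j : Fin D.J) :
    (G.times Sig T {Sum.inr (D.basePoint j (D.ε j / 2))}).Finite := by
  refine (Set.finite_iUnion fun k : Fin (D.m j) => Set.finite_iUnion fun b : Bool =>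
    (G.pulseTimes_finite Sig T ((D.cell j k).1, b)).image
      (· + G.offset ((D.cell j k).1, b) (D.aff j k (D.ε j / 2)))).subset ?_
  intro t ht
  obtain ⟨k, b, hb⟩ := (D.mem_times_iff (D.mid_mem j)).1 ht
  have hm := D.aff_mem_edge j k (D.mid_mem j)
  exact Set.mem_iUnion.2 ⟨k, Set.mem_iUnion.2 ⟨b, _, hb.emission hm.1.le hm.2.le, by simp⟩⟩

lemma mem_timeSet_iff {j : Fin D.J} {t : ℝ} :
    t ∈ D.timeSet j ↔ D.IsTime j (D.ε j / 2) t := by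
  rw [← D.mem_times_iff (D.mid_mem j), timeSet, dif_pos (D.times_mid_finite j),
    Set.Finite.mem_toFinset]

lemma isTime_time (j : Fin D.J) (i : Fin (D.n j)) : D.IsTime j (D.ε j / 2) (D.time j i) :=
  D.mem_timeSet_iff.1 (Finset.orderEmbOfFin_mem _ _ _)

/-- The sign of the slope of the `i`-th time of the `j`-th family as a function of `r`. -/
noncomputable def timeSign (j : Fin D.J) (i : Fin (D.n j)) : ℝ :=
  (IsTime.exists_sign D (D.mid_mem j) (D.isTime_time j i)).choose

/-- The `i`-th time of the lattice of the base point with parameter `r`. -/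
noncomputable def timeFun (j : Fin D.J) (i : Fin (D.n j)) (r : ℝ) : ℝ :=
  D.time j i + D.timeSign j i * (r - D.ε j / 2)

lemma timeSign_eq (j : Fin D.J) (i : Fin (D.n j)) : D.timeSign j i = 1 ∨ D.timeSign j i = -1 :=
  (IsTime.exists_sign D (D.mid_mem j) (D.isTime_time j i)).choose_spec.1

lemma isTime_timeFun (j : Fin D.J) (i : Fin (D.n j)) {r : ℝ} (hr : r ∈ Set.Ioo 0 (D.ε j)) :
    D.IsTime j r (D.timeFun j i r) :=
  (IsTime.exists_sign D (D.mid_mem j) (D.isTime_time j i)).choose_spec.2 r hr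

lemma timeFun_mid (j : Fin D.J) (i : Fin (D.n j)) :
    D.timeFun j i (D.ε j / 2) = D.time j i := by
  simp [timeFun]

lemma timeFun_sub (j : Fin D.J) (i : Fin (D.n j)) (r r' : ℝ) :
    D.timeFun j i r' = D.timeFun j i r + D.timeSign j i * (r' - r) := by
  unfold timeFun
  ring

lemma continuous_timeFun (j : Fin D.J) (i : Fin (D.n j)) : Continuous (D.timeFun j i) := by
  unfold timeFun
  fun_prop

lemma timeFun_injective (j : Fin D.J) (i : Fin (D.n j)) : Function.Injective (D.timeFun j i) := by
  intro r r' h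
  unfold timeFun at h
  rcases D.timeSign_eq j i with hs | hs <;> rw [hs] at h <;> linarith

lemma IsTime.bounds {j : Fin D.J} {r t : ℝ} (hr : r ∈ Set.Ioo 0 (D.ε j)) (h : D.IsTime j r t) :
    0 < t ∧ t ≤ T := by
  obtain ⟨k, b, hT, γ, -, hb⟩ := h
  have := D.aff_mem_edge j k hr
  exact ⟨G.time_pos_of_run_ne_zero this.1 this.2 hb, hT⟩

lemma timeSign_unique {j : Fin D.J} {i : Fin (D.n j)} {r τ : ℝ} (hr : r ∈ Set.Ioo 0 (D.ε j))
    (hτ : τ = 1 ∨ τ = -1)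
    (h : ∀ r' ∈ Set.Ioo 0 (D.ε j), D.IsTime j r' (D.timeFun j i r + τ * (r' - r))) :
    τ = D.timeSign j i := by
  refine D.timeLine_sign_unique hr hτ (D.timeSign_eq j i) h fun r' hr' => ?_
  rw [← D.timeFun_sub]
  exact D.isTime_timeFun j i hr'

lemma timeFun_index_injective {j : Fin D.J} {i i' : Fin (D.n j)} {r : ℝ}
    (hr : r ∈ Set.Ioo 0 (D.ε j)) (h : D.timeFun j i r = D.timeFun j i' r) : i = i' := by
  have hs : D.timeSign j i = D.timeSign j i' := by
    refine D.timeSign_unique hr (D.timeSign_eq j i) fun r' hr' => ?_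
    rw [← h, ← D.timeFun_sub]
    exact D.isTime_timeFun j i hr'
  have : D.time j i = D.time j i' := by
    unfold timeFun at h
    rw [hs] at h
    linarith
  exact (Finset.orderEmbOfFin _ _).injective this

/-- The time cells of different families are disjoint, and those of one family are disjoint. -/
theorem timeFun_inj {j j' : Fin D.J} {i : Fin (D.n j)} {i' : Fin (D.n j')} {r r' : ℝ}
    (hr : r ∈ Set.Ioo 0 (D.ε j)) (hr' : r' ∈ Set.Ioo 0 (D.ε j'))
    (h : D.timeFun j i r = D.timeFun j' i' r') :
    (⟨j, i⟩ : Σ j, Fin (D.n j)) = ⟨j', i'⟩ ∧ r = r' := by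
  have h1 := D.isTime_timeFun j i hr
  rw [h] at h1
  obtain ⟨rfl, rfl⟩ := IsTime.unique D hr hr' h1 (D.isTime_timeFun j' i' hr')
  obtain rfl := D.timeFun_index_injective hr h
  exact ⟨rfl, rfl⟩

lemma IsTime.exists_timeFun {j : Fin D.J} {r t : ℝ} (hr : r ∈ Set.Ioo 0 (D.ε j))
    (h : D.IsTime j r t) : ∃ i, t = D.timeFun j i r := by
  obtain ⟨τ, hτ, hline⟩ := IsTime.exists_sign D hr h
  have hmid := D.mem_timeSet_iff.2 (hline _ (D.mid_mem j))
  obtain ⟨i, hi⟩ : ∃ i : Fin (D.n j), D.time j i = t + τ * (D.ε j / 2 - r) := by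
    have : t + τ * (D.ε j / 2 - r) ∈ Set.range (D.timeSet j |>.orderEmbOfFin rfl) := by
      rw [Finset.range_orderEmbOfFin]
      exact hmid
    obtain ⟨i, hi⟩ := this
    exact ⟨i, hi⟩
  have hs : τ = D.timeSign j i := by
    refine D.timeSign_unique (D.mid_mem j) hτ fun r' hr' => ?_
    rw [timeFun_mid, hi]
    convert hline r' hr' using 1
    ring
  refine ⟨i, ?_⟩
  rw [timeFun, hi, ← hs]
  ring

/-- A change of order would force a crossing of two time functions, which `timeFun_index_injective`
forbids. Hence one Gram-Schmidt order is right for every `r`. -/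
lemma timeFun_strictMono {j : Fin D.J} {r : ℝ} (hr : r ∈ Set.Ioo 0 (D.ε j)) :
    StrictMono fun i => D.timeFun j i r := by
  intro i i' hii
  have hlt : D.time j i < D.time j i' := (Finset.orderEmbOfFin _ _).strictMono hii
  by_contra! hle
  have h0 : (0 : ℝ) ∈ Set.uIcc (D.timeFun j i' (D.ε j / 2) - D.timeFun j i (D.ε j / 2))
      (D.timeFun j i' r - D.timeFun j i r) := by
    rw [timeFun_mid, timeFun_mid]
    exact Set.mem_uIcc.2 (Or.inr ⟨by linarith, by linarith⟩)
  obtain ⟨v, hv, hv0⟩ := intermediate_value_uIcc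
    (f := fun r => D.timeFun j i' r - D.timeFun j i r) (a := D.ε j / 2) (b := r)
    ((D.continuous_timeFun j i').sub (D.continuous_timeFun j i)).continuousOn h0
  have hvI := (Set.ordConnected_Ioo (a := 0) (b := D.ε j)).uIcc_subset (D.mid_mem j) hr hv
  have := D.timeFun_index_injective hvI (sub_eq_zero.1 hv0)
  exact absurd this hii.ne'

/-- An impulse present at one `r` traces a line of times of slope `dirSign b * sign`; the slope
through a given time is unique, so this line is `timeFun`, and amplitudes are constant along it. If
no impulse is present at either parameter, both sides vanish. -/
lemma run_const {γ : V} (hγ : γ ∈ Sig) {j : Fin D.J} (k : Fin (D.m j)) (b : Bool)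
    (i : Fin (D.n j)) {r r' : ℝ} (hr : r ∈ Set.Ioo 0 (D.ε j)) (hr' : r' ∈ Set.Ioo 0 (D.ε j)) :
    G.run γ ((D.cell j k).1, b) (D.aff j k r) (D.timeFun j i r) =
      G.run γ ((D.cell j k).1, b) (D.aff j k r') (D.timeFun j i r') := by
  have key : ∀ r ∈ Set.Ioo 0 (D.ε j), ∀ r' ∈ Set.Ioo 0 (D.ε j),
      G.run γ ((D.cell j k).1, b) (D.aff j k r) (D.timeFun j i r) ≠ 0 →
      G.run γ ((D.cell j k).1, b) (D.aff j k r) (D.timeFun j i r) =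
      G.run γ ((D.cell j k).1, b) (D.aff j k r') (D.timeFun j i r') := by
    intro r hr r' hr' hne
    have hl : G.Live Sig T (D.cell j k).1 b (D.aff j k r) (D.timeFun j i r) :=
      ⟨(IsTime.bounds D hr (D.isTime_timeFun j i hr)).2, γ, hγ, hne⟩
    have hs := D.timeSign_unique hr (D.dirSign_mul_sign b j k) fun r' hr' =>
      ⟨k, b, D.live_line hr hr' hl⟩
    rw [D.aff_sub j k r r', D.timeFun_sub j i r r', ← hs, mul_assoc, G.run_shift]
  by_cases h : G.run γ ((D.cell j k).1, b) (D.aff j k r) (D.timeFun j i r) = 0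
  · by_cases h' : G.run γ ((D.cell j k).1, b) (D.aff j k r') (D.timeFun j i r') = 0
    · rw [h, h']
    · exact (key r' hr' r hr h').symm
  · exact key r hr r' hr' h

lemma amp_eq_α {γ : V} (hγ : γ ∈ Sig) {j : Fin D.J} (k : Fin (D.m j)) (i : Fin (D.n j)) {r : ℝ}
    (hr : r ∈ Set.Ioo 0 (D.ε j)) :
    G.amp γ ((D.cell j k).1, D.aff j k r) (D.timeFun j i r) = D.α γ j i k := by
  unfold α amp
  simp only
  rw [D.pt_eq j k (D.mid_mem j)]
  refine Finset.sum_congr rfl fun b _ => ?_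
  simp only
  rw [← D.timeFun_mid j i]
  exact D.run_const hγ k b i hr (D.mid_mem j)

lemma exists_timeFun_of_amp_ne_zero {γ : V} (hγ : γ ∈ Sig) {j : Fin D.J} {k : Fin (D.m j)}
    {r t : ℝ} (hr : r ∈ Set.Ioo 0 (D.ε j)) (ht : t ≤ T)
    (h : G.amp γ ((D.cell j k).1, D.aff j k r) t ≠ 0) : ∃ i, t = D.timeFun j i r := by
  obtain ⟨b, hb⟩ := exists_live_of_amp_ne_zero hγ ht h
  exact IsTime.exists_timeFun D hr ⟨k, b, hb⟩

/-- At the times of a family no impulse from `Sig` is elsewhere than over its cells. This allows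
controls that excite one family only. -/
lemma exists_aff_of_amp_ne_zero {γ : V} (hγ : γ ∈ Sig) {j : Fin D.J} {i : Fin (D.n j)}
    {r : ℝ} (hr : r ∈ Set.Ioo 0 (D.ε j)) {e : E} {s : ℝ} (h0 : 0 < s) (h1 : s < G.len e)
    (h : G.amp γ (e, s) (D.timeFun j i r) ≠ 0) : ∃ k, (D.cell j k).1 = e ∧ D.aff j k r = s := by
  have ht := D.isTime_timeFun j i hr
  obtain ⟨b, hb⟩ := exists_live_of_amp_ne_zero hγ (IsTime.bounds D hr ht).2 h
  obtain ⟨k', b', hb'⟩ := ht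
  exact D.isTime_of_live hr h0 h1 hb' hb

end Parametrization

end MetricGraph

/-! ### Increasing families of projections and their Stieltjes sums. -/

section ProjectionChain

variable {H : Type*} [NormedAddCommGroup H] [InnerProductSpace ℝ H]

/-- An increasing family of orthogonal projections. -/
structure ProjectionChain {ι : Type*} [Preorder ι] (P : ι → H →L[ℝ] H) : Prop where
  mul_of_le : ∀ {k l}, k ≤ l → P k * P l = P k
  mul_of_ge : ∀ {k l}, k ≤ l → P l * P k = P k
  inner_comm : ∀ k x y, inner ℝ (P k x) y = inner ℝ x (P k y)

namespace ProjectionChain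

lemma comp {ι κ : Type*} [Preorder ι] [Preorder κ] {P : ι → H →L[ℝ] H} (hP : ProjectionChain P)
    {f : κ → ι} (hf : Monotone f) : ProjectionChain fun k => P (f k) where
  mul_of_le h := hP.mul_of_le (hf h)
  mul_of_ge h := hP.mul_of_ge (hf h)
  inner_comm k := hP.inner_comm (f k)

lemma norm_apply_le {ι : Type*} [Preorder ι] {P : ι → H →L[ℝ] H} (hP : ProjectionChain P) (k : ι)
    (y : H) : ‖P k y‖ ≤ ‖y‖ := by
  have h1 : ‖P k y‖ * ‖P k y‖ = inner ℝ (P k y) y := by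
    rw [← real_inner_self_eq_norm_mul_norm, ← hP.inner_comm]
    have : P k (P k y) = P k y := DFunLike.congr_fun (hP.mul_of_le le_rfl) y
    rw [this]
  have h2 := real_inner_le_norm (P k y) y
  rw [← h1] at h2
  by_contra! h
  have := norm_nonneg y
  nlinarith

variable {P : ℕ → H →L[ℝ] H} (hP : ProjectionChain P)

include hP

lemma diff_mul_diff (k l : ℕ) :
    (P (k + 1) - P k) * (P (l + 1) - P l) = if k = l then P (k + 1) - P k else 0 := by
  have h1 : ∀ a b, P a * P b = P (min a b) := by
    intro a b
    rcases le_total a b with h | h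
    · rw [min_eq_left h, hP.mul_of_le h]
    · rw [min_eq_right h, hP.mul_of_ge h]
  rw [sub_mul, mul_sub, mul_sub, h1, h1, h1, h1]
  rcases lt_trichotomy k l with h | rfl | h
  · rw [if_neg h.ne, min_eq_left (by omega), min_eq_left (by omega), min_eq_left (by omega),
      min_eq_left (by omega)]
    abel
  · simp
  · rw [if_neg h.ne', min_eq_right (by omega), min_eq_right (by omega), min_eq_right (by omega),
      min_eq_right (by omega)]
    abel

/-- Pythagoras for orthogonal increments. The first assertion is carried through the induction
because it makes the partial sum orthogonal to the next increment. -/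
lemma norm_sum_apply_sq_le {c : ℕ → ℝ} {C : ℝ} (N : ℕ)
    (hc : ∀ k < N, |c k| ≤ C) (y : H) :
    P N ((∑ k ∈ Finset.range N, c k • (P (k + 1) - P k)) y) =
      (∑ k ∈ Finset.range N, c k • (P (k + 1) - P k)) y ∧
    ‖(∑ k ∈ Finset.range N, c k • (P (k + 1) - P k)) y‖ ^ 2 ≤ C ^ 2 * ‖P N y‖ ^ 2 := by
  induction N with
  | zero => simp; positivity
  | succ N ih =>
    obtain ⟨ih1, ih2⟩ := ih fun k hk => hc k (by omega)
    set S := (∑ k ∈ Finset.range N, c k • (P (k + 1) - P k)) with hS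
    have hPP : ∀ a b, a ≤ b → ∀ z, P b (P a z) = P a z := fun a b h z =>
      DFunLike.congr_fun (hP.mul_of_ge h) z
    have hPP' : ∀ a b, a ≤ b → ∀ z, P a (P b z) = P a z := fun a b h z =>
      DFunLike.congr_fun (hP.mul_of_le h) z
    have horth : ∀ z w, inner ℝ (P N z) (P (N + 1) w - P N w) = 0 := by
      intro z w
      rw [hP.inner_comm, map_sub, hPP' N (N + 1) (by omega), hPP' N N le_rfl]
      simp
    rw [Finset.sum_range_succ, ← hS]
    simp only [add_apply, smul_apply, sub_apply, map_add, map_smul, map_sub]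
    constructor
    · rw [← ih1, hPP N (N + 1) (by omega), hPP N (N + 1) (by omega), hPP (N + 1) (N + 1) le_rfl]
    · have h1 : ‖S y + c N • (P (N + 1) y - P N y)‖ ^ 2 =
          ‖S y‖ ^ 2 + (c N) ^ 2 * ‖P (N + 1) y - P N y‖ ^ 2 := by
        rw [norm_add_sq_real, inner_smul_right, ← ih1, horth, norm_smul, mul_pow, Real.norm_eq_abs,
          sq_abs]
        ring
      have h2 : ‖P (N + 1) y‖ ^ 2 = ‖P N y‖ ^ 2 + ‖P (N + 1) y - P N y‖ ^ 2 := by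
        have := norm_add_sq_real (P N y) (P (N + 1) y - P N y)
        rw [horth, add_sub_cancel] at this
        linarith
      rw [h1, h2, mul_add]
      have h3 : (c N) ^ 2 ≤ C ^ 2 := by
        have := hc N (by omega)
        have h0 := abs_nonneg (c N)
        rw [← sq_abs]
        exact pow_le_pow_left₀ h0 this 2
      gcongr

lemma norm_sum_le {c : ℕ → ℝ} {C : ℝ} (hC : 0 ≤ C) (N : ℕ) (hc : ∀ k < N, |c k| ≤ C) :
    ‖∑ k ∈ Finset.range N, c k • (P (k + 1) - P k)‖ ≤ C := by
  refine ContinuousLinearMap.opNorm_le_bound _ hC fun y => ?_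
  refine (sq_le_sq₀ (norm_nonneg _) (by positivity)).1 ?_
  refine (hP.norm_sum_apply_sq_le N hc y).2.trans ?_
  rw [mul_pow]
  have := hP.norm_apply_le N y
  gcongr

end ProjectionChain

end ProjectionChain

/-- Polynomials of a combination of orthogonal idempotents. -/
lemma aeval_sum_smul_idempotents {A ι : Type*} [Ring A] [Algebra ℝ A] [DecidableEq ι]
    (s : Finset ι) (D : ι → A) (hD : ∀ k l, D k * D l = if k = l then D k else 0) (c : ι → ℝ)
    (p : Polynomial ℝ) (hp : p.coeff 0 = 0) :
    Polynomial.aeval (∑ k ∈ s, c k • D k) p = ∑ k ∈ s, p.eval (c k) • D k := by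
  have hpow : ∀ n : ℕ, (∑ k ∈ s, c k • D k) ^ (n + 1) = ∑ k ∈ s, (c k) ^ (n + 1) • D k := by
    intro n
    induction n with
    | zero => simp
    | succ n ih =>
      rw [pow_succ, ih, Finset.sum_mul]
      refine Finset.sum_congr rfl fun k hk => ?_
      rw [Finset.mul_sum, Finset.sum_eq_single k]
      · rw [smul_mul_smul_comm, hD, if_pos rfl, ← pow_succ]
      · intro l _ hl
        rw [smul_mul_smul_comm, hD, if_neg hl.symm, smul_zero]
      · exact fun h => absurd hk h
  rw [Polynomial.aeval_eq_sum_range]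
  simp_rw [Polynomial.eval_eq_sum_range, Finset.sum_smul]
  rw [Finset.sum_comm]
  refine Finset.sum_congr rfl fun n _ => ?_
  -- The constant term has to vanish, since the idempotents need not add up to `1`.
  rcases n with _ | n
  · simp [hp]
  · rw [hpow, Finset.smul_sum]
    simp_rw [mul_smul]

lemma Finset.sum_range_mul_block {M : Type*} [AddCommMonoid M] (g : ℕ → M) (N m : ℕ) :
    ∑ l ∈ range (N * m), g l = ∑ k ∈ range N, ∑ i ∈ range m, g (k * m + i) := by
  induction N with
  | zero => simp
  | succ N ih => rw [Nat.succ_mul, sum_range_add, ih, sum_range_succ]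

section Eikonal

variable {H : Type*} [NormedAddCommGroup H] [InnerProductSpace ℝ H]

/-- The Riemann-Stieltjes sum `∑ f(s_{k+1}) (P_{s_{k+1}} - P_{s_k})` over `N` equal steps. -/
noncomputable def stieltjesSum (P : ℝ → H →L[ℝ] H) (T : ℝ) (f : ℝ → ℝ) (N : ℕ) : H →L[ℝ] H :=
  ∑ k ∈ Finset.range N, f (((k : ℝ) + 1) * T / N) •
    (P (((k : ℝ) + 1) * T / N) - P ((k : ℝ) * T / N))

variable {P : ℝ → H →L[ℝ] H} {T : ℝ} (hT : 0 ≤ T)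
  (hP : ProjectionChain fun s : Set.Ici (0 : ℝ) => P s)

include hT hP

lemma projectionChain_grid (N : ℕ) : ProjectionChain fun k : ℕ => P ((k : ℝ) * T / N) := by
  have := hP.comp (κ := ℕ) (f := fun k => ⟨(k : ℝ) * T / N, by
    simp only [Set.mem_Ici]; positivity⟩) (by
    intro a b hab
    simp only [Subtype.mk_le_mk]
    gcongr)
  exact this

lemma norm_stieltjesSum_le {f : ℝ → ℝ} {C : ℝ} (hC : 0 ≤ C) (hf : ∀ s ∈ Set.Icc 0 T, |f s| ≤ C)
    (N : ℕ) : ‖stieltjesSum P T f N‖ ≤ C := by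
  have := (projectionChain_grid hT hP N).norm_sum_le (c := fun k => f (((k : ℝ) + 1) * T / N)) hC N
    (fun k hk => hf _ ?_)
  · simpa [stieltjesSum] using this
  · have hN : (0 : ℝ) < N := by exact_mod_cast (by omega : 0 < N)
    refine ⟨by positivity, ?_⟩
    rw [div_le_iff₀ hN, mul_comm]
    gcongr
    exact_mod_cast hk

lemma aeval_stieltjesSum (f : ℝ → ℝ) (N : ℕ) (p : Polynomial ℝ) (hp : p.coeff 0 = 0) :
    Polynomial.aeval (stieltjesSum P T f N) p = stieltjesSum P T (fun s => p.eval (f s)) N := by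
  have h := (projectionChain_grid hT hP N).diff_mul_diff
  have := aeval_sum_smul_idempotents (Finset.range N)
    (fun k : ℕ => P (((k + 1 : ℕ) : ℝ) * T / N) - P ((k : ℝ) * T / N))
    (fun k l => h k l) (fun k => f (((k : ℝ) + 1) * T / N)) p hp
  simpa [stieltjesSum] using this

/-- On the common refinement the coarse sum gives the `l`-th small step the right end of its coarse
interval, whose index is `l / m`. The weights of the two sums differ by at most `T / N`, and
orthogonality of the increments turns this into a bound in operator norm. -/
lemma norm_stieltjesSum_sub_le {N m : ℕ} (hN : 0 < N) (hm : 0 < m) :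
    ‖stieltjesSum P T id N - stieltjesSum P T id (N * m)‖ ≤ T / N := by
  have hN' : (0 : ℝ) < N := by exact_mod_cast hN
  have hm' : (0 : ℝ) < m := by exact_mod_cast hm
  set Q : ℕ → H →L[ℝ] H := fun k => P ((k : ℝ) * T / (N * m : ℕ)) with hQ
  have hQc : ProjectionChain Q := projectionChain_grid hT hP (N * m)
  have h1 : stieltjesSum P T id N = ∑ l ∈ Finset.range (N * m),
      (((l / m : ℕ) + 1) * T / N : ℝ) • (Q (l + 1) - Q l) := by
    rw [Finset.sum_range_mul_block, stieltjesSum]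
    refine Finset.sum_congr rfl fun k _ => ?_
    have hdiv : ∀ i ∈ Finset.range m, (k * m + i) / m = k := by
      intro i hi
      rw [Finset.mem_range] at hi
      rw [mul_comm, Nat.mul_add_div hm, Nat.div_eq_of_lt hi, add_zero]
    rw [Finset.sum_congr rfl fun i hi => by rw [hdiv i hi], ← Finset.smul_sum]
    have htel : ∑ i ∈ Finset.range m, (Q (k * m + i + 1) - Q (k * m + i)) =
        Q (k * m + m) - Q (k * m) := Finset.sum_range_sub (fun i => Q (k * m + i)) m
    rw [htel]
    have e1 : ((k * m + m : ℕ) : ℝ) * T / (N * m : ℕ) = ((k : ℝ) + 1) * T / N := by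
      push_cast
      field_simp
    have e2 : ((k * m : ℕ) : ℝ) * T / (N * m : ℕ) = (k : ℝ) * T / N := by
      push_cast
      field_simp
    simp only [hQ, id, e1, e2]
  have h2 : stieltjesSum P T id (N * m) = ∑ l ∈ Finset.range (N * m),
      (((l : ℝ) + 1) * T / (N * m : ℕ)) • (Q (l + 1) - Q l) := by
    simp [stieltjesSum, hQ]
  rw [h1, h2, ← Finset.sum_sub_distrib]
  simp_rw [← sub_smul]
  refine hQc.norm_sum_le (c := fun l => (((l / m : ℕ) + 1) * T / N : ℝ) -
    ((l : ℝ) + 1) * T / (N * m : ℕ)) (by positivity) _ fun l _ => ?_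
  have e1 : (((l / m : ℕ) + 1) * T / N : ℝ) - ((l : ℝ) + 1) * T / (N * m : ℕ) =
      T / N * ((((l / m : ℕ) : ℝ) * m + m - l - 1) / m) := by
    push_cast
    field_simp
    ring
  rw [e1, abs_mul, abs_of_nonneg (by positivity : 0 ≤ T / N)]
  refine mul_le_of_le_one_right (by positivity) ?_
  have hmod := Nat.div_add_mod l m
  have hlt := Nat.mod_lt l hm
  have e2 : ((l / m : ℕ) : ℝ) * m = l - (l % m : ℕ) := by
    have : (m : ℝ) * ((l / m : ℕ) : ℝ) + ((l % m : ℕ) : ℝ) = l := by exact_mod_cast hmod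
    linarith
  have e3 : ((l % m : ℕ) : ℝ) + 1 ≤ m := by exact_mod_cast hlt
  have e4 : (0 : ℝ) ≤ ((l % m : ℕ) : ℝ) := by positivity
  rw [e2, abs_le]
  constructor
  · rw [le_div_iff₀ hm']; linarith
  · rw [div_le_iff₀ hm']; linarith

lemma cauchySeq_stieltjesSum : CauchySeq (stieltjesSum P T id) := by
  rw [Metric.cauchySeq_iff]
  intro δ hδ
  obtain ⟨N₀, hN₀⟩ := exists_nat_gt (2 * T / δ)
  refine ⟨N₀ + 1, fun m hm n hn => ?_⟩
  have key : ∀ n : ℕ, N₀ + 1 ≤ n → T / n < δ / 2 := by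
    intro n hn
    have h1 : (N₀ : ℝ) < n := by exact_mod_cast hn
    have h2 : 2 * T / δ < n := hN₀.trans h1
    have h3 : (0 : ℝ) < n := lt_of_le_of_lt (by positivity) h1
    rw [div_lt_iff₀ hδ] at h2
    rw [div_lt_iff₀ h3]
    linarith
  have a1 := norm_stieltjesSum_sub_le hT hP (N := m) (m := n) (by omega) (by omega)
  have a2 := norm_stieltjesSum_sub_le hT hP (N := n) (m := m) (by omega) (by omega)
  rw [mul_comm] at a2
  have := key m hm
  have := key n hn
  rw [dist_eq_norm]
  calc _ = ‖(stieltjesSum P T id m - stieltjesSum P T id (m * n)) -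
        (stieltjesSum P T id n - stieltjesSum P T id (m * n))‖ := by congr 1; abel
    _ ≤ _ := norm_sub_le _ _
    _ < δ := by linarith

lemma tendsto_stieltjesSum [CompleteSpace H] :
    Tendsto (stieltjesSum P T id) atTop (𝓝 (limUnder atTop (stieltjesSum P T id))) :=
  tendsto_nhds_limUnder (cauchySeq_tendsto_of_complete (cauchySeq_stieltjesSum hT hP))

omit hT hP in
lemma stieltjesSum_add_one (h0 : P 0 = 0) {N : ℕ} (hN : 0 < N) :
    stieltjesSum P T (fun s => s + 1) N = stieltjesSum P T id N + P T := by
  have hN' : (N : ℝ) ≠ 0 := by positivity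
  unfold stieltjesSum
  simp_rw [add_smul, Finset.sum_add_distrib, one_smul, id]
  congr 1
  have := Finset.sum_range_sub (fun k : ℕ => P ((k : ℝ) * T / N)) N
  push_cast at this
  rw [this]
  simp [h0, mul_div_cancel_left₀ _ hN']

lemma tendsto_stieltjesSum_add_one [CompleteSpace H] (h0 : P 0 = 0) :
    Tendsto (stieltjesSum P T fun s => s + 1) atTop
      (𝓝 (limUnder atTop (stieltjesSum P T id) + P T)) := by
  refine ((tendsto_stieltjesSum hT hP).add_const (P T)).congr' ?_
  filter_upwards [eventually_gt_atTop 0] with N hN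
  rw [stieltjesSum_add_one h0 hN]

/-- The norm of a polynomial of the shifted eikonal. -/
lemma norm_aeval_eikonal_le [CompleteSpace H] (h0 : P 0 = 0) {p : Polynomial ℝ}
    (hp : p.coeff 0 = 0) {C : ℝ} (hC : 0 ≤ C)
    (hpC : ∀ s ∈ Set.Icc 0 T, |p.eval (s + 1)| ≤ C) :
    ‖Polynomial.aeval (limUnder atTop (stieltjesSum P T id) + P T) p‖ ≤ C := by
  have h1 := ((Polynomial.continuous_aeval p).tendsto _).comp
    (tendsto_stieltjesSum_add_one hT hP h0)
  refine le_of_tendsto h1.norm (Eventually.of_forall fun N => ?_)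
  simp only [Function.comp]
  rw [aeval_stieltjesSum hT hP _ N p hp]
  exact norm_stieltjesSum_le hT hP hC hpC N

end Eikonal

/-! ### Multiplication by bounded functions in `L²` -/

section BoundedMultiplication

variable {X : Type*} [MeasurableSpace X] {μ : Measure X}

/-- Bounded measurable functions. -/
def BoundedMeasurable (f : X → ℝ) : Prop := Measurable f ∧ ∃ C, ∀ x, |f x| ≤ C

lemma BoundedMeasurable.const (c : ℝ) : BoundedMeasurable fun _ : X => c :=
  ⟨measurable_const, |c|, fun _ => le_rfl⟩

lemma BoundedMeasurable.mul {f g : X → ℝ} (hf : BoundedMeasurable f) (hg : BoundedMeasurable g) :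
    BoundedMeasurable fun x => f x * g x := by
  obtain ⟨hf, C, hC⟩ := hf
  obtain ⟨hg, C', hC'⟩ := hg
  refine ⟨hf.mul hg, C * C', fun x => ?_⟩
  rw [abs_mul]
  exact mul_le_mul (hC x) (hC' x) (abs_nonneg _) ((abs_nonneg _).trans (hC x))

lemma BoundedMeasurable.sum {ι : Type*} (s : Finset ι) {f : ι → X → ℝ}
    (hf : ∀ i ∈ s, BoundedMeasurable (f i)) : BoundedMeasurable fun x => ∑ i ∈ s, f i x := by
  classical
  induction s using Finset.induction_on with
  | empty => simpa using BoundedMeasurable.const 0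
  | insert i s hi ih =>
    obtain ⟨h1, C1, hC1⟩ := hf i (Finset.mem_insert_self _ _)
    obtain ⟨h2, C2, hC2⟩ := ih fun k hk => hf k (Finset.mem_insert_of_mem hk)
    simp only [Finset.sum_insert hi]
    exact ⟨h1.add h2, C1 + C2, fun x => (abs_add_le _ _).trans (add_le_add (hC1 x) (hC2 x))⟩

lemma BoundedMeasurable.ite_le {f : X → ℝ} (hf : Measurable f) (s : ℝ) :
    BoundedMeasurable fun x => if f x ≤ s then (1 : ℝ) else 0 := by
  refine ⟨Measurable.ite (measurableSet_le hf measurable_const) measurable_const measurable_const,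
    1, fun x => ?_⟩
  dsimp only
  split_ifs <;> simp

lemma BoundedMeasurable.memLp_mul {f : X → ℝ} (hf : BoundedMeasurable f) (h : Lp ℝ 2 μ) :
    MemLp (fun x => f x * h x) 2 μ := by
  obtain ⟨hf, C, hC⟩ := hf
  refine (Lp.memLp h).of_le_mul (c := C)
    (hf.aestronglyMeasurable.mul (Lp.aestronglyMeasurable h)) (ae_of_all _ fun x => ?_)
  rw [norm_mul]
  gcongr
  exact hC x

open Classical in
/-- Multiplication by a bounded measurable function. -/
noncomputable def mulLp (f : X → ℝ) (h : Lp ℝ 2 μ) : Lp ℝ 2 μ :=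
  if hm : MemLp (fun x => f x * h x) 2 μ then hm.toLp else 0

lemma coeFn_mulLp {f : X → ℝ} (hf : BoundedMeasurable f) (h : Lp ℝ 2 μ) :
    mulLp f h =ᵐ[μ] fun x => f x * h x := by
  rw [mulLp, dif_pos (hf.memLp_mul h)]
  exact MemLp.coeFn_toLp _

lemma inner_mulLp {f : X → ℝ} (hf : BoundedMeasurable f) (g h : Lp ℝ 2 μ) :
    inner ℝ (mulLp f g) h = inner ℝ g (mulLp f h) := by
  rw [L2.inner_def, L2.inner_def]
  refine integral_congr_ae ?_
  filter_upwards [coeFn_mulLp hf g, coeFn_mulLp hf h] with x h1 h2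
  rw [h1, h2]
  simp only [RCLike.inner_apply, conj_trivial]
  ring

lemma coeFn_sum_Lp {ι : Type*} (s : Finset ι) (f : ι → Lp ℝ 2 μ) :
    (∑ i ∈ s, f i : Lp ℝ 2 μ) =ᵐ[μ] fun x => ∑ i ∈ s, f i x := by
  classical
  induction s using Finset.induction_on with
  | empty =>
    simp only [Finset.sum_empty]
    exact Lp.coeFn_zero ℝ 2 μ
  | insert i s hi ih =>
    rw [Finset.sum_insert hi]
    filter_upwards [Lp.coeFn_add (f i) (∑ i ∈ s, f i), ih] with x h1 h2
    rw [h1, Pi.add_apply, h2, Finset.sum_insert hi]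

end BoundedMultiplication

lemma measurePreserving_affine (c : ℝ) {σ : ℝ} (hσ : σ = 1 ∨ σ = -1) :
    MeasurePreserving (fun r : ℝ => c + σ * r) volume volume := by
  rcases hσ with rfl | rfl
  · simpa using measurePreserving_add_left (volume : Measure ℝ) c
  · have := (measurePreserving_add_left (volume : Measure ℝ) c).comp
      (Measure.measurePreserving_neg (volume : Measure ℝ))
    convert this using 2
    simp

/-! ### The space `L₂(Ω)` and its restriction to the cells. -/

namespace MetricGraph

variable {V E : Type*} [Fintype E] {G : MetricGraph V E} {Sig : Set V} {T : ℝ}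

namespace L2

/-- The restriction of a function on the graph to an edge. -/
noncomputable def edge (e : E) : G.L2 →L[ℝ] Lp ℝ 2 (volume.restrict (Set.Ioo 0 (G.len e))) :=
  PiLp.proj 2 (fun e : E => Lp ℝ 2 (volume.restrict (Set.Ioo 0 (G.len e)))) e

lemma val_eq (y : G.L2) (e : E) (x : ℝ) : y.val (e, x) = edge e y x := rfl

lemma val_sum {ι : Type*} (s : Finset ι) (y : ι → G.L2) (e : E) :
    ∀ᵐ x ∂volume.restrict (Set.Ioo 0 (G.len e)),
      (∑ i ∈ s, y i).val (e, x) = ∑ i ∈ s, (y i).val (e, x) := by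
  simp only [val_eq, map_sum]
  exact coeFn_sum_Lp s fun i => edge e (y i)

omit [Fintype E] in
lemma ext_val {y z : G.L2} (h : ∀ e, ∀ᵐ x ∂volume.restrict (Set.Ioo 0 (G.len e)),
    y.val (e, x) = z.val (e, x)) : y = z := by
  refine PiLp.ext fun e => ?_
  exact Lp.ext (h e)

lemma inner_eq (y z : G.L2) : inner ℝ y z = ∑ e, ∫ x in Set.Ioo 0 (G.len e),
    y.val (e, x) * z.val (e, x) := by
  refine (PiLp.inner_apply _ _).trans (Finset.sum_congr rfl fun e _ => ?_)
  rw [MeasureTheory.L2.inner_def]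
  refine integral_congr_ae (ae_of_all _ fun x => ?_)
  simp only [RCLike.inner_apply, conj_trivial]
  exact mul_comm _ _

end L2

namespace Parametrization

variable (D : G.Parametrization Sig T)

/-- The space `L₂(0, ε_j)`. -/
abbrev CellL2 (j : Fin D.J) : Type := Lp ℝ 2 (volume.restrict (Set.Ioo 0 (D.ε j)))

/-- The `k`-th cell of the `j`-th family as a set of coordinates. -/
def cellSet (j : Fin D.J) (k : Fin (D.m j)) : Set ℝ :=
  Set.Ioo (D.cell j k).2.1 (D.cell j k).2.2

lemma cellSet_subset (j : Fin D.J) (k : Fin (D.m j)) :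
    D.cellSet j k ⊆ Set.Ioo 0 (G.len (D.cell j k).1) :=
  Set.Ioo_subset_Ioo (D.isCell j k).1 (D.isCell j k).2.2.1

lemma measurableSet_cellSet (j : Fin D.J) (k : Fin (D.m j)) : MeasurableSet (D.cellSet j k) :=
  measurableSet_Ioo

variable [Finite V]

lemma aff_preimage (j : Fin D.J) (k : Fin (D.m j)) :
    D.aff j k ⁻¹' D.cellSet j k = Set.Ioo 0 (D.ε j) := by
  ext r
  exact D.aff_mem_iff j k r

lemma measurePreserving_aff (j : Fin D.J) (k : Fin (D.m j)) :
    MeasurePreserving (D.aff j k) (volume.restrict (Set.Ioo 0 (D.ε j)))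
      ((volume.restrict (Set.Ioo 0 (G.len (D.cell j k).1))).restrict (D.cellSet j k)) := by
  rw [Measure.restrict_restrict (D.measurableSet_cellSet j k),
    Set.inter_eq_left.2 (D.cellSet_subset j k), ← D.aff_preimage j k]
  exact (measurePreserving_affine _ (D.sign_eq j k)).restrict_preimage
    (D.measurableSet_cellSet j k)

/-- The function `r ↦ y(x_k(r))`. -/
noncomputable def cellMap (j : Fin D.J) (k : Fin (D.m j)) : G.L2 →L[ℝ] D.CellL2 j :=
  (Lp.compMeasurePreservingₗᵢ ℝ (D.aff j k) (D.measurePreserving_aff j k)).toContinuousLinearMap ∘L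
    LpToLpRestrictCLM ℝ ℝ ℝ (volume.restrict (Set.Ioo 0 (G.len (D.cell j k).1))) 2
      (D.cellSet j k) ∘L
    PiLp.proj 2 (fun e : E => Lp ℝ 2 (volume.restrict (Set.Ioo 0 (G.len e)))) (D.cell j k).1

lemma ae_aff {j : Fin D.J} {k : Fin (D.m j)} {p : ℝ → Prop}
    (h : ∀ᵐ x ∂volume.restrict (Set.Ioo 0 (G.len (D.cell j k).1)), p x) :
    ∀ᵐ r ∂volume.restrict (Set.Ioo 0 (D.ε j)), p (D.aff j k r) :=
  (D.measurePreserving_aff j k).quasiMeasurePreserving.ae (ae_restrict_of_ae h)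

lemma coeFn_cellMap (j : Fin D.J) (k : Fin (D.m j)) (y : G.L2) :
    D.cellMap j k y =ᵐ[volume.restrict (Set.Ioo 0 (D.ε j))]
      fun r => y.val ((D.cell j k).1, D.aff j k r) := by
  refine (Lp.coeFn_compMeasurePreserving _ (D.measurePreserving_aff j k)).trans ?_
  exact (D.measurePreserving_aff j k).quasiMeasurePreserving.ae (LpToLpRestrictCLM_coeFn ℝ _ _)

lemma norm_cellMap_le (j : Fin D.J) (k : Fin (D.m j)) (y : G.L2) : ‖D.cellMap j k y‖ ≤ ‖y‖ := by
  refine (Lp.norm_compMeasurePreserving _ (D.measurePreserving_aff j k)).le.trans ?_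
  refine (norm_Lp_toLp_restrict_le _ _).trans ?_
  exact PiLp.norm_apply_le _ _

/-- The embedding of `L₂(0, ε_j)` as the functions on the `k`-th cell. -/
noncomputable def embed (j : Fin D.J) (k : Fin (D.m j)) : D.CellL2 j →L[ℝ] G.L2 :=
  ContinuousLinearMap.adjoint (D.cellMap j k)

lemma inner_embed (j : Fin D.J) (k : Fin (D.m j)) (g : D.CellL2 j) (y : G.L2) :
    inner ℝ (D.embed j k g) y = inner ℝ g (D.cellMap j k y) :=
  ContinuousLinearMap.adjoint_inner_left _ _ _

/-- The inverse of the affine parametrisation of a cell. -/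
noncomputable def affInv (j : Fin D.J) (k : Fin (D.m j)) (x : ℝ) : ℝ :=
  D.sign j k * (x - D.shift j k)

lemma affInv_aff (j : Fin D.J) (k : Fin (D.m j)) (r : ℝ) : D.affInv j k (D.aff j k r) = r := by
  unfold affInv aff
  linear_combination r * D.sign_mul_self j k

lemma aff_affInv (j : Fin D.J) (k : Fin (D.m j)) (x : ℝ) : D.aff j k (D.affInv j k x) = x := by
  unfold affInv aff
  linear_combination (x - D.shift j k) * D.sign_mul_self j k

lemma measurableEmbedding_aff (j : Fin D.J) (k : Fin (D.m j)) :
    MeasurableEmbedding (D.aff j k) :=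
  Continuous.measurableEmbedding (by unfold aff; fun_prop) (D.aff_injective j k)

open Classical in
/-- The function on the graph which is `g` on the `k`-th cell and zero elsewhere. -/
noncomputable def cellFun (j : Fin D.J) (k : Fin (D.m j)) (g : ℝ → ℝ) (e : E) (x : ℝ) : ℝ :=
  if (D.cell j k).1 = e ∧ x ∈ D.cellSet j k then g (D.affInv j k x) else 0

lemma cellFun_aff (j : Fin D.J) (k : Fin (D.m j)) (g : ℝ → ℝ) {r : ℝ}
    (hr : r ∈ Set.Ioo 0 (D.ε j)) : D.cellFun j k g (D.cell j k).1 (D.aff j k r) = g r := by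
  rw [cellFun, if_pos ⟨rfl, (D.aff_mem_iff j k r).2 hr⟩, affInv_aff]

lemma cellFun_of_notMem {j : Fin D.J} {k : Fin (D.m j)} {g : ℝ → ℝ} {e : E} {x : ℝ}
    (h : ∀ r ∈ Set.Ioo 0 (D.ε j), ¬ ((D.cell j k).1 = e ∧ D.aff j k r = x)) :
    D.cellFun j k g e x = 0 := by
  rw [cellFun, if_neg]
  rintro ⟨h1, h2⟩
  refine h (D.affInv j k x) ?_ ⟨h1, D.aff_affInv j k x⟩
  rw [← D.aff_mem_iff j k, aff_affInv]
  exact h2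

lemma memLp_cellFun (j : Fin D.J) (k : Fin (D.m j)) (g : D.CellL2 j) (e : E) :
    MemLp (D.cellFun j k g e) 2 (volume.restrict (Set.Ioo 0 (G.len e))) := by
  by_cases he : (D.cell j k).1 = e
  · subst he
    have h1 : D.cellFun j k g (D.cell j k).1 =
        (D.cellSet j k).indicator (fun x => g (D.affInv j k x)) := by
      ext x
      by_cases hx : x ∈ D.cellSet j k <;> simp [cellFun, hx]
    rw [h1, memLp_indicator_iff_restrict (D.measurableSet_cellSet j k),
      ← (D.measurePreserving_aff j k).map_eq,
      (D.measurableEmbedding_aff j k).memLp_map_measure_iff]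
    refine (Lp.memLp g).ae_eq (ae_of_all _ fun r => ?_)
    simp only [Function.comp, affInv_aff]
  · have : D.cellFun j k g e = 0 := by
      ext x
      simp [cellFun, he]
    rw [this]
    exact MemLp.zero

/-- The adjoint is identified by pairing with `y` and substituting `x = aff r`, which preserves the
measure. -/
lemma embed_val (j : Fin D.J) (k : Fin (D.m j)) (g : D.CellL2 j) (e : E) :
    ∀ᵐ x ∂volume.restrict (Set.Ioo 0 (G.len e)),
      (D.embed j k g).val (e, x) = D.cellFun j k g e x := by
  set w : G.L2 := WithLp.toLp 2 fun e => (D.memLp_cellFun j k g e).toLp with hw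
  have hval : ∀ e, ∀ᵐ x ∂volume.restrict (Set.Ioo 0 (G.len e)),
      w.val (e, x) = D.cellFun j k g e x := fun e =>
    MemLp.coeFn_toLp (D.memLp_cellFun j k g e)
  suffices h : D.embed j k g = w by rw [h]; exact hval e
  refine ext_inner_right ℝ fun y => ?_
  rw [inner_embed, L2.inner_eq, Finset.sum_eq_single (D.cell j k).1]
  · rw [MeasureTheory.L2.inner_def]
    have h1 : ∫ r in Set.Ioo 0 (D.ε j), inner ℝ (g r) (D.cellMap j k y r) =
        ∫ r in Set.Ioo 0 (D.ε j), g (D.affInv j k (D.aff j k r)) *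
          y.val ((D.cell j k).1, D.aff j k r) := by
      refine integral_congr_ae ?_
      filter_upwards [D.coeFn_cellMap j k y] with r hr
      rw [hr, affInv_aff]
      simp only [RCLike.inner_apply, conj_trivial]
      exact mul_comm _ _
    rw [h1, (D.measurePreserving_aff j k).integral_comp (D.measurableEmbedding_aff j k)
      (fun x => g (D.affInv j k x) * y.val ((D.cell j k).1, x)),
      ← integral_indicator (D.measurableSet_cellSet j k)]
    refine integral_congr_ae ?_
    filter_upwards [hval (D.cell j k).1] with x hx
    rw [hx]
    by_cases h : x ∈ D.cellSet j k <;> simp [cellFun, h]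
  · intro e _ he
    refine integral_eq_zero_of_ae ?_
    filter_upwards [hval e] with x hx
    simp [hx, cellFun, he.symm]
  · simp

lemma cellMap_embed (j : Fin D.J) (k : Fin (D.m j)) (g : D.CellL2 j) :
    D.cellMap j k (D.embed j k g) = g := by
  refine Lp.ext ?_
  filter_upwards [D.coeFn_cellMap j k (D.embed j k g), D.ae_aff (D.embed_val j k g _),
    ae_restrict_mem measurableSet_Ioo] with r h1 h2 hr
  rw [h1, h2, D.cellFun_aff j k g hr]

lemma cellMap_embed_of_ne {j : Fin D.J} {k l : Fin (D.m j)} (hkl : k ≠ l) (g : D.CellL2 j) :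
    D.cellMap j l (D.embed j k g) = 0 := by
  refine Lp.ext ?_
  filter_upwards [D.coeFn_cellMap j l (D.embed j k g), D.ae_aff (D.embed_val j k g _),
    ae_restrict_mem measurableSet_Ioo, Lp.coeFn_zero ℝ 2 (volume.restrict (Set.Ioo 0 (D.ε j)))]
    with r h1 h2 hr h3
  rw [h1, h2, h3, Pi.zero_apply]
  refine D.cellFun_of_notMem fun r' hr' h => hkl ?_
  have := (D.aff_cell_injective hr' hr h.1 h.2).1
  simpa using this

lemma norm_embed_le (j : Fin D.J) (k : Fin (D.m j)) (g : D.CellL2 j) :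
    ‖D.embed j k g‖ ≤ ‖g‖ := by
  have h1 : ‖D.embed j k g‖ * ‖D.embed j k g‖ = inner ℝ g g := by
    rw [← real_inner_self_eq_norm_mul_norm, inner_embed, cellMap_embed]
  rw [real_inner_self_eq_norm_mul_norm] at h1
  nlinarith [norm_nonneg (D.embed j k g), norm_nonneg g]

end Parametrization

end MetricGraph

/-! ### Reachable sets, and the projectors onto them after parametrisation. -/

namespace MetricGraph

variable {V E : Type*} [Fintype E] {G : MetricGraph V E} {Sig : Set V} {T : ℝ}

/-- The control is delayed by `δ = s' - s`: what `φ` produces at time `s`, the delayed control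
produces at time `s'`. -/
lemma reachable_mono {γ : V} {s s' : ℝ} (hss : s ≤ s') :
    G.reachable T γ s ⊆ G.reachable T γ s' := by
  rintro y ⟨φ, hφ, hy⟩
  set δ := s' - s with hδ
  have hδ0 : 0 ≤ δ := sub_nonneg.2 hss
  refine ⟨(Set.Ici δ).indicator fun τ => φ (-δ + 1 * τ), ?_, fun e => ?_⟩
  · rw [memLp_indicator_iff_restrict measurableSet_Ici,
      Measure.restrict_restrict measurableSet_Ici]
    have hmp := (measurePreserving_affine (-δ) (Or.inl rfl)).restrict_preimage
      (measurableSet_Icc (a := (0 : ℝ)) (b := T))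
    refine (hφ.comp_measurePreserving hmp).mono_measure (Measure.restrict_mono ?_ le_rfl)
    rintro τ ⟨h1, h2⟩
    have h1' : δ ≤ τ := h1
    constructor <;> linarith [h2.2]
  · filter_upwards [hy e] with x hx
    rw [hx, wave, wave, finsum_mem_def, finsum_mem_def]
    refine finsum_congr fun t => ?_
    by_cases h1 : t ∈ Set.Icc 0 s
    · have h2 : t ∈ Set.Icc 0 s' := ⟨h1.1, h1.2.trans hss⟩
      rw [Set.indicator_of_mem h1, Set.indicator_of_mem h2, Set.indicator_of_mem]
      · congr 2
        rw [hδ]; ring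
      · simp only [Set.mem_Ici]
        linarith [h1.2]
    · rw [Set.indicator_of_notMem h1]
      by_cases h2 : t ∈ Set.Icc 0 s'
      · rw [Set.indicator_of_mem h2, Set.indicator_of_notMem, mul_zero]
        simp only [Set.mem_Ici]
        intro h3
        exact h1 ⟨h2.1, by linarith⟩
      · rw [Set.indicator_of_notMem h2]

lemma proj_zero (T : ℝ) (γ : V) : G.proj T γ 0 = 0 := by
  have h : G.reachable T γ 0 ⊆ {0} := by
    rintro y ⟨φ, -, hy⟩
    refine L2.ext_val fun e => ?_
    have h0 : ∀ᵐ x ∂volume.restrict (Set.Ioo 0 (G.len e)), (0 : G.L2).val (e, x) = 0 := by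
      filter_upwards [Lp.coeFn_zero ℝ 2 (volume.restrict (Set.Ioo 0 (G.len e)))] with x hx
      rw [L2.val_eq, map_zero, hx, Pi.zero_apply]
    filter_upwards [hy e, h0, ae_restrict_mem measurableSet_Ioo] with x hx h0 hmem
    rw [hx, h0, wave]
    refine finsum_mem_eq_zero_of_forall_eq_zero fun t ht => ?_
    obtain rfl : t = 0 := le_antisymm ht.2 ht.1
    have : G.amp γ (e, x) 0 = 0 := by
      refine Finset.sum_eq_zero fun b _ => ?_
      by_contra hne
      exact lt_irrefl _ (G.time_pos_of_run_ne_zero hmem.1 hmem.2 hne)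
    rw [this, zero_mul]
  have h2 : (Submodule.span ℝ (G.reachable T γ 0)).topologicalClosure = ⊥ := by
    rw [Submodule.span_eq_bot.2 fun y hy => h hy]
    exact IsClosed.submodule_topologicalClosure_eq (by simp)
  unfold proj
  ext1 y
  have hm := Submodule.starProjection_apply_mem
    (Submodule.span ℝ (G.reachable T γ 0)).topologicalClosure y
  have : ∀ z ∈ (Submodule.span ℝ (G.reachable T γ 0)).topologicalClosure, z = 0 := by
    rw [h2]
    simp
  simpa using this _ hm

lemma projectionChain_proj (T : ℝ) (γ : V) :
    ProjectionChain fun s : Set.Ici (0 : ℝ) => G.proj T γ s := by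
  have hle : ∀ {s s' : Set.Ici (0 : ℝ)}, s ≤ s' →
      (Submodule.span ℝ (G.reachable T γ s)).topologicalClosure ≤
      (Submodule.span ℝ (G.reachable T γ s')).topologicalClosure := fun {s s'} h =>
    Submodule.topologicalClosure_mono (Submodule.span_mono (reachable_mono h))
  refine ⟨fun {s s'} h => ?_, fun {s s'} h => ?_, fun s x y => ?_⟩
  · exact Submodule.starProjection_comp_starProjection_of_le (hle h)
  · ext1 y
    exact Submodule.starProjection_eq_self_iff.2 (hle h (Submodule.starProjection_apply_mem _ _))
  · exact Submodule.inner_starProjection_left_eq_right _ _ _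

namespace Parametrization

variable (D : G.Parametrization Sig T) [Finite V]

/-- Only the times `timeFun j i r` carry an amplitude at this point, so the sum defining the wave
runs over `i`; the indicator records arrival by time `s`. -/
lemma wave_aff {γ : V} (hγ : γ ∈ Sig) {s : ℝ} (hs : s ≤ T) (φ : ℝ → ℝ) {j : Fin D.J}
    (k : Fin (D.m j)) {r : ℝ} (hr : r ∈ Set.Ioo 0 (D.ε j)) :
    G.wave γ φ s ((D.cell j k).1, D.aff j k r) = ∑ i, (if D.timeFun j i r ≤ s then (1 : ℝ) else 0) *
      (D.α γ j i k * φ (s - D.timeFun j i r)) := by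
  classical
  rw [wave, finsum_mem_def, finsum_eq_sum_of_support_subset
    (s := Finset.univ.image fun i => D.timeFun j i r)]
  · rw [Finset.sum_image fun i _ i' _ h => D.timeFun_index_injective hr h]
    refine Finset.sum_congr rfl fun i _ => ?_
    have h0 := (IsTime.bounds D hr (D.isTime_timeFun j i hr)).1.le
    rw [Set.indicator_apply, D.amp_eq_α hγ k i hr]
    by_cases h : D.timeFun j i r ≤ s
    · rw [if_pos ⟨h0, h⟩, if_pos h, one_mul]
    · rw [if_neg fun h' => h h'.2, if_neg h, zero_mul]
  · intro t ht
    have h1 : t ∈ Set.Icc 0 s := Set.mem_of_indicator_ne_zero ht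
    have h2 : G.amp γ ((D.cell j k).1, D.aff j k r) t ≠ 0 := by
      rw [Function.mem_support, Set.indicator_of_mem h1] at ht
      exact left_ne_zero_of_mul ht
    obtain ⟨i, rfl⟩ := D.exists_timeFun_of_amp_ne_zero hγ hr (h1.2.trans hs) h2
    simp

lemma cellFun_congr {j : Fin D.J} (k : Fin (D.m j)) {g g' : ℝ → ℝ}
    (h : g =ᵐ[volume.restrict (Set.Ioo 0 (D.ε j))] g') (e : E) :
    D.cellFun j k g e =ᵐ[volume.restrict (Set.Ioo 0 (G.len e))] D.cellFun j k g' e := by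
  by_cases he : (D.cell j k).1 = e
  · subst he
    have h1 : ∀ᵐ x ∂(volume.restrict (Set.Ioo 0 (G.len (D.cell j k).1))).restrict (D.cellSet j k),
        g (D.affInv j k x) = g' (D.affInv j k x) := by
      rw [← (D.measurePreserving_aff j k).map_eq, (D.measurableEmbedding_aff j k).ae_map_iff]
      simp only [affInv_aff]
      exact h
    rw [ae_restrict_iff' (D.measurableSet_cellSet j k)] at h1
    filter_upwards [h1] with x hx
    by_cases hxc : x ∈ D.cellSet j k
    · simp [cellFun, hxc, hx hxc]
    · simp [cellFun, hxc]
  · exact ae_of_all _ fun x => by simp [cellFun, he]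

/-- A control that acts through the `i`-th time cell alone. Disjointness of the time cells keeps it
from exciting anything else, and the cut-off arises because the wave only contains what has been
sent by time `s`. -/
lemma sum_embed_mem_reachable {γ : V} (hγ : γ ∈ Sig) {s : ℝ} (hs : s ≤ T)
    {j : Fin D.J} (i : Fin (D.n j)) (h : D.CellL2 j) :
    ∑ l, D.α γ j i l • D.embed j l (mulLp (fun r => if D.timeFun j i r ≤ s then 1 else 0) h) ∈
      G.reachable T γ s := by
  set σ := D.timeSign j i with hσ
  have hsq : σ * σ = 1 := by rcases D.timeSign_eq j i with h | h <;> rw [hσ, h] <;> norm_num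
  set c := D.ε j / 2 + σ * (s - D.time j i) with hc
  -- `R (s - t)` is the parameter at which the `i`-th time equals `t`. So `φ = h ∘ R`, with `h`
  -- extended by zero, takes the value `h r` at `s - timeFun j i r` and vanishes at the delays
  -- belonging to other times.
  set R : ℝ → ℝ := fun τ => c + (-σ) * τ with hR
  have hmp : MeasurePreserving R volume volume := by
    refine measurePreserving_affine _ ?_
    rcases D.timeSign_eq j i with h | h <;> rw [hσ, h] <;> simp
  have hRf : ∀ t, D.timeFun j i (R (s - t)) = t := by
    intro t
    simp only [timeFun, ← hσ, hR, hc]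
    linear_combination (t - D.time j i) * hsq
  set φ : ℝ → ℝ := fun τ => (Set.Ioo 0 (D.ε j)).indicator h (R τ) with hφ
  have hfm : Measurable fun r => D.timeFun j i r := (D.continuous_timeFun j i).measurable
  have hbm := BoundedMeasurable.ite_le hfm s
  have key : ∀ e, ∀ x ∈ Set.Ioo 0 (G.len e), G.wave γ φ s (e, x) = ∑ l, D.α γ j i l *
      D.cellFun j l (fun r => (if D.timeFun j i r ≤ s then 1 else 0) * h r) e x := by
    intro e x hx
    by_cases hex : ∃ l, ∃ r ∈ Set.Ioo 0 (D.ε j), (D.cell j l).1 = e ∧ D.aff j l r = x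
    · obtain ⟨l, r, hr, rfl, rfl⟩ := hex
      have hφr : ∀ i', φ (s - D.timeFun j i' r) = if i' = i then h r else 0 := by
        intro i'
        split_ifs with hii
        · subst hii
          have : R (s - D.timeFun j i' r) = r := D.timeFun_injective j i' (hRf _)
          simp only [hφ, this, Set.indicator_of_mem hr]
        · refine Set.indicator_of_notMem (fun hmem => hii ?_) _
          have := (D.timeFun_inj hmem hr (hRf (D.timeFun j i' r))).1
          simpa using this.symm
      rw [D.wave_aff hγ hs φ l hr, Finset.sum_eq_single i, Finset.sum_eq_single l, hφr i, if_pos rfl,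
        D.cellFun_aff j l _ hr]
      · ring
      · intro l' _ hl'
        rw [D.cellFun_of_notMem, mul_zero]
        intro r' hr' hcon
        have := (D.aff_cell_injective hr' hr hcon.1 hcon.2).1
        exact hl' (by simpa using this)
      · simp
      · intro i' _ hi'
        rw [hφr i', if_neg hi', mul_zero, mul_zero]
      · simp
    -- Away from the family: where `φ (s - t) ≠ 0`, `t` is a time of the family, and then all
    -- impulses are over its cells.
    · push Not at hex
      rw [Finset.sum_eq_zero, wave]
      · refine finsum_mem_eq_zero_of_forall_eq_zero fun t ht => ?_
        by_contra hne
        have h1 : G.amp γ (e, x) t ≠ 0 := left_ne_zero_of_mul hne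
        have h2 : φ (s - t) ≠ 0 := right_ne_zero_of_mul hne
        have h3 : R (s - t) ∈ Set.Ioo 0 (D.ε j) := Set.mem_of_indicator_ne_zero h2
        rw [← hRf t] at h1
        obtain ⟨k, hk1, hk2⟩ := D.exists_aff_of_amp_ne_zero hγ h3 hx.1 hx.2 h1
        exact hex k _ h3 hk1 hk2
      · intro l _
        rw [D.cellFun_of_notMem, mul_zero]
        intro r hr hcon
        exact hex l r hr hcon.1 hcon.2
  refine ⟨φ, ?_, fun e => ?_⟩
  · have h1 : MemLp ((Set.Ioo 0 (D.ε j)).indicator h) 2 volume :=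
      (memLp_indicator_iff_restrict measurableSet_Ioo).2 (Lp.memLp h)
    exact (h1.comp_measurePreserving hmp).restrict _
  · have h1 : ∀ᵐ x ∂volume.restrict (Set.Ioo 0 (G.len e)), ∀ l, (D.α γ j i l • D.embed j l
        (mulLp (fun r => if D.timeFun j i r ≤ s then 1 else 0) h)).val (e, x) = D.α γ j i l *
        D.cellFun j l (fun r => (if D.timeFun j i r ≤ s then 1 else 0) * h r) e x := by
      rw [ae_all_iff]
      intro l
      filter_upwards [D.embed_val j l (mulLp (fun r => if D.timeFun j i r ≤ s then 1 else 0) h) e,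
        D.cellFun_congr l (coeFn_mulLp hbm h) e,
        Lp.coeFn_smul (D.α γ j i l) (L2.edge e (D.embed j l
          (mulLp (fun r => if D.timeFun j i r ≤ s then 1 else 0) h)))] with x h1 h2 h3
      rw [L2.val_eq, map_smul, h3, Pi.smul_apply, ← L2.val_eq, h1, h2, smul_eq_mul]
    filter_upwards [L2.val_sum Finset.univ (fun l => D.α γ j i l • D.embed j l
        (mulLp (fun r => if D.timeFun j i r ≤ s then 1 else 0) h)) e, h1,
        ae_restrict_mem measurableSet_Ioo] with x h1 h2 hx
    rw [h1, key e x hx]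
    exact Finset.sum_congr rfl fun l _ => h2 l

/-! ### The Gram-Schmidt projectors -/

omit [Finite V] in
lemma P_apply (γ : V) (j : Fin D.J) (i : Fin (D.n j)) (k l : Fin (D.m j)) :
    D.P γ j i k l = D.β γ j i k * D.β γ j i l := rfl

omit [Finite V] in
lemma inner_β (γ : V) (j : Fin D.J) (i i' : Fin (D.n j)) :
    inner ℝ (D.β γ j i) (D.β γ j i') = if i = i' ∧ D.β γ j i ≠ 0 then 1 else 0 := by
  split_ifs with h
  · obtain ⟨rfl, h⟩ := h
    rw [real_inner_self_eq_norm_sq]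
    have : ‖D.β γ j i‖ = 1 := InnerProductSpace.gramSchmidtNormed_unit_length' h
    rw [this, one_pow]
  · by_cases hz : D.β γ j i = 0
    · rw [hz, inner_zero_left]
    · have hne : i ≠ i' := fun h' => h ⟨h', hz⟩
      simp [β, InnerProductSpace.gramSchmidtNormed, inner_smul_left, inner_smul_right,
        InnerProductSpace.gramSchmidt_orthogonal ℝ (D.α γ j) hne]

omit [Finite V] in
lemma inner_eq_sum (j : Fin D.J) (v w : EuclideanSpace ℝ (Fin (D.m j))) :
    inner ℝ v w = ∑ l, v l * w l := by
  rw [PiLp.inner_apply]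
  refine Finset.sum_congr rfl fun l _ => ?_
  simp only [RCLike.inner_apply, conj_trivial]
  ring

omit [Finite V] in
lemma P_mul_P (γ : V) (j : Fin D.J) (i i' : Fin (D.n j)) :
    D.P γ j i * D.P γ j i' = if i = i' then D.P γ j i else 0 := by
  have h : D.P γ j i * D.P γ j i' = Matrix.of fun k l =>
      inner ℝ (D.β γ j i) (D.β γ j i') * (D.β γ j i k * D.β γ j i' l) := by
    ext k l
    rw [Matrix.mul_apply, Matrix.of_apply, inner_eq_sum, Finset.sum_mul]
    refine Finset.sum_congr rfl fun x _ => ?_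
    rw [P_apply, P_apply]
    ring
  rw [h, inner_β]
  by_cases hii : i = i'
  · subst hii
    by_cases hz : D.β γ j i = 0
    · ext k l
      simp [P_apply, hz]
    · ext k l
      simp [P_apply, hz]
  · ext k l
    simp [hii]

omit [Finite V] in
lemma P_transpose (γ : V) (j : Fin D.J) (i : Fin (D.n j)) : (D.P γ j i).transpose = D.P γ j i := by
  ext k l
  simp only [Matrix.transpose_apply, P_apply]
  ring

omit [Finite V] in
lemma span_β (γ : V) (j : Fin D.J) (i : Fin (D.n j)) :
    Submodule.span ℝ (D.β γ j '' Set.Iic i) = Submodule.span ℝ (D.α γ j '' Set.Iic i) :=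
  (InnerProductSpace.span_gramSchmidtNormed _ _).trans (InnerProductSpace.span_gramSchmidt_Iic _ _ _)

/-- The matrix function by which the projector onto the waves reachable at time `s` acts. -/
noncomputable def projSymbol (γ : V) (s : ℝ) (j : Fin D.J) (r : ℝ) :
    Matrix (Fin (D.m j)) (Fin (D.m j)) ℝ :=
  ∑ i, (if D.timeFun j i r ≤ s then (1 : ℝ) else 0) • D.P γ j i

lemma projSymbol_apply (γ : V) (s : ℝ) (j : Fin D.J) (r : ℝ) (k l : Fin (D.m j)) :
    D.projSymbol γ s j r k l =
      ∑ i, (if D.timeFun j i r ≤ s then (1 : ℝ) else 0) * (D.β γ j i k * D.β γ j i l) := by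
  simp only [projSymbol, Matrix.sum_apply, Matrix.smul_apply, P_apply, smul_eq_mul]

lemma projSymbol_symm (γ : V) (s : ℝ) (j : Fin D.J) (r : ℝ) (k l : Fin (D.m j)) :
    D.projSymbol γ s j r k l = D.projSymbol γ s j r l k := by
  simp only [projSymbol_apply]
  refine Finset.sum_congr rfl fun i _ => ?_
  ring

lemma boundedMeasurable_projSymbol (γ : V) (s : ℝ) (j : Fin D.J) (k l : Fin (D.m j)) :
    BoundedMeasurable fun r => D.projSymbol γ s j r k l := by
  simp only [projSymbol_apply]
  exact BoundedMeasurable.sum _ fun i _ =>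
    (BoundedMeasurable.ite_le (D.continuous_timeFun j i).measurable s).mul
      (BoundedMeasurable.const _)

/-- The projector of the waves fixes the amplitude vectors that have arrived. -/
lemma projSymbol_mul_α (γ : V) {s : ℝ} {j : Fin D.J} {r : ℝ} (hr : r ∈ Set.Ioo 0 (D.ε j))
    {i : Fin (D.n j)} (hi : D.timeFun j i r ≤ s) (k : Fin (D.m j)) :
    ∑ l, D.projSymbol γ s j r k l * D.α γ j i l = D.α γ j i k := by
  have hmem : D.α γ j i ∈ Submodule.span ℝ (D.β γ j '' Set.Iic i) := by
    rw [span_β]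
    exact Submodule.subset_span ⟨i, Set.mem_Iic.2 le_rfl, rfl⟩
  -- Generalised to the span of the `β` with index at most `i`: their times are no later than the
  -- `i`-th one, so all these projectors are already switched on at `s`.
  suffices h : ∀ v ∈ Submodule.span ℝ (D.β γ j '' Set.Iic i), ∀ k,
      ∑ l, D.projSymbol γ s j r k l * v l = v k from h _ hmem k
  intro v hv
  induction hv using Submodule.span_induction with
  | mem v hv =>
    obtain ⟨i', hi', rfl⟩ := hv
    have hi's : D.timeFun j i' r ≤ s := ((D.timeFun_strictMono hr).monotone hi').trans hi
    intro k
    simp_rw [projSymbol_apply, Finset.sum_mul]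
    rw [Finset.sum_comm]
    have h1 : ∀ a, ∑ l, (if D.timeFun j a r ≤ s then (1 : ℝ) else 0) *
        (D.β γ j a k * D.β γ j a l) * D.β γ j i' l =
        (if D.timeFun j a r ≤ s then (1 : ℝ) else 0) * D.β γ j a k *
          inner ℝ (D.β γ j a) (D.β γ j i') := by
      intro a
      rw [inner_eq_sum, Finset.mul_sum]
      exact Finset.sum_congr rfl fun l _ => by ring
    simp_rw [h1, inner_β]
    rw [Finset.sum_eq_single i']
    · rw [if_pos hi's]
      by_cases hz : D.β γ j i' = 0
      · simp [hz]
      · simp [hz]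
    · intro a _ ha
      simp [ha]
    · simp
  | zero => simp
  | add v w _ _ hv hw =>
    intro k
    have := hv k
    have := hw k
    simp only [PiLp.add_apply, mul_add, Finset.sum_add_distrib]
    linarith
  | smul c v _ hv =>
    intro k
    simp only [PiLp.smul_apply, smul_eq_mul]
    rw [← hv k, Finset.mul_sum]
    exact Finset.sum_congr rfl fun l _ => by ring

/-- The vector `β` of index `i` combines vectors `α` of indices `i' ≤ i`. These arrive no later, so
a function cut off to `timeFun j i r ≤ s` is unchanged by the cut-off for `i'`. -/
lemma sum_embed_β_mem {γ : V} (hγ : γ ∈ Sig) {s : ℝ} (hs : s ≤ T)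
    {j : Fin D.J} (i : Fin (D.n j)) (h : D.CellL2 j) :
    ∑ l, D.β γ j i l • D.embed j l (mulLp (fun r => if D.timeFun j i r ≤ s then 1 else 0) h) ∈
      Submodule.span ℝ (G.reachable T γ s) := by
  have hmem : D.β γ j i ∈ Submodule.span ℝ (D.α γ j '' Set.Iic i) := by
    rw [← span_β]
    exact Submodule.subset_span ⟨i, Set.mem_Iic.2 le_rfl, rfl⟩
  set g := mulLp (fun r => if D.timeFun j i r ≤ s then 1 else 0) h with hg
  generalize D.β γ j i = v at hmem
  induction hmem using Submodule.span_induction with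
  | mem v hv =>
    obtain ⟨i', hi', rfl⟩ := hv
    have hgg : mulLp (fun r => if D.timeFun j i' r ≤ s then 1 else 0) g = g := by
      refine Lp.ext ?_
      filter_upwards [coeFn_mulLp (BoundedMeasurable.ite_le
        (D.continuous_timeFun j i').measurable s) g, coeFn_mulLp (BoundedMeasurable.ite_le
        (D.continuous_timeFun j i).measurable s) h, ae_restrict_mem measurableSet_Ioo]
        with r h1 h2 hr
      rw [h1, hg, h2]
      by_cases hle : D.timeFun j i r ≤ s
      · have : D.timeFun j i' r ≤ s := ((D.timeFun_strictMono hr).monotone hi').trans hle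
        simp [hle, this]
      · simp [hle]
    have := D.sum_embed_mem_reachable hγ hs i' g
    rw [hgg] at this
    exact Submodule.subset_span this
  | zero => simp
  | add v w _ _ hv hw =>
    simp only [PiLp.add_apply, add_smul, Finset.sum_add_distrib]
    exact add_mem hv hw
  | smul c v _ hv =>
    simp only [PiLp.smul_apply, smul_eq_mul, mul_smul, ← Finset.smul_sum]
    exact Submodule.smul_mem _ _ hv

/-- `A` acts on the functions of the parameter as multiplication by `Q`. -/
def HasSymbol (A : G.L2 →L[ℝ] G.L2)
    (Q : (j : Fin D.J) → ℝ → Matrix (Fin (D.m j)) (Fin (D.m j)) ℝ) : Prop :=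
  ∀ y j k, ∀ᵐ r ∂volume.restrict (Set.Ioo 0 (D.ε j)),
    D.cellMap j k (A y) r = ∑ l, Q j r k l * D.cellMap j l y r

/-- At each `r` a reachable wave is a combination of the amplitude vectors that have arrived, and
`projSymbol` fixes those. -/
lemma cellMap_eq_of_mem_reachable {γ : V} (hγ : γ ∈ Sig) {s : ℝ} (hs : s ≤ T) {w : G.L2}
    (hw : w ∈ G.reachable T γ s) (j : Fin D.J) (k : Fin (D.m j)) :
    D.cellMap j k w = ∑ l, mulLp (fun r => D.projSymbol γ s j r k l) (D.cellMap j l w) := by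
  obtain ⟨φ, -, hw⟩ := hw
  have h1 : ∀ l, ∀ᵐ r ∂volume.restrict (Set.Ioo 0 (D.ε j)), D.cellMap j l w r =
      ∑ i, (if D.timeFun j i r ≤ s then (1 : ℝ) else 0) *
      (D.α γ j i l * φ (s - D.timeFun j i r)) := by
    intro l
    filter_upwards [D.coeFn_cellMap j l w, D.ae_aff (hw (D.cell j l).1),
      ae_restrict_mem measurableSet_Ioo] with r h1 h2 hr
    rw [h1, h2, D.wave_aff hγ hs φ l hr]
  refine Lp.ext ?_
  filter_upwards [ae_all_iff.2 h1, coeFn_sum_Lp Finset.univ fun l =>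
    mulLp (fun r => D.projSymbol γ s j r k l) (D.cellMap j l w),
    ae_all_iff.2 fun l => coeFn_mulLp (D.boundedMeasurable_projSymbol γ s j k l) (D.cellMap j l w),
    ae_restrict_mem measurableSet_Ioo] with r h1 h2 h3 hr
  rw [h2]
  simp_rw [h3, h1, Finset.mul_sum]
  rw [Finset.sum_comm]
  refine Finset.sum_congr rfl fun i _ => ?_
  by_cases hi : D.timeFun j i r ≤ s
  · simp only [if_pos hi, one_mul]
    rw [← D.projSymbol_mul_α γ hr hi k, Finset.sum_mul]
    exact Finset.sum_congr rfl fun l _ => by ring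
  · simp [hi]

/-- The orthogonal projection is recognised by two properties: the candidate lies in the subspace,
and the remainder is orthogonal to every wave, because `projSymbol` is symmetric and fixes waves. -/
lemma proj_embed {γ : V} (hγ : γ ∈ Sig) {s : ℝ} (hs : s ≤ T) {j : Fin D.J} (k : Fin (D.m j))
    (g : D.CellL2 j) : G.proj T γ s (D.embed j k g) =
      ∑ l, D.embed j l (mulLp (fun r => D.projSymbol γ s j r l k) g) := by
  refine Submodule.eq_starProjection_of_mem_orthogonal ?_ ?_
  · refine Submodule.le_topologicalClosure _ ?_
    have h1 : ∑ l, D.embed j l (mulLp (fun r => D.projSymbol γ s j r l k) g) =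
        ∑ i, ∑ l, D.β γ j i l • D.embed j l
          (mulLp (fun r => if D.timeFun j i r ≤ s then 1 else 0) (D.β γ j i k • g)) := by
      rw [Finset.sum_comm]
      refine Finset.sum_congr rfl fun l _ => ?_
      simp_rw [← map_smul, ← map_sum]
      congr 1
      refine Lp.ext ?_
      filter_upwards [coeFn_mulLp (D.boundedMeasurable_projSymbol γ s j l k) g,
        coeFn_sum_Lp Finset.univ fun i => D.β γ j i l •
          mulLp (fun r => if D.timeFun j i r ≤ s then 1 else 0) (D.β γ j i k • g),
        ae_all_iff.2 fun i => Lp.coeFn_smul (D.β γ j i l)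
          (mulLp (fun r => if D.timeFun j i r ≤ s then 1 else 0) (D.β γ j i k • g)),
        ae_all_iff.2 fun i => coeFn_mulLp (BoundedMeasurable.ite_le
          (D.continuous_timeFun j i).measurable s) (D.β γ j i k • g),
        ae_all_iff.2 fun i => Lp.coeFn_smul (D.β γ j i k) g] with r h1 h2 h3 h4 h5
      rw [h1, h2, projSymbol_apply, Finset.sum_mul]
      refine Finset.sum_congr rfl fun i _ => ?_
      rw [h3, Pi.smul_apply, h4, h5, Pi.smul_apply, smul_eq_mul, smul_eq_mul]
      ring
    rw [h1]
    exact sum_mem fun i _ => D.sum_embed_β_mem hγ hs i _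
  · rw [Submodule.orthogonal_closure]
    refine (Submodule.mem_orthogonal' _ _).2 fun w hw => ?_
    induction hw using Submodule.span_induction with
    | mem w hw =>
      rw [inner_sub_left, sum_inner, inner_embed]
      simp_rw [inner_embed]
      rw [D.cellMap_eq_of_mem_reachable hγ hs hw j k, inner_sum, sub_eq_zero]
      refine Finset.sum_congr rfl fun l _ => ?_
      rw [inner_mulLp (D.boundedMeasurable_projSymbol γ s j l k)]
      simp_rw [D.projSymbol_symm γ s j _ k l]
    | zero => simp
    | add v w _ _ hv hw => rw [inner_add_right, hv, hw, add_zero]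
    | smul c v _ hv => rw [inner_smul_right, hv, mul_zero]

/-- The projectors onto the reachable sets, after parametrisation. -/
theorem hasSymbol_proj {γ : V} (hγ : γ ∈ Sig) {s : ℝ} (hs : s ≤ T) :
    D.HasSymbol (G.proj T γ s) (D.projSymbol γ s) := by
  intro y j k
  have h : D.cellMap j k (G.proj T γ s y) =
      ∑ l, mulLp (fun r => D.projSymbol γ s j r k l) (D.cellMap j l y) := by
    -- `embed` is adjoint to `cellMap` and the projection is self-adjoint, so the formula for
    -- functions on one cell gives the formula for every `y`, including `y` that do not vanish off
    -- the cells.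
    refine ext_inner_left ℝ fun g => ?_
    rw [← inner_embed, proj, ← Submodule.inner_starProjection_left_eq_right, ← proj,
      D.proj_embed hγ hs, sum_inner, inner_sum]
    refine Finset.sum_congr rfl fun l _ => ?_
    rw [inner_embed, inner_mulLp (D.boundedMeasurable_projSymbol γ s j l k)]
    simp_rw [D.projSymbol_symm γ s j _ k l]
  rw [h]
  filter_upwards [coeFn_sum_Lp Finset.univ fun l =>
    mulLp (fun r => D.projSymbol γ s j r k l) (D.cellMap j l y),
    ae_all_iff.2 fun l => coeFn_mulLp (D.boundedMeasurable_projSymbol γ s j k l) (D.cellMap j l y)]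
    with r h1 h2
  rw [h1]
  exact Finset.sum_congr rfl fun l _ => h2 l

end Parametrization

end MetricGraph

/-! ### The symbol of a shifted eikonal and its functional calculus. -/

/-- Stieltjes sums against a unit step at `t`. -/
lemma tendsto_step_sum {t T : ℝ} (ht : 0 < t) (htT : t ≤ T) :
    Tendsto (fun N : ℕ => ∑ k ∈ Finset.range N, (((k : ℝ) + 1) * T / N + 1) *
      ((if t ≤ ((k : ℝ) + 1) * T / N then (1 : ℝ) else 0) -
        if t ≤ (k : ℝ) * T / N then (1 : ℝ) else 0)) atTop (𝓝 (t + 1)) := by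
  have hT : 0 < T := ht.trans_le htT
  have hlim : Tendsto (fun N : ℕ => T / (N : ℝ)) atTop (𝓝 0) :=
    tendsto_const_div_atTop_nhds_zero_nat T
  rw [← tendsto_sub_nhds_zero_iff]
  refine squeeze_zero_norm' ?_ hlim
  filter_upwards [eventually_gt_atTop 0] with N hN
  have hN' : (0 : ℝ) < N := by exact_mod_cast hN
  set χ : ℕ → ℝ := fun k => if t ≤ (k : ℝ) * T / N then (1 : ℝ) else 0 with hχ
  have hχN : χ N - χ 0 = 1 := by
    have h1 : (N : ℝ) * T / N = T := by field_simp
    simp only [hχ, h1, if_pos htT]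
    simp [not_le.2 ht]
  have htel := Finset.sum_range_sub χ N
  rw [hχN] at htel
  have hmono : ∀ k, χ k ≤ χ (k + 1) := by
    intro k
    simp only [hχ]
    by_cases h : t ≤ (k : ℝ) * T / N
    · rw [if_pos h, if_pos (h.trans (by push_cast; gcongr; linarith))]
    · rw [if_neg h]
      split_ifs <;> simp
  have hrew : (∑ k ∈ Finset.range N, (((k : ℝ) + 1) * T / N + 1) *
      ((if t ≤ ((k : ℝ) + 1) * T / N then (1 : ℝ) else 0) -
        if t ≤ (k : ℝ) * T / N then (1 : ℝ) else 0)) - (t + 1) =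
      ∑ k ∈ Finset.range N, (((k : ℝ) + 1) * T / N - t) * (χ (k + 1) - χ k) := by
    have : t + 1 = ∑ k ∈ Finset.range N, (t + 1) * (χ (k + 1) - χ k) := by
      rw [← Finset.mul_sum, htel, mul_one]
    rw [this, ← Finset.sum_sub_distrib]
    refine Finset.sum_congr rfl fun k _ => ?_
    simp only [hχ]
    push_cast
    ring
  rw [hrew]
  -- The increments of `χ` are nonnegative with sum `1`, and nonzero only for the step containing
  -- `t`, where the weight differs from `t` by at most `T / N`.
  calc _ ≤ ∑ k ∈ Finset.range N, ‖(((k : ℝ) + 1) * T / N - t) * (χ (k + 1) - χ k)‖ :=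
        norm_sum_le _ _
    _ ≤ ∑ k ∈ Finset.range N, T / N * (χ (k + 1) - χ k) := by
        refine Finset.sum_le_sum fun k _ => ?_
        rw [norm_mul, Real.norm_of_nonneg (sub_nonneg.2 (hmono k))]
        by_cases h : χ (k + 1) - χ k = 0
        · rw [h]; simp
        · refine mul_le_mul_of_nonneg_right ?_ (sub_nonneg.2 (hmono k))
          have h1 : ¬ t ≤ (k : ℝ) * T / N := by
            intro h1
            have h2 : t ≤ ((k : ℝ) + 1) * T / N := h1.trans (by gcongr; linarith)
            apply h
            simp only [hχ]
            push_cast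
            rw [if_pos h1, if_pos h2, sub_self]
          have h2 : t ≤ ((k : ℝ) + 1) * T / N := by
            by_contra h2
            apply h
            simp only [hχ]
            push_cast
            rw [if_neg h1, if_neg h2, sub_self]
          have h3 : ((k : ℝ) + 1) * T / N = (k : ℝ) * T / N + T / N := by ring
          rw [Real.norm_of_nonneg (by linarith)]
          linarith
    _ = T / N := by rw [← Finset.mul_sum, htel, mul_one]

namespace MetricGraph

variable {V E : Type*} [Fintype E] {G : MetricGraph V E} {Sig : Set V} {T : ℝ}

lemma tendsto_shiftedEikonal (hT : 0 < T) (γ : V) :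
    Tendsto (stieltjesSum (G.proj T γ) T fun s => s + 1) atTop (𝓝 (G.shiftedEikonal T γ)) :=
  tendsto_stieltjesSum_add_one hT.le (projectionChain_proj T γ) (proj_zero T γ)

lemma isSelfAdjoint_shiftedEikonal (hT : 0 < T) (γ : V) :
    star (G.shiftedEikonal T γ) = G.shiftedEikonal T γ := by
  have h := tendsto_shiftedEikonal (G := G) hT γ
  have hs : ∀ N, star (stieltjesSum (G.proj T γ) T (fun s => s + 1) N) =
      stieltjesSum (G.proj T γ) T (fun s => s + 1) N := by
    intro N
    have hp : ∀ s, star (G.proj T γ s) = G.proj T γ s := fun s =>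
      isSelfAdjoint_starProjection _
    simp only [stieltjesSum, star_sum, star_smul, star_sub, hp, star_trivial]
  have h2 := (continuous_star.tendsto _).comp h
  refine tendsto_nhds_unique h2 (h.congr fun N => ?_)
  exact (hs N).symm

lemma norm_aeval_shiftedEikonal_le (hT : 0 < T) (γ : V) {p : Polynomial ℝ} (hp : p.coeff 0 = 0)
    {C : ℝ} (hC : 0 ≤ C) (hpC : ∀ s ∈ Set.Icc 0 T, |p.eval (s + 1)| ≤ C) :
    ‖Polynomial.aeval (G.shiftedEikonal T γ) p‖ ≤ C :=
  norm_aeval_eikonal_le hT.le (projectionChain_proj T γ) (proj_zero T γ) hp hC hpC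

lemma aeval_shiftedEikonal_mem {γ : V} (hγ : γ ∈ Sig) {p : Polynomial ℝ} (hp : p.coeff 0 = 0) :
    Polynomial.aeval (G.shiftedEikonal T γ) p ∈ G.eikonalAlgebra Sig T := by
  have hE : G.shiftedEikonal T γ ∈ G.eikonalAlgebra Sig T :=
    NonUnitalStarSubalgebra.le_topologicalClosure _
      (NonUnitalStarAlgebra.subset_adjoin ℝ _ ⟨γ, hγ, rfl⟩)
  have hpow : ∀ n : ℕ, G.shiftedEikonal T γ ^ (n + 1) ∈ G.eikonalAlgebra Sig T := by
    intro n
    induction n with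
    | zero => simpa using hE
    | succ n ih => rw [pow_succ]; exact mul_mem ih hE
  rw [Polynomial.aeval_eq_sum_range]
  refine sum_mem fun n _ => ?_
  rcases n with _ | n
  · rw [hp, zero_smul]; exact zero_mem _
  · exact SMulMemClass.smul_mem _ (hpow n)

namespace Parametrization

variable {D : G.Parametrization Sig T} [Finite V]

namespace HasSymbol

variable {A B : G.L2 →L[ℝ] G.L2} {Q R : (j : Fin D.J) → ℝ → Matrix (Fin (D.m j)) (Fin (D.m j)) ℝ}

lemma congr (h : D.HasSymbol A Q) (hQR : ∀ j, ∀ r ∈ Set.Ioo 0 (D.ε j), Q j r = R j r) :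
    D.HasSymbol A R := by
  intro y j k
  filter_upwards [h y j k, ae_restrict_mem measurableSet_Ioo] with r h1 hr
  rw [h1, hQR j r hr]

lemma add (hA : D.HasSymbol A Q) (hB : D.HasSymbol B R) :
    D.HasSymbol (A + B) fun j r => Q j r + R j r := by
  intro y j k
  rw [add_apply, map_add]
  filter_upwards [hA y j k, hB y j k, Lp.coeFn_add (D.cellMap j k (A y)) (D.cellMap j k (B y))]
    with r h1 h2 h3
  rw [h3, Pi.add_apply, h1, h2, ← Finset.sum_add_distrib]
  exact Finset.sum_congr rfl fun l _ => by rw [Matrix.add_apply, add_mul]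

lemma smul (c : ℝ) (hA : D.HasSymbol A Q) : D.HasSymbol (c • A) fun j r => c • Q j r := by
  intro y j k
  rw [smul_apply, map_smul]
  filter_upwards [hA y j k, Lp.coeFn_smul c (D.cellMap j k (A y))] with r h1 h2
  rw [h2, Pi.smul_apply, h1, smul_eq_mul, Finset.mul_sum]
  exact Finset.sum_congr rfl fun l _ => by rw [Matrix.smul_apply, smul_eq_mul, mul_assoc]

lemma sub (hA : D.HasSymbol A Q) (hB : D.HasSymbol B R) :
    D.HasSymbol (A - B) fun j r => Q j r - R j r := by
  have := hA.add (hB.smul (-1))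
  simpa [sub_eq_add_neg] using this

lemma zero : D.HasSymbol 0 fun _ _ => 0 := by
  intro y j k
  rw [zero_apply, map_zero]
  filter_upwards [Lp.coeFn_zero ℝ 2 (volume.restrict (Set.Ioo 0 (D.ε j)))] with r h
  rw [h]
  simp

lemma one : D.HasSymbol 1 fun _ _ => 1 := by
  intro y j k
  refine ae_of_all _ fun r => ?_
  simp [Matrix.one_apply]

lemma mul (hA : D.HasSymbol A Q) (hB : D.HasSymbol B R) :
    D.HasSymbol (A * B) fun j r => Q j r * R j r := by
  intro y j k
  filter_upwards [hA (B y) j k, ae_all_iff.2 fun l => hB y j l] with r h1 h2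
  rw [mul_apply_eq_comp, h1]
  simp_rw [h2, Matrix.mul_apply, Finset.mul_sum, Finset.sum_mul]
  rw [Finset.sum_comm]
  exact Finset.sum_congr rfl fun l _ => Finset.sum_congr rfl fun l' _ => by ring

lemma sum {ι : Type*} (s : Finset ι) {A : ι → G.L2 →L[ℝ] G.L2}
    {Q : ι → (j : Fin D.J) → ℝ → Matrix (Fin (D.m j)) (Fin (D.m j)) ℝ}
    (h : ∀ i ∈ s, D.HasSymbol (A i) (Q i)) :
    D.HasSymbol (∑ i ∈ s, A i) fun j r => ∑ i ∈ s, Q i j r := by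
  classical
  induction s using Finset.induction_on with
  | empty => simpa using zero
  | insert i s hi ih =>
    simp only [Finset.sum_insert hi]
    exact (h i (Finset.mem_insert_self _ _)).add
      (ih fun k hk => h k (Finset.mem_insert_of_mem hk))

lemma aeval (hA : D.HasSymbol A Q) (p : Polynomial ℝ) :
    D.HasSymbol (Polynomial.aeval A p) fun j r => Polynomial.aeval (Q j r) p := by
  have hpow : ∀ n : ℕ, D.HasSymbol (A ^ n) fun j r => Q j r ^ n := by
    intro n
    induction n with
    | zero => simpa using one
    | succ n ih => simpa only [pow_succ] using ih.mul hA
  simp_rw [Polynomial.aeval_eq_sum_range]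
  exact sum _ fun n _ => (hpow n).smul _

/-- Operator convergence gives convergence in `L²` on each cell, hence almost everywhere along a
subsequence, where it must agree with the pointwise limit of the symbols. -/
lemma limit {A : ℕ → G.L2 →L[ℝ] G.L2} {A' : G.L2 →L[ℝ] G.L2}
    {Q : ℕ → (j : Fin D.J) → ℝ → Matrix (Fin (D.m j)) (Fin (D.m j)) ℝ}
    (h : ∀ N, D.HasSymbol (A N) (Q N)) (hA : Tendsto A atTop (𝓝 A'))
    (hQ : ∀ j, ∀ r ∈ Set.Ioo 0 (D.ε j), Tendsto (fun N => Q N j r) atTop (𝓝 (R j r))) :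
    D.HasSymbol A' R := by
  intro y j k
  have h1 : Tendsto (fun N => D.cellMap j k (A N y)) atTop (𝓝 (D.cellMap j k (A' y))) :=
    ((D.cellMap j k).continuous.tendsto _).comp
      (((ContinuousLinearMap.apply ℝ G.L2 y).continuous.tendsto A').comp hA)
  obtain ⟨ns, hns, hae⟩ := (tendstoInMeasure_of_tendsto_Lp h1).exists_seq_tendsto_ae
  filter_upwards [hae, ae_all_iff.2 fun N => h N y j k, ae_restrict_mem measurableSet_Ioo]
    with r h2 h3 hr
  refine tendsto_nhds_unique h2 ?_
  simp_rw [h3]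
  refine tendsto_finsetSum _ fun l _ => ?_
  have h4 := (hQ j r hr).comp hns.tendsto_atTop
  exact ((tendsto_pi_nhds.1 (tendsto_pi_nhds.1 h4 k)) l).mul_const _

end HasSymbol

variable (D)

/-- The matrix function by which the shifted eikonal acts. -/
noncomputable def eikonalSymbol (γ : V) (j : Fin D.J) (r : ℝ) :
    Matrix (Fin (D.m j)) (Fin (D.m j)) ℝ :=
  ∑ i, (D.timeFun j i r + 1) • D.P γ j i

theorem hasSymbol_shiftedEikonal (hT : 0 < T) {γ : V} (hγ : γ ∈ Sig) :
    D.HasSymbol (G.shiftedEikonal T γ) (D.eikonalSymbol γ) := by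
  have hN : ∀ N : ℕ, D.HasSymbol (stieltjesSum (G.proj T γ) T (fun s => s + 1) N) fun j r =>
      ∑ k ∈ Finset.range N, (((k : ℝ) + 1) * T / N + 1) •
        (D.projSymbol γ (((k : ℝ) + 1) * T / N) j r - D.projSymbol γ ((k : ℝ) * T / N) j r) := by
    intro N
    refine HasSymbol.sum _ fun k hk => HasSymbol.smul _ ?_
    have hkN : k + 1 ≤ N := Finset.mem_range.1 hk
    have hN : (0 : ℝ) < N := by exact_mod_cast (by omega : 0 < N)
    have h1 : ((k : ℝ) + 1) ≤ N := by exact_mod_cast hkN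
    refine (D.hasSymbol_proj hγ ?_).sub (D.hasSymbol_proj hγ ?_)
    · rw [div_le_iff₀ hN]; nlinarith
    · rw [div_le_iff₀ hN]; nlinarith
  refine HasSymbol.limit hN (tendsto_shiftedEikonal hT γ) fun j r hr => ?_
  have hre : ∀ N : ℕ, (∑ k ∈ Finset.range N, (((k : ℝ) + 1) * T / N + 1) •
        (D.projSymbol γ (((k : ℝ) + 1) * T / N) j r - D.projSymbol γ ((k : ℝ) * T / N) j r)) =
      ∑ i, (∑ k ∈ Finset.range N, (((k : ℝ) + 1) * T / N + 1) *
      ((if D.timeFun j i r ≤ ((k : ℝ) + 1) * T / N then (1 : ℝ) else 0) -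
        if D.timeFun j i r ≤ (k : ℝ) * T / N then (1 : ℝ) else 0)) • D.P γ j i := by
    intro N
    simp_rw [Finset.sum_smul]
    rw [Finset.sum_comm]
    refine Finset.sum_congr rfl fun k _ => ?_
    rw [projSymbol, projSymbol, ← Finset.sum_sub_distrib, Finset.smul_sum]
    refine Finset.sum_congr rfl fun i _ => ?_
    rw [← sub_smul, smul_smul]
  simp_rw [hre]
  refine tendsto_finsetSum _ fun i _ => ?_
  have hb := IsTime.bounds D hr (D.isTime_timeFun j i hr)
  exact (tendsto_step_sum hb.1 hb.2).smul_const _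

/-- A continuous function of a shifted eikonal. -/
theorem exists_functionalCalculus (hT : 0 < T) {γ : V} (hγ : γ ∈ Sig) {h : ℝ → ℝ}
    (hc : Continuous h) (h0 : h 0 = 0) : ∃ A ∈ G.eikonalAlgebra Sig T,
      D.HasSymbol A fun j r => ∑ i, h (D.timeFun j i r + 1) • D.P γ j i := by
  have hpoly : ∀ N : ℕ, ∃ p : Polynomial ℝ, p.coeff 0 = 0 ∧
      ∀ x ∈ Set.Icc 0 (T + 1), |p.eval x - h x| ≤ 1 / ((N : ℝ) + 1) := by
    intro N
    -- Removing the constant term costs another copy of the error, because `h 0 = 0`; hence the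
    -- accuracy is halved beforehand.
    obtain ⟨p, hp⟩ := exists_polynomial_near_of_continuousOn 0 (T + 1) h hc.continuousOn
      (1 / ((N : ℝ) + 1) / 2) (by positivity)
    refine ⟨p - Polynomial.C (p.eval 0), ?_, fun x hx => ?_⟩
    · simp [Polynomial.coeff_zero_eq_eval_zero]
    · have h1 := hp x hx
      have h2 := hp 0 ⟨le_rfl, by linarith⟩
      rw [h0, sub_zero] at h2
      rw [Polynomial.eval_sub, Polynomial.eval_C]
      have : p.eval x - p.eval 0 - h x = (p.eval x - h x) - p.eval 0 := by ring
      rw [this]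
      refine (abs_sub _ _).trans ?_
      linarith
  choose p hp0 hp using hpoly
  -- A polynomial without constant term, evaluated at the shifted eikonal, has norm at most its
  -- supremum over `[1, T + 1]`; uniform approximation of `h` therefore makes these operators
  -- Cauchy.
  have hdist : ∀ m n, ‖Polynomial.aeval (G.shiftedEikonal T γ) (p m) -
      Polynomial.aeval (G.shiftedEikonal T γ) (p n)‖ ≤ 1 / ((m : ℝ) + 1) + 1 / ((n : ℝ) + 1) := by
    intro m n
    rw [← map_sub]
    refine norm_aeval_shiftedEikonal_le hT γ (by simp [hp0]) (by positivity) fun s hs => ?_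
    have hs' : s + 1 ∈ Set.Icc 0 (T + 1) := ⟨by linarith [hs.1], by linarith [hs.2]⟩
    have h1 := hp m _ hs'
    have h2 := hp n _ hs'
    rw [Polynomial.eval_sub]
    have : (p m).eval (s + 1) - (p n).eval (s + 1) =
      ((p m).eval (s + 1) - h (s + 1)) - ((p n).eval (s + 1) - h (s + 1)) := by ring
    rw [this]
    exact (abs_sub _ _).trans (add_le_add h1 h2)
  have hlim := tendsto_one_div_add_atTop_nhds_zero_nat (𝕜 := ℝ)
  have hcau : CauchySeq fun N => Polynomial.aeval (G.shiftedEikonal T γ) (p N) := by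
    refine cauchySeq_of_le_tendsto_0 (fun N : ℕ => 2 * (1 / ((N : ℝ) + 1))) ?_ ?_
    · intro n m N hn hm
      rw [dist_eq_norm]
      refine (hdist n m).trans ?_
      have h1 : 1 / ((n : ℝ) + 1) ≤ 1 / ((N : ℝ) + 1) := by gcongr
      have h2 : 1 / ((m : ℝ) + 1) ≤ 1 / ((N : ℝ) + 1) := by gcongr
      linarith
    · simpa using hlim.const_mul 2
  obtain ⟨A, hA⟩ := cauchySeq_tendsto_of_complete hcau
  refine ⟨A, ?_, ?_⟩
  · exact (NonUnitalStarSubalgebra.isClosed_topologicalClosure _).mem_of_tendsto hA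
      (Eventually.of_forall fun N => aeval_shiftedEikonal_mem hγ (hp0 N))
  · refine HasSymbol.limit (fun N => (D.hasSymbol_shiftedEikonal hT hγ).aeval (p N)) hA
      fun j r hr => ?_
    simp_rw [eikonalSymbol, aeval_sum_smul_idempotents Finset.univ (fun i => D.P γ j i)
      (fun i i' => D.P_mul_P γ j i i') _ _ (hp0 _)]
    refine tendsto_finsetSum _ fun i _ => Tendsto.smul_const ?_ _
    have hb := IsTime.bounds D hr (D.isTime_timeFun j i hr)
    rw [← tendsto_sub_nhds_zero_iff]
    exact squeeze_zero_norm (fun N => hp N _ ⟨by linarith, by linarith⟩) hlim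

/-- The symbol of an element which sees only one time cell. -/
theorem exists_localized (hT : 0 < T) {γ : V} (hγ : γ ∈ Sig) (j : Fin D.J) (i : Fin (D.n j))
    {g : ℝ → ℝ} (hg : Continuous g) (hg0 : ∀ r, r ∉ Set.Ioo 0 (D.ε j) → g r = 0) :
    ∃ A ∈ G.eikonalAlgebra Sig T, D.HasSymbol A fun j' r => Pi.single
      (M := fun j => Matrix (Fin (D.m j)) (Fin (D.m j)) ℝ) j (g r • D.P γ j i) j' := by
  set σ := D.timeSign j i with hσ
  have hsq : σ * σ = 1 := by rcases D.timeSign_eq j i with h | h <;> rw [hσ, h] <;> norm_num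
  -- `R x` is the parameter at which the shifted time `timeFun j i r + 1` equals `x`; the function
  -- applied to the eikonal is `g ∘ R`.
  set R : ℝ → ℝ := fun x => D.ε j / 2 + σ * (x - 1 - D.time j i) with hR
  have hRf : ∀ x, D.timeFun j i (R x) = x - 1 := by
    intro x
    simp only [timeFun, ← hσ, hR]
    linear_combination (x - 1 - D.time j i) * hsq
  -- The value `0` corresponds to the time `-1`, whereas all times of a lattice are positive.
  have h0 : g (R 0) = 0 := by
    refine hg0 _ fun hmem => ?_
    have := (IsTime.bounds D hmem (D.isTime_timeFun j i hmem)).1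
    rw [hRf] at this
    linarith
  obtain ⟨A, hA, hsym⟩ := D.exists_functionalCalculus hT hγ (h := fun x => g (R x))
    (hg.comp (by fun_prop)) h0
  refine ⟨A, hA, hsym.congr fun j' r hr => ?_⟩
  -- If `R` carried a shifted time of another time cell into `(0, ε_j)`, the two time cells would
  -- overlap.
  have hval : ∀ i', (⟨j, i⟩ : Σ j, Fin (D.n j)) ≠ ⟨j', i'⟩ →
      g (R (D.timeFun j' i' r + 1)) = 0 := by
    intro i' hne
    refine hg0 _ fun hmem => hne ?_
    exact (D.timeFun_inj hmem hr (by rw [hRf]; ring)).1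
  by_cases hj : j' = j
  · subst hj
    rw [Pi.single_eq_same, Finset.sum_eq_single i]
    · have : R (D.timeFun j' i r + 1) = r := D.timeFun_injective j' i (by rw [hRf]; ring)
      rw [this]
    · intro i' _ hi'
      rw [hval i' (by simpa using hi'.symm), zero_smul]
    · simp
  · rw [Pi.single_eq_of_ne hj]
    refine Finset.sum_eq_zero fun i' _ => ?_
    rw [hval i' (fun h => hj (by rw [Sigma.mk.inj_iff] at h; exact h.1.symm)), zero_smul]

end Parametrization

end MetricGraph

/-! ### Continuous symbols, the model algebra and its fibres. -/

namespace MetricGraph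

variable {V E : Type*} [Fintype E] {G : MetricGraph V E} {Sig : Set V} {T : ℝ}

namespace Parametrization

variable (D : G.Parametrization Sig T)

/-- A symbol as a function of a real parameter. -/
noncomputable def extendSymbol (F : D.Symbols) (j : Fin D.J) (r : ℝ) :
    Matrix (Fin (D.m j)) (Fin (D.m j)) ℝ :=
  F j (Set.projIcc 0 (D.ε j) (D.ε_pos j).le r)

variable {D} in
lemma extendSymbol_of_mem (F : D.Symbols) {j : Fin D.J} {r : ℝ} (hr : r ∈ Set.Icc 0 (D.ε j)) :
    D.extendSymbol F j r = F j ⟨r, hr⟩ := by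
  rw [extendSymbol, Set.projIcc_of_mem _ hr]

variable {D} in
lemma extendSymbol_coe (F : D.Symbols) {j : Fin D.J} (r : Set.Icc 0 (D.ε j)) :
    D.extendSymbol F j r = F j r := extendSymbol_of_mem F r.2

lemma continuous_extendSymbol (F : D.Symbols) (j : Fin D.J) : Continuous (D.extendSymbol F j) :=
  (F j).continuous.comp continuous_projIcc

variable {D} [Finite V]

/-- The two ends of the interval are a null set, and inside it `pt` is the affine parametrisation.
-/
theorem isSymbol_iff {A : G.L2 →L[ℝ] G.L2} {F : D.Symbols} :
    D.IsSymbol A F ↔ D.HasSymbol A (D.extendSymbol F) := by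
  have hval : ∀ (y : G.L2) (j : Fin D.J), ∀ᵐ r ∂volume.restrict (Set.Ioo 0 (D.ε j)),
      ∀ k, D.cellMap j k y r = y.val (D.pt j k r) := by
    intro y j
    rw [ae_all_iff]
    intro k
    filter_upwards [D.coeFn_cellMap j k y, ae_restrict_mem measurableSet_Ioo] with r h hr
    rw [h, D.pt_eq j k hr]
  constructor
  · intro h y j k
    filter_upwards [hval y j, hval (A y) j, ae_restrict_of_ae (h y j),
      ae_restrict_mem measurableSet_Ioo] with r h1 h2 h3 hr
    have hr' := Set.Ioo_subset_Icc_self hr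
    rw [h2, h3 hr' k, extendSymbol_of_mem F hr']
    simp_rw [h1]
  · intro h y j
    have h0 : ∀ᵐ r : ℝ, r ≠ 0 := by simp [ae_iff]
    have h1 : ∀ᵐ r : ℝ, r ≠ D.ε j := by simp [ae_iff]
    have h2 := (ae_restrict_iff' measurableSet_Ioo).1 (hval y j)
    have h3 := (ae_restrict_iff' measurableSet_Ioo).1 (hval (A y) j)
    have h4 := (ae_restrict_iff' measurableSet_Ioo).1 (ae_all_iff.2 (h y j))
    filter_upwards [h0, h1, h2, h3, h4] with r h0 h1 h2 h3 h4 hr k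
    have hr' : r ∈ Set.Ioo 0 (D.ε j) := ⟨lt_of_le_of_ne hr.1 h0.symm, lt_of_le_of_ne hr.2 h1⟩
    rw [← h3 hr' k, h4 hr' k, extendSymbol_of_mem F hr]
    simp_rw [h2 hr']

/-- The entries of a symbol are bounded by the norm of the operator. -/
theorem IsSymbol.abs_le {A : G.L2 →L[ℝ] G.L2} {F : D.Symbols} (h : D.IsSymbol A F) (j : Fin D.J)
    (r : Set.Icc 0 (D.ε j)) (k l : Fin (D.m j)) : |F j r k l| ≤ ‖A‖ := by
  by_contra! hlt
  set φ : ℝ → ℝ := fun r => |D.extendSymbol F j r k l| with hφ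
  have hφc : Continuous φ := ((D.continuous_extendSymbol F j).matrix_elem k l).abs
  set c := (‖A‖ + |F j r k l|) / 2 with hc
  have hc1 : ‖A‖ < c := by rw [hc]; linarith
  have hc2 : c < φ r := by
    rw [hφ]
    simp only [extendSymbol_coe]
    rw [hc]; linarith
  have hc0 : 0 < c := (norm_nonneg A).trans_lt hc1
  have hUo : IsOpen {x | c < φ x} := isOpen_lt continuous_const hφc
  -- The bad set is pushed into the open interval; it is nonempty even when `r` is an end, since `r`
  -- is in the closure. Testing `A` on the indicator of `S`, placed on the `l`-th cell, contradicts
  -- its norm.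
  set S := {x | c < φ x} ∩ Set.Ioo 0 (D.ε j) with hS
  have hSo : IsOpen S := hUo.inter isOpen_Ioo
  have hSne : S.Nonempty := by
    refine mem_closure_iff.1 ?_ _ hUo hc2
    rw [closure_Ioo (D.ε_pos j).ne]
    exact r.2
  have hSmeas : volume.restrict (Set.Ioo 0 (D.ε j)) S = volume S := by
    rw [Measure.restrict_apply hSo.measurableSet, Set.inter_eq_left.2 Set.inter_subset_right]
  have hfin : volume.restrict (Set.Ioo 0 (D.ε j)) S ≠ ⊤ := by
    rw [hSmeas]
    exact ((measure_mono Set.inter_subset_right).trans_lt measure_Ioo_lt_top).ne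
  have hpos : volume.restrict (Set.Ioo 0 (D.ε j)) S ≠ 0 := by
    rw [hSmeas]
    exact (hSo.measure_pos volume hSne).ne'
  set g : D.CellL2 j := indicatorConstLp 2 hSo.measurableSet hfin 1 with hg
  have hg0 : 0 < ‖g‖ := by
    rw [hg, norm_indicatorConstLp (by norm_num) (by norm_num), norm_one, one_mul]
    refine Real.rpow_pos_of_pos ?_ _
    exact ENNReal.toReal_pos hpos hfin
  have hb : ‖g‖ ≤ c⁻¹ * ‖D.cellMap j k (A (D.embed j l g))‖ := by
    refine Lp.norm_le_mul_norm_of_ae_le_mul ?_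
    filter_upwards [isSymbol_iff.1 h (D.embed j l g) j k,
      indicatorConstLp_coeFn (p := 2) (hs := hSo.measurableSet) (hμs := hfin) (c := (1 : ℝ)),
      Lp.coeFn_zero ℝ 2 (volume.restrict (Set.Ioo 0 (D.ε j)))] with x h1 h2 h3
    have h4 : ∀ l', D.cellMap j l' (D.embed j l g) x = if l' = l then g x else 0 := by
      intro l'
      split_ifs with hl
      · rw [hl, cellMap_embed]
      · rw [D.cellMap_embed_of_ne (Ne.symm hl), h3, Pi.zero_apply]
    simp_rw [h1, h4, mul_ite, mul_zero]
    rw [Finset.sum_ite_eq' Finset.univ l, if_pos (Finset.mem_univ _), norm_mul, hg, h2]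
    by_cases hx : x ∈ S
    · have : c < ‖D.extendSymbol F j x k l‖ := hx.1
      rw [Set.indicator_of_mem hx, norm_one, mul_one, ← div_eq_inv_mul, le_div_iff₀ hc0]
      linarith
    · simp [Set.indicator_of_notMem hx]
  have h1 : ‖D.cellMap j k (A (D.embed j l g))‖ ≤ ‖A‖ * ‖g‖ :=
    (D.norm_cellMap_le j k _).trans ((A.le_opNorm _).trans
      (mul_le_mul_of_nonneg_left (D.norm_embed_le j l g) (norm_nonneg A)))
  have h2 : c * ‖g‖ ≤ ‖A‖ * ‖g‖ := by
    rw [← div_eq_inv_mul, le_div_iff₀ hc0] at hb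
    linarith
  have := le_of_mul_le_mul_right h2 hg0
  linarith

namespace IsSymbol

variable {A B : G.L2 →L[ℝ] G.L2} {F F' : D.Symbols}

lemma add (hA : D.IsSymbol A F) (hB : D.IsSymbol B F') : D.IsSymbol (A + B) (F + F') :=
  isSymbol_iff.2 ((isSymbol_iff.1 hA).add (isSymbol_iff.1 hB))

lemma mul (hA : D.IsSymbol A F) (hB : D.IsSymbol B F') : D.IsSymbol (A * B) (F * F') :=
  isSymbol_iff.2 ((isSymbol_iff.1 hA).mul (isSymbol_iff.1 hB))

lemma smul (c : ℝ) (hA : D.IsSymbol A F) : D.IsSymbol (c • A) (c • F) :=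
  isSymbol_iff.2 ((isSymbol_iff.1 hA).smul c)

lemma sub (hA : D.IsSymbol A F) (hB : D.IsSymbol B F') : D.IsSymbol (A - B) (F - F') :=
  isSymbol_iff.2 ((isSymbol_iff.1 hA).sub (isSymbol_iff.1 hB))

lemma zero : D.IsSymbol 0 0 := isSymbol_iff.2 HasSymbol.zero

theorem unique (hF : D.IsSymbol A F) (hF' : D.IsSymbol A F') : F = F' := by
  have h := hF.sub hF'
  rw [sub_self] at h
  funext j
  ext r k l
  have := h.abs_le j r k l
  rw [norm_zero] at this
  have := abs_nonpos_iff.1 this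
  exact sub_eq_zero.1 this

end IsSymbol

variable (D)

/-- The symbol of a shifted eikonal. -/
noncomputable def eikonalFun (γ : V) : D.Symbols := fun j =>
  ⟨fun r => D.eikonalSymbol γ j r, by
    unfold eikonalSymbol
    refine continuous_finsetSum _ fun i _ => ?_
    have h : Continuous fun r : Set.Icc 0 (D.ε j) => D.timeFun j i r + 1 :=
      ((D.continuous_timeFun j i).comp continuous_subtype_val).add continuous_const
    exact h.smul continuous_const⟩

lemma isSymbol_eikonalFun (hT : 0 < T) {γ : V} (hγ : γ ∈ Sig) :
    D.IsSymbol (G.shiftedEikonal T γ) (D.eikonalFun γ) := by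
  refine isSymbol_iff.2 ((D.hasSymbol_shiftedEikonal hT hγ).congr fun j r hr => ?_)
  rw [extendSymbol_of_mem _ (Set.Ioo_subset_Icc_self hr)]
  rfl

omit [Finite V] in
lemma star_P (γ : V) (j : Fin D.J) (i : Fin (D.n j)) : star (D.P γ j i) = D.P γ j i := by
  rw [Matrix.star_eq_conjTranspose, Matrix.conjTranspose_eq_transpose_of_trivial, P_transpose]

lemma star_eikonalFun (γ : V) : star (D.eikonalFun γ) = D.eikonalFun γ := by
  funext j
  ext1 r
  change star (D.eikonalSymbol γ j r) = D.eikonalSymbol γ j r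
  simp only [eikonalSymbol, star_sum, star_smul, star_P, star_trivial]

/-- The elements of the eikonal algebra have symbols, compatibly with the adjoint and with the
fibre algebras. -/
theorem exists_symbol (hT : 0 < T) {A : G.L2 →L[ℝ] G.L2} (hA : A ∈ G.eikonalAlgebra Sig T) :
    ∃ F : D.Symbols, D.IsSymbol A F ∧ D.IsSymbol (star A) (star F) ∧
      ∀ r, (fun j => F j (r j)) ∈ D.fibreAlgebra r := by
  -- The symbol of the adjoint is carried along so that the induction passes through `star`; it
  -- starts because the eikonals and their symbols are self-adjoint.
  have hadj : ∀ A ∈ NonUnitalStarAlgebra.adjoin ℝ (G.shiftedEikonal T '' Sig),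
      ∃ F : D.Symbols, D.IsSymbol A F ∧ D.IsSymbol (star A) (star F) ∧
        ∀ r, (fun j => F j (r j)) ∈ D.fibreAlgebra r := by
    intro A hA
    induction hA using NonUnitalStarAlgebra.adjoin_induction with
    | mem A hA =>
      obtain ⟨γ, hγ, rfl⟩ := hA
      have h := D.isSymbol_eikonalFun hT hγ
      refine ⟨D.eikonalFun γ, h, ?_, fun r => ?_⟩
      · rw [isSelfAdjoint_shiftedEikonal hT, star_eikonalFun]
        exact h
      · exact NonUnitalStarSubalgebra.le_topologicalClosure _
          (NonUnitalStarAlgebra.subset_adjoin ℝ _ ⟨γ, hγ, _, h, rfl⟩)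
    | add A B _ _ hA hB =>
      obtain ⟨F, h1, h2, h3⟩ := hA
      obtain ⟨F', h1', h2', h3'⟩ := hB
      refine ⟨F + F', h1.add h1', ?_, fun r => add_mem (h3 r) (h3' r)⟩
      rw [star_add, star_add]
      exact h2.add h2'
    | zero =>
      refine ⟨0, IsSymbol.zero, ?_, fun r => zero_mem _⟩
      rw [star_zero, star_zero]
      exact IsSymbol.zero
    | mul A B _ _ hA hB =>
      obtain ⟨F, h1, h2, h3⟩ := hA
      obtain ⟨F', h1', h2', h3'⟩ := hB
      refine ⟨F * F', h1.mul h1', ?_, fun r => mul_mem (h3 r) (h3' r)⟩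
      rw [star_mul, star_mul]
      exact h2'.mul h2
    | smul c A _ hA =>
      obtain ⟨F, h1, h2, h3⟩ := hA
      refine ⟨c • F, h1.smul c, ?_, fun r => SMulMemClass.smul_mem c (h3 r)⟩
      rw [star_smul, star_smul]
      exact h2.smul _
    | star A _ hA =>
      obtain ⟨F, h1, h2, h3⟩ := hA
      refine ⟨star F, h2, ?_, fun r => star_mem (h3 r)⟩
      rw [star_star, star_star]
      exact h1
  obtain ⟨a, ha, hlim⟩ := mem_closure_iff_seq_limit.1
    (show A ∈ closure (NonUnitalStarAlgebra.adjoin ℝ (G.shiftedEikonal T '' Sig) :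
      Set (G.L2 →L[ℝ] G.L2)) from hA)
  choose F h1 h2 h3 using fun n => hadj (a n) (ha n)
  -- Entries of symbols are controlled by the operator norm, so for a convergent sequence of
  -- operators each entry is uniformly Cauchy and has a continuous limit, also at the ends of the
  -- interval.
  have hent : ∀ j k l, ∃ g : C(Set.Icc 0 (D.ε j), ℝ), ∀ r,
      Tendsto (fun n => F n j r k l) atTop (𝓝 (g r)) := by
    intro j k l
    set f : ℕ → C(Set.Icc 0 (D.ε j), ℝ) := fun n =>
      ⟨fun r => F n j r k l, (F n j).continuous.matrix_elem k l⟩ with hf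
    have hcau : CauchySeq f := by
      refine Metric.cauchySeq_iff.2 fun δ hδ => ?_
      obtain ⟨N, hN⟩ := Metric.cauchySeq_iff.1 hlim.cauchySeq δ hδ
      refine ⟨N, fun m hm n hn => lt_of_le_of_lt ?_ (hN m hm n hn)⟩
      refine (ContinuousMap.dist_le dist_nonneg).2 fun r => ?_
      rw [dist_eq_norm (a m), Real.dist_eq]
      exact ((h1 m).sub (h1 n)).abs_le j r k l
    obtain ⟨g, hg⟩ := cauchySeq_tendsto_of_complete hcau
    exact ⟨g, fun r => ((continuous_eval_const r).tendsto g).comp hg⟩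
  choose g hg using hent
  set F' : D.Symbols := fun j => ⟨fun r => Matrix.of fun k l => g j k l r,
    continuous_matrix fun k l => (g j k l).continuous⟩ with hF'
  have hFlim : ∀ j r, Tendsto (fun n => F n j r) atTop (𝓝 (F' j r)) := fun j r =>
    tendsto_pi_nhds.2 fun k => tendsto_pi_nhds.2 fun l => hg j k l r
  refine ⟨F', isSymbol_iff.2 (HasSymbol.limit (fun n => isSymbol_iff.1 (h1 n)) hlim
    fun j r _ => hFlim j _), isSymbol_iff.2 (HasSymbol.limit (fun n => isSymbol_iff.1 (h2 n))
    ((continuous_star.tendsto A).comp hlim) fun j r _ => ?_), fun r => ?_⟩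
  · exact (continuous_star.tendsto _).comp (hFlim j _)
  · exact (NonUnitalStarSubalgebra.isClosed_topologicalClosure _).mem_of_tendsto
      (tendsto_pi_nhds.2 fun j => hFlim j (r j)) (Eventually.of_forall fun n => h3 n r)

section ModelAlgebra

variable {D}

lemma modelAlgebra_add {e e' : D.Symbols} (he : e ∈ D.modelAlgebra) (he' : e' ∈ D.modelAlgebra) :
    e + e' ∈ D.modelAlgebra := by
  obtain ⟨A, hA, h⟩ := he
  obtain ⟨B, hB, h'⟩ := he'
  exact ⟨A + B, add_mem hA hB, h.add h'⟩

lemma modelAlgebra_zero : (0 : D.Symbols) ∈ D.modelAlgebra := ⟨0, zero_mem _, IsSymbol.zero⟩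

lemma modelAlgebra_mul {e e' : D.Symbols} (he : e ∈ D.modelAlgebra) (he' : e' ∈ D.modelAlgebra) :
    e * e' ∈ D.modelAlgebra := by
  obtain ⟨A, hA, h⟩ := he
  obtain ⟨B, hB, h'⟩ := he'
  exact ⟨A * B, mul_mem hA hB, h.mul h'⟩

lemma modelAlgebra_smul (c : ℝ) {e : D.Symbols} (he : e ∈ D.modelAlgebra) :
    c • e ∈ D.modelAlgebra := by
  obtain ⟨A, hA, h⟩ := he
  exact ⟨c • A, SMulMemClass.smul_mem c hA, h.smul c⟩

lemma modelAlgebra_star (hT : 0 < T) {e : D.Symbols} (he : e ∈ D.modelAlgebra) :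
    star e ∈ D.modelAlgebra := by
  obtain ⟨A, hA, h⟩ := he
  obtain ⟨F, h1, h2, -⟩ := D.exists_symbol hT hA
  rw [h.unique h1]
  exact ⟨star A, star_mem hA, h2⟩

lemma modelAlgebra_sum {ι : Type*} (s : Finset ι) {e : ι → D.Symbols}
    (he : ∀ i ∈ s, e i ∈ D.modelAlgebra) : ∑ i ∈ s, e i ∈ D.modelAlgebra := by
  classical
  induction s using Finset.induction_on with
  | empty => simpa using modelAlgebra_zero
  | insert i s hi ih =>
    rw [Finset.sum_insert hi]
    exact modelAlgebra_add (he i (Finset.mem_insert_self _ _))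
      (ih fun k hk => he k (Finset.mem_insert_of_mem hk))

lemma mem_fibreAlgebra_of_mem_modelAlgebra (hT : 0 < T) {e : D.Symbols}
    (he : e ∈ D.modelAlgebra) (r : ∀ j, Set.Icc (0 : ℝ) (D.ε j)) :
    (fun j => e j (r j)) ∈ D.fibreAlgebra r := by
  obtain ⟨A, hA, h⟩ := he
  obtain ⟨F, h1, -, h3⟩ := D.exists_symbol hT hA
  rw [h.unique h1]
  exact h3 r

omit [Finite V] in
lemma P_mem_blockAlgebra {γ : V} (hγ : γ ∈ Sig) (j : Fin D.J) (i : Fin (D.n j)) :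
    D.P γ j i ∈ D.blockAlgebra j :=
  NonUnitalStarSubalgebra.le_topologicalClosure _
    (NonUnitalStarAlgebra.subset_adjoin ℝ _ ⟨γ, hγ, i, rfl⟩)

/-- The generators evaluate to combinations of the projectors, and the block algebra is closed. The
coordinates of `r` may be ends of the intervals here. -/
lemma mem_blockAlgebra_of_mem_fibreAlgebra (hT : 0 < T) {r : ∀ j, Set.Icc (0 : ℝ) (D.ε j)}
    {M : ∀ j, Matrix (Fin (D.m j)) (Fin (D.m j)) ℝ} (hM : M ∈ D.fibreAlgebra r) (j : Fin D.J) :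
    M j ∈ D.blockAlgebra j := by
  have hcl : IsClosed {M : ∀ j, Matrix (Fin (D.m j)) (Fin (D.m j)) ℝ | M j ∈ D.blockAlgebra j} :=
    (NonUnitalStarSubalgebra.isClosed_topologicalClosure _).preimage (continuous_apply j)
  suffices hadj : ∀ M ∈ NonUnitalStarAlgebra.adjoin ℝ
      {M : ∀ j, Matrix (Fin (D.m j)) (Fin (D.m j)) ℝ |
        ∃ γ ∈ Sig, ∃ F : D.Symbols, D.IsSymbol (G.shiftedEikonal T γ) F ∧ M = fun j => F j (r j)},
      M j ∈ D.blockAlgebra j from closure_minimal hadj hcl hM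
  intro M hM
  induction hM using NonUnitalStarAlgebra.adjoin_induction with
  | mem M hM =>
    obtain ⟨γ, hγ, F, hF, rfl⟩ := hM
    rw [hF.unique (D.isSymbol_eikonalFun hT hγ)]
    change ∑ i, (D.timeFun j i (r j) + 1) • D.P γ j i ∈ D.blockAlgebra j
    exact sum_mem fun i _ => SMulMemClass.smul_mem _ (P_mem_blockAlgebra hγ j i)
  | add M N _ _ hM hN => exact add_mem hM hN
  | zero => exact zero_mem (D.blockAlgebra j)
  | mul M N _ _ hM hN => exact mul_mem hM hN
  | smul c M _ hM => exact SMulMemClass.smul_mem (s := D.blockAlgebra j) c hM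
  | star M _ hM => exact star_mem (s := D.blockAlgebra j) hM

/-- The model algebra contains the functions supported in one time cell. -/
theorem exists_mem_modelAlgebra (hT : 0 < T) {γ : V} (hγ : γ ∈ Sig) (j : Fin D.J) (i : Fin (D.n j))
    {g : ℝ → ℝ} (hg : Continuous g) (hg0 : ∀ r, r ∉ Set.Ioo 0 (D.ε j) → g r = 0) :
    ∃ e ∈ D.modelAlgebra, (∀ r : Set.Icc 0 (D.ε j), e j r = g r • D.P γ j i) ∧
      ∀ j', j' ≠ j → e j' = 0 := by
  obtain ⟨A, hA, hsym⟩ := D.exists_localized hT hγ j i hg hg0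
  set e : D.Symbols := Pi.single (M := fun j =>
    C(Set.Icc (0 : ℝ) (D.ε j), Matrix (Fin (D.m j)) (Fin (D.m j)) ℝ)) j
    ⟨fun r => g r • D.P γ j i, (hg.comp continuous_subtype_val).smul continuous_const⟩ with he
  refine ⟨e, ⟨A, hA, isSymbol_iff.2 (hsym.congr fun j' r hr => ?_)⟩, fun r => ?_, fun j' hj => ?_⟩
  · rw [extendSymbol_of_mem _ (Set.Ioo_subset_Icc_self hr)]
    by_cases hj : j' = j
    · subst hj
      rw [he, Pi.single_eq_same, Pi.single_eq_same]
      rfl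
    · rw [he, Pi.single_eq_of_ne hj, Pi.single_eq_of_ne hj]
      rfl
  · rw [he, Pi.single_eq_same]
    rfl
  · rw [he, Pi.single_eq_of_ne hj]

lemma exists_cutoff {ε a b : ℝ} (ha : 0 < a) (hb : b < ε) : ∃ χ : ℝ → ℝ, Continuous χ ∧
    (∀ r, r ∉ Set.Ioo 0 ε → χ r = 0) ∧ ∀ r ∈ Set.Icc a b, χ r = 1 := by
  refine ⟨fun r => max 0 (min 1 (min (r / a) ((ε - r) / (ε - b)))), by fun_prop, fun r hr => ?_,
    fun r hr => ?_⟩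
  · refine max_eq_left ?_
    by_cases h0 : 0 < r
    · have h1 : ε ≤ r := by
        by_contra! h
        exact hr ⟨h0, h⟩
      exact (min_le_right _ _).trans ((min_le_right _ _).trans
        (div_nonpos_of_nonpos_of_nonneg (by linarith) (by linarith)))
    · exact (min_le_right _ _).trans ((min_le_left _ _).trans
        (div_nonpos_of_nonpos_of_nonneg (by linarith) ha.le))
  · have h1 : 1 ≤ r / a := (one_le_div ha).2 hr.1
    have h2 : 1 ≤ (ε - r) / (ε - b) := (one_le_div (by linarith)).2 (by linarith [hr.2])
    simp only
    rw [min_eq_left (le_min h1 h2), max_eq_right zero_le_one]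

/-- Quantifying over all `f` inside the induction is what handles products: one factor carries `f`,
the other the constant `1`. Equality is asked only on `[a, b]`, where the cut-off equals `1`. -/
lemma exists_mem_modelAlgebra_smul (hT : 0 < T) {j : Fin D.J} {a b : ℝ} (ha : 0 < a)
    (hb : b < D.ε j) {M : Matrix (Fin (D.m j)) (Fin (D.m j)) ℝ}
    (hM : M ∈ NonUnitalStarAlgebra.adjoin ℝ {M | ∃ γ ∈ Sig, ∃ i, M = D.P γ j i}) :
    ∀ f : ℝ → ℝ, Continuous f → ∃ e ∈ D.modelAlgebra,
      (∀ r : Set.Icc 0 (D.ε j), (r : ℝ) ∈ Set.Icc a b → e j r = f r • M) ∧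
        ∀ j', j' ≠ j → e j' = 0 := by
  induction hM using NonUnitalStarAlgebra.adjoin_induction with
  | mem M hM =>
    obtain ⟨γ, hγ, i, rfl⟩ := hM
    intro f hf
    obtain ⟨χ, hχ, h0, h1⟩ := exists_cutoff ha hb
    obtain ⟨e, he, he1, he2⟩ := exists_mem_modelAlgebra hT hγ j i (g := fun r => χ r * f r)
      (hχ.mul hf) fun r hr => by rw [h0 r hr, zero_mul]
    refine ⟨e, he, fun r hr => ?_, he2⟩
    rw [he1, h1 r hr, one_mul]
  | add M N _ _ hM hN =>
    intro f hf
    obtain ⟨e, he, he1, he2⟩ := hM f hf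
    obtain ⟨e', he', he1', he2'⟩ := hN f hf
    refine ⟨e + e', modelAlgebra_add he he', fun r hr => ?_, fun j' hj => ?_⟩
    · rw [Pi.add_apply, ContinuousMap.add_apply, he1 r hr, he1' r hr, smul_add]
    · rw [Pi.add_apply, he2 j' hj, he2' j' hj, add_zero]
  | zero =>
    intro f _
    exact ⟨0, modelAlgebra_zero, fun r _ => by simp, fun _ _ => rfl⟩
  | mul M N _ _ hM hN =>
    intro f hf
    obtain ⟨e, he, he1, he2⟩ := hM f hf
    obtain ⟨e', he', he1', he2'⟩ := hN (fun _ => 1) continuous_const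
    refine ⟨e * e', modelAlgebra_mul he he', fun r hr => ?_, fun j' hj => ?_⟩
    · rw [Pi.mul_apply, ContinuousMap.mul_apply, he1 r hr, he1' r hr, one_smul, smul_mul_assoc]
    · rw [Pi.mul_apply, he2 j' hj, zero_mul]
  | smul c M _ hM =>
    intro f hf
    obtain ⟨e, he, he1, he2⟩ := hM f hf
    refine ⟨c • e, modelAlgebra_smul c he, fun r hr => ?_, fun j' hj => ?_⟩
    · rw [Pi.smul_apply, ContinuousMap.smul_apply, he1 r hr, smul_comm]
    · rw [Pi.smul_apply, he2 j' hj, smul_zero]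
  | star M _ hM =>
    intro f hf
    obtain ⟨e, he, he1, he2⟩ := hM f hf
    refine ⟨star e, modelAlgebra_star hT he, fun r hr => ?_, fun j' hj => ?_⟩
    · rw [Pi.star_apply, ContinuousMap.star_apply, he1 r hr, star_smul, star_trivial]
    · rw [Pi.star_apply, he2 j' hj, star_zero]

/-- Every continuous function with values in a block algebra extends to an element of the model
algebra which vanishes in the other blocks. -/
theorem exists_extension (hT : 0 < T) {j : Fin D.J} {a b : ℝ} (ha : 0 < a) (hab : a ≤ b)
    (hb : b < D.ε j) (g : C(Set.Icc a b, Matrix (Fin (D.m j)) (Fin (D.m j)) ℝ))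
    (hg : ∀ s, g s ∈ D.blockAlgebra j) :
    ∃ e ∈ D.modelAlgebra, (∀ s, g s = e j (D.incl ha hb s)) ∧ ∀ j', j' ≠ j → e j' = 0 := by
  -- Matrices form a finite-dimensional space, so the subalgebra generated algebraically is already
  -- closed. In a basis of it `g` has continuous coordinates, and the basis matrices are treated one
  -- by one.
  set W : Submodule ℝ (Matrix (Fin (D.m j)) (Fin (D.m j)) ℝ) :=
    (NonUnitalStarAlgebra.adjoin ℝ
      {M | ∃ γ ∈ Sig, ∃ i, M = D.P γ j i}).toNonUnitalSubalgebra.toSubmodule with hW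
  have hgW : ∀ s, g s ∈ W := by
    have hcl : IsClosed (W : Set (Matrix (Fin (D.m j)) (Fin (D.m j)) ℝ)) :=
      W.closed_of_finiteDimensional
    intro s
    have : g s ∈ closure (W : Set (Matrix (Fin (D.m j)) (Fin (D.m j)) ℝ)) := hg s
    rwa [hcl.closure_eq] at this
  set B := Module.finBasis ℝ W with hB
  have hcoord : ∀ i, Continuous fun s => B.repr ⟨g s, hgW s⟩ i := fun i =>
    (LinearMap.continuous_of_finiteDimensional (B.coord i)).comp
      (Continuous.subtype_mk g.continuous _)
  have hex := fun i => exists_mem_modelAlgebra_smul (D := D) hT ha hb (M := (B i : Matrix _ _ ℝ))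
    (B i).2 (Set.IccExtend hab fun s => B.repr ⟨g s, hgW s⟩ i) (hcoord i).Icc_extend'
  choose e he he1 he2 using hex
  refine ⟨∑ i, e i, modelAlgebra_sum _ fun i _ => he i, fun s => ?_, fun j' hj => ?_⟩
  · have h1 : g s = ∑ i, B.repr ⟨g s, hgW s⟩ i • (B i : Matrix _ _ ℝ) := by
      have := congrArg W.subtype (B.sum_repr ⟨g s, hgW s⟩)
      rw [map_sum] at this
      simp only [map_smul, Submodule.subtype_apply] at this
      exact this.symm
    rw [Finset.sum_apply, ContinuousMap.coe_sum, Finset.sum_apply]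
    refine h1.trans (Finset.sum_congr rfl fun i _ => ?_)
    rw [he1 i (D.incl ha hb s) s.2]
    congr 1
    exact (Set.IccExtend_of_mem hab (fun s => B.repr ⟨g s, hgW s⟩ i) s.2).symm
  · rw [Finset.sum_apply]
    exact Finset.sum_eq_zero fun i _ => he2 i j' hj

end ModelAlgebra

/-- An element which is a given projector at one point and vanishes at another one. -/
theorem exists_separating (hT : 0 < T) {γ : V} (hγ : γ ∈ Sig) (j : Fin D.J) (i : Fin (D.n j))
    (r r' : ∀ j, Set.Icc (0 : ℝ) (D.ε j)) (h0 : 0 < (r j : ℝ)) (h1 : (r j : ℝ) < D.ε j)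
    (hne : r j ≠ r' j) : ∃ e ∈ D.modelAlgebra,
      (fun k => e k (r k)) = Pi.single j (D.P γ j i) ∧ (fun k => e k (r' k)) = 0 := by
  have hne' : 0 < |(r' j : ℝ) - r j| := abs_pos.2 (sub_ne_zero.2 fun h => hne (Subtype.ext h.symm))
  -- Half the width of a tent centred at `r j`: small enough for the tent to vanish at `0`, at `ε_j`
  -- and at `r' j`.
  set η := min (min (r j : ℝ) (D.ε j - r j)) |(r' j : ℝ) - r j| with hη
  have hη0 : 0 < η := lt_min (lt_min h0 (by linarith)) hne'
  have hz : ∀ x : ℝ, η ≤ |x - r j| → max 0 (1 - |x - r j| / η) = 0 := by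
    intro x hx
    refine max_eq_left ?_
    have := (one_le_div hη0).2 hx
    linarith
  obtain ⟨e, he, he1, he2⟩ := exists_mem_modelAlgebra (D := D) hT hγ j i
    (g := fun x => max 0 (1 - |x - r j| / η)) (by fun_prop) (fun x hx => by
      refine hz x ?_
      by_contra! hlt
      have h2 := abs_lt.1 hlt
      have h3 : η ≤ r j := (min_le_left _ _).trans (min_le_left _ _)
      have h4 : η ≤ D.ε j - r j := (min_le_left _ _).trans (min_le_right _ _)
      exact hx ⟨by linarith, by linarith⟩)
  refine ⟨e, he, ?_, ?_⟩
  · funext k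
    by_cases hk : k = j
    · subst hk
      rw [Pi.single_eq_same, he1]
      simp
    · rw [Pi.single_eq_of_ne hk, he2 k hk]
      rfl
  · funext k
    by_cases hk : k = j
    · subst hk
      rw [he1, hz _ (min_le_right _ _), zero_smul]
      rfl
    · rw [he2 k hk]
      rfl

end Parametrization

end MetricGraph

theorem corollary2 {V E : Type*} [Fintype V] [Fintype E] (G : MetricGraph V E)
    (Sig : Set V) (hSig : Sig ⊆ G.boundary) (T : ℝ) (hT : 0 < T)
    (D : G.Parametrization Sig T) :
    -- every element of the eikonal algebra acts, after parametrisation, as multiplication by a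
    -- unique continuous matrix function (so that the evaluations below are meaningful)
    (∀ A ∈ G.eikonalAlgebra Sig T, ∃! F : D.Symbols, D.IsSymbol A F) ∧
    -- an element of the algebra which is a given projector at `r` and vanishes at the second point
    (∀ γ ∈ Sig, ∀ (j : Fin D.J) (i : Fin (D.n j)) (r r' : ∀ j, Set.Icc (0 : ℝ) (D.ε j)),
      0 < (r j : ℝ) → (r j : ℝ) < D.ε j → r j ≠ r' j →
      ∃ e ∈ D.modelAlgebra,
        (fun k => e k (r k)) = Pi.single j (D.P γ j i) ∧ (fun k => e k (r' k)) = 0) ∧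
    -- the fibre algebra at a point without extreme coordinates
    (∀ r : ∀ j, Set.Icc (0 : ℝ) (D.ε j), (∀ j, (r j : ℝ) ≠ 0 ∧ (r j : ℝ) ≠ D.ε j) →
      ∀ M : ∀ j, Matrix (Fin (D.m j)) (Fin (D.m j)) ℝ,
        M ∈ D.fibreAlgebra r ↔ ∀ j, M j ∈ D.blockAlgebra j) ∧
    -- the restriction of the `j`-th block to an interior segment
    (∀ (j : Fin D.J) (a b : ℝ) (ha : 0 < a) (_ : a ≤ b) (hb : b < D.ε j),
      {g : C(Set.Icc a b, Matrix (Fin (D.m j)) (Fin (D.m j)) ℝ) |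
          ∃ e ∈ D.modelAlgebra, ∀ s, g s = e j (D.incl ha hb s)} =
        {g | ∀ s, g s ∈ D.blockAlgebra j}) ∧
    -- no links between the blocks away from the endpoints
    (∀ (a b : Fin D.J → ℝ) (ha : ∀ j, 0 < a j) (_ : ∀ j, a j ≤ b j) (hb : ∀ j, b j < D.ε j),
      {g : ∀ j, C(Set.Icc (a j) (b j), Matrix (Fin (D.m j)) (Fin (D.m j)) ℝ) |
          ∃ e ∈ D.modelAlgebra, ∀ j s, g j s = e j (D.incl (ha j) (hb j) s)} =
        {g | ∀ j s, g j s ∈ D.blockAlgebra j}) := by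
  open MetricGraph.Parametrization in
  refine ⟨fun A hA => ?_, fun γ hγ j i r r' h0 h1 hne =>
      D.exists_separating hT hγ j i r r' h0 h1 hne,
    fun r hr M => ⟨fun hM j => mem_blockAlgebra_of_mem_fibreAlgebra hT hM j, fun hM => ?_⟩,
    fun j a b ha hab hb => ?_, fun a b ha hab hb => ?_⟩
  · obtain ⟨F, hF, -⟩ := D.exists_symbol hT hA
    exact ⟨F, hF, fun F' hF' => IsSymbol.unique hF' hF⟩
  · have hsingle : ∀ j, Pi.single j (M j) ∈ D.fibreAlgebra r := by
      intro j
      have h0 : 0 < (r j : ℝ) := lt_of_le_of_ne (r j).2.1 (hr j).1.symm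
      have h1 : (r j : ℝ) < D.ε j := lt_of_le_of_ne (r j).2.2 (hr j).2
      -- The extension is taken from the one-point segment `[r j, r j]`.
      obtain ⟨e, he, he1, he2⟩ := exists_extension hT h0 le_rfl h1
        (ContinuousMap.const _ (M j)) fun _ => hM j
      have heq : Pi.single j (M j) = fun k => e k (r k) := by
        funext k
        by_cases hk : k = j
        · subst hk
          rw [Pi.single_eq_same]
          exact he1 ⟨r k, le_rfl, le_rfl⟩
        · rw [Pi.single_eq_of_ne hk, he2 k hk]
          rfl
      rw [heq]
      exact mem_fibreAlgebra_of_mem_modelAlgebra hT he r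
    rw [← Finset.univ_sum_single M]
    exact sum_mem fun j _ => hsingle j
  · ext g
    refine ⟨?_, fun hg => ?_⟩
    · rintro ⟨e, he, hge⟩ s
      rw [hge]
      -- The other coordinates are irrelevant and are set to `0`; membership of the evaluated block
      -- needs no interior point.
      have := mem_blockAlgebra_of_mem_fibreAlgebra hT (mem_fibreAlgebra_of_mem_modelAlgebra hT he
        (Function.update (fun k => ⟨0, le_rfl, (D.ε_pos k).le⟩) j (D.incl ha hb s))) j
      simpa using this
    · obtain ⟨e, he, he1, -⟩ := exists_extension hT ha hab hb g hg
      exact ⟨e, he, he1⟩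
  · ext g
    refine ⟨?_, fun hg => ?_⟩
    · rintro ⟨e, he, hge⟩ j s
      rw [hge]
      have := mem_blockAlgebra_of_mem_fibreAlgebra hT (mem_fibreAlgebra_of_mem_modelAlgebra hT he
        (Function.update (fun k => ⟨0, le_rfl, (D.ε_pos k).le⟩) j (D.incl (ha j) (hb j) s))) j
      simpa using this
    · choose e he he1 he2 using fun j => exists_extension hT (ha j) (hab j) (hb j) (g j) (hg j)
      -- Each summand vanishes outside its own block, so the blocks can be prescribed independently.
      refine ⟨∑ j, e j, modelAlgebra_sum _ fun j _ => he j, fun j s => ?_⟩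
      rw [Finset.sum_apply, Finset.sum_eq_single j (fun j' _ hj => he2 j' j hj.symm) (by simp)]
      exact he1 j s
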